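/- For $\theta<1$ let $q_+=(1+\sqrt{1-\theta})/6$. To $q=(q_1,q_2,q_3)\in H^1(-1,1)^3$ associate $$Q=\begin{pmatrix}-2q_1&0&0\\0&q_1-q_2&q_3\\0&q_3&q_1+q_2\end{pmatrix},$$ and let $\mathcal H$ be the set of those $q$ with $q_1(\pm1)=q_+$, $q_2(\pm1)=\mp3q_+$, $q_3(\pm1)=0$. For $\lambda>0$ put $$E_\lambda(Q)=\int_{-1}^1\Big(\frac1{2\lambda^2}|Q'|^2+\frac\theta6|Q|^2-\frac23\mathrm{tr}(Q^3)+\frac18|Q|^4+c(\theta)\Big)dx,$$ where the constant $c(\theta)$ makes the minimum of the bulk density over symmetric traceless matrices equal to $0$. Let $\mathcal H^{ee}=\{q\in\mathcal H: q_3\equiv0\}$ and $E^{ee}_\lambda=E_\lambda|_{\mathcal H^{ee}}$. For $\chi\in\mathcal H^{ee}$ write $\Phi[h_1,h_2]=D^2E_\lambda(\chi)[(h_1,h_2,0)]$ and $\Psi[h]=D^2E_\lambda(\chi)[(0,0,h)]$, and let $$\nu=\inf_{0\ne(h_1,h_2)\in H^1_0(-1,1)^2}\frac{\Phi[h_1,h_2]}{\int_{-1}^1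 (h_1^2+h_2^2)},\qquad \mu=\inf_{0\ne h\in H^1_0(-1,1)}\frac{\Psi[h]}{\int_{-1}^1 h^2}.$$ The branch of eigenvalue exchange solutions at temperature $\theta$ is the smooth map $(0,\lambda_*)\ni\lambda\mapsto\chi_\lambda\in\mathcal H^{ee}$, $\lambda_*\in(0,+\infty]$, such that for all sufficiently small $\lambda$ the configuration $\chi_\lambda$ is the unique critical point of $E_\lambda$ in $\mathcal H$; every $\chi_\lambda$ is a critical point of $E^{ee}_\lambda$ with $\nu(\lambda)>0$; and either $\lambda_*=+\infty$ or $\nu(\lambda)\to0$ as $\lambda\to\lambda_*^-$. Here $\nu(\lambda)$, $\mu(\lambda)$ denote $\nu,\mu$ at $\chi=\chi_\lambda$. Consider the following conditions on $\theta$: (i) there exists $\lambda\in(0,\lambda_*)$ with $\mu(\lambda)<0$; (ii) with $\lambda_c=\inf\{\lambda\in(0,\lambda_*):\mu(\lambda)<0\}$, one has $\mu(\lambda)>0$ for all $\lambda\in(0,\lambda_c)$ and $\mu'(\lambda_c)<0$. If $\theta_0<1$ satisfies (i)–(ii), then there exists $\varepsilon>0$ such that for every $\theta<1$ with $|\theta-\theta_0|<\varepsilon$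 the branch of eigenvalue exchange solutions exists and $\theta$ satisfies (i)–(ii). -/

import Mathlib

open MeasureTheory Filter Topology

noncomputable section

namespace FrustratedCell

/-! ### The Sobolev space `H¹(-1,1)` -/

/-- `L²(-1,1)` (the endpoint `1` is a null set). -/
abbrev L2 : Type := Lp ℝ 2 (volume.restrict (Set.Ioc (-1 : ℝ) 1))

theorem L2.intervalIntegrable (v : L2) (x : Set.Icc (-1 : ℝ) 1) :
    IntervalIntegrable (fun t => v t) volume (-1) x := by
  rw [intervalIntegrable_iff_integrableOn_Ioc_of_le x.2.1]
  have h : IntegrableOn (fun t => v t) (Set.Ioc (-1 : ℝ) 1) volume :=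
    (Lp.memLp v).integrable (by norm_num)
  exact h.mono_set (Set.Ioc_subset_Ioc_right x.2.2)

theorem L2.integral_congr {f g : ℝ → ℝ}
    (h : f =ᵐ[volume.restrict (Set.Ioc (-1 : ℝ) 1)] g) (x : Set.Icc (-1 : ℝ) 1) :
    ∫ t in (-1 : ℝ)..x, f t = ∫ t in (-1 : ℝ)..x, g t := by
  rw [intervalIntegral.integral_of_le x.2.1, intervalIntegral.integral_of_le x.2.1]
  exact integral_congr_ae
    (ae_restrict_of_ae_restrict_of_subset (Set.Ioc_subset_Ioc_right x.2.2) h)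

/-- `H¹(-1,1)`: the pairs `(u, v)` of a continuous function `u` on `[-1,1]` and a function
`v ∈ L²(-1,1)` such that `u` is a primitive of `v`; thus `u` is the continuous representative
of an `H¹` function and `v = u'` is its weak derivative. The norm inherited from
`C([-1,1]) × L²(-1,1)` is equivalent to the usual `H¹` norm. -/
def h1Submodule : Submodule ℝ (C(Set.Icc (-1 : ℝ) 1, ℝ) × L2) where
  carrier := {p | ∀ x : Set.Icc (-1 : ℝ) 1,
    p.1 x = p.1 ⟨-1, by norm_num⟩ + ∫ t in (-1 : ℝ)..x, p.2 t}
  zero_mem' := by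
    intro x
    have h := L2.integral_congr (Lp.coeFn_zero ℝ 2 (volume.restrict (Set.Ioc (-1 : ℝ) 1))) x
    simp only [Prod.fst_zero, Prod.snd_zero, ContinuousMap.zero_apply]
    rw [h]
    simp
  add_mem' := by
    intro p q hp hq x
    have h := L2.integral_congr (Lp.coeFn_add p.2 q.2) x
    simp only [Prod.fst_add, Prod.snd_add, ContinuousMap.add_apply]
    rw [h]
    simp only [Pi.add_apply]
    rw [intervalIntegral.integral_add (L2.intervalIntegrable p.2 x)
      (L2.intervalIntegrable q.2 x), hp x, hq x]
    ring
  smul_mem' := by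
    intro c p hp x
    have h := L2.integral_congr (Lp.coeFn_smul c p.2) x
    simp only [Prod.smul_fst, Prod.smul_snd, ContinuousMap.smul_apply, smul_eq_mul]
    rw [h]
    simp only [Pi.smul_apply, smul_eq_mul]
    rw [intervalIntegral.integral_const_mul, hp x]
    ring

/-- The normed space `H¹(-1,1)`. -/
abbrev H1 : Type := h1Submodule

/-- The value at `x ∈ [-1,1]` of (the continuous representative of) `u ∈ H¹(-1,1)`. -/
def H1.val (u : H1) (x : ℝ) : ℝ := u.1.1 (Set.projIcc (-1) 1 (by norm_num) x)

/-- The weak derivative `u'` of `u ∈ H¹(-1,1)`. -/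
def H1.weakDeriv (u : H1) (x : ℝ) : ℝ := u.1.2 x

/-- `u ∈ H¹₀(-1,1)`. -/
def H1.IsH10 (u : H1) : Prop := u.val (-1) = 0 ∧ u.val 1 = 0

/-! ### The Landau-de Gennes energy -/

/-- The `Q`-tensor with coordinates `(q₁, q₂, q₃)`. -/
def qTensor (q₁ q₂ q₃ : ℝ) : Matrix (Fin 3) (Fin 3) ℝ :=
  !![-2 * q₁, 0, 0; 0, q₁ - q₂, q₃; 0, q₃, q₁ + q₂]

/-- `|Q|²`. -/
def normSq (Q : Matrix (Fin 3) (Fin 3) ℝ) : ℝ := (Q.transpose * Q).trace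

/-- The bulk energy density at reduced temperature `θ`, without its additive constant. -/
def bulk₀ (θ : ℝ) (Q : Matrix (Fin 3) (Fin 3) ℝ) : ℝ :=
  θ / 6 * normSq Q - 2 / 3 * (Q * Q * Q).trace + 1 / 8 * normSq Q ^ 2

/-- The bulk energy density `f`, normalised so that its minimum over all symmetric traceless
matrices is `0`. -/
def bulk (θ : ℝ) (Q : Matrix (Fin 3) (Fin 3) ℝ) : ℝ :=
  bulk₀ θ Q - sInf (bulk₀ θ '' {P | P.IsSymm ∧ P.trace = 0})

/-- The coordinate functions `(q₁, q₂, q₃) ∈ H¹(-1,1)³` of a `Q`-tensor valued map. -/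
abbrev Config : Type := H1 × H1 × H1

/-- The energy `E_λ(Q) = ∫_{-1}^1 ( |Q'|² / (2 λ²) + f(Q) ) dx`, with `lam = λ`. -/
def energy (θ lam : ℝ) (q : Config) : ℝ :=
  ∫ x in (-1 : ℝ)..1,
    (1 / (2 * lam ^ 2) *
        normSq (qTensor (q.1.weakDeriv x) (q.2.1.weakDeriv x) (q.2.2.weakDeriv x)) +
      bulk θ (qTensor (q.1.val x) (q.2.1.val x) (q.2.2.val x)))

/-- `q₊ = (1 + √(1 - θ)) / 6`. -/
def qPlus (θ : ℝ) : ℝ := (1 + Real.sqrt (1 - θ)) / 6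

/-- The affine space `ℋ` of admissible configurations (boundary conditions). -/
def IsAdmissible (θ : ℝ) (q : Config) : Prop :=
  (q.1.val (-1) = qPlus θ ∧ q.1.val 1 = qPlus θ) ∧
  (q.2.1.val (-1) = 3 * qPlus θ ∧ q.2.1.val 1 = -3 * qPlus θ) ∧
  (q.2.2.val (-1) = 0 ∧ q.2.2.val 1 = 0)

/-- `q` is a critical point of `E_λ` on `ℋ`. -/
def IsCritical (θ lam : ℝ) (q : Config) : Prop :=
  IsAdmissible θ q ∧
    ∀ h : Config, h.1.IsH10 → h.2.1.IsH10 → h.2.2.IsH10 →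
      HasDerivAt (fun t : ℝ => energy θ lam (q + t • h)) 0 0

/-! ### Eigenvalue exchange configurations -/

/-- The configuration `(q₁, q₂, 0)` given by `χ = (q₁, q₂)`. -/
def eeConfig (χ : H1 × H1) : Config := (χ.1, χ.2, 0)

/-- The restricted energy `E_λ^{ee}`. -/
def eeEnergy (θ lam : ℝ) (χ : H1 × H1) : ℝ := energy θ lam (eeConfig χ)

/-- `χ` is a critical point of `E_λ^{ee}` on `ℋ^{ee}`. -/
def IsEECritical (θ lam : ℝ) (χ : H1 × H1) : Prop :=
  IsAdmissible θ (eeConfig χ) ∧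
    ∀ h : H1 × H1, h.1.IsH10 → h.2.IsH10 →
      HasDerivAt (fun t : ℝ => eeEnergy θ lam (χ + t • h)) 0 0

/-- `Φ[h₁, h₂] = D²E_λ(χ)[(h₁, h₂, 0)]`: the second variation under symmetry-preserving
perturbations. -/
def secondVarSP (θ lam : ℝ) (χ h : H1 × H1) : ℝ :=
  iteratedDeriv 2 (fun t : ℝ => energy θ lam (eeConfig χ + t • ((h.1, h.2, 0) : Config))) 0

/-- `Ψ[h] = D²E_λ(χ)[(0, 0, h)]`: the second variation under symmetry-breaking
perturbations. -/
def secondVarSB (θ lam : ℝ) (χ : H1 × H1) (h : H1) : ℝ :=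
  iteratedDeriv 2 (fun t : ℝ => energy θ lam (eeConfig χ + t • ((0, 0, h) : Config))) 0

/-- The first eigenvalue `ν` of `Φ`: infimum of the Rayleigh quotient over `H¹₀(-1,1)²`. -/
def nu (θ lam : ℝ) (χ : H1 × H1) : ℝ :=
  sInf {r : ℝ | ∃ h : H1 × H1, h.1.IsH10 ∧ h.2.IsH10 ∧ h ≠ 0 ∧
    r = secondVarSP θ lam χ h / ∫ x in (-1 : ℝ)..1, (h.1.val x ^ 2 + h.2.val x ^ 2)}

/-- The first eigenvalue `μ` of `Ψ`: infimum of the Rayleigh quotient over `H¹₀(-1,1)`. -/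
def mu (θ lam : ℝ) (χ : H1 × H1) : ℝ :=
  sInf {r : ℝ | ∃ h : H1, h.IsH10 ∧ h ≠ 0 ∧
    r = secondVarSB θ lam χ h / ∫ x in (-1 : ℝ)..1, h.val x ^ 2}

/-! ### The branch of eigenvalue exchange solutions starting at small `λ` -/

/-- The interval `(0, Λ)`, where `Λ` may be `+∞`. -/
def lengthInterval (Λ : EReal) : Set ℝ := {lam : ℝ | 0 < lam ∧ (lam : EReal) < Λ}

/-- `λ ↦ χ_λ`, `λ ∈ (0, Λ)`, is the branch of eigenvalue exchange solutions at temperature `θ`,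
and `Λ` is its endpoint `λ_* ∈ (0, +∞]`: for small `λ`, `χ_λ` is the unique critical point of
`E_λ` on `ℋ`; the branch is smooth and consists of solutions with `ν(λ) > 0`; and it stops
only where `ν` vanishes, that is, `Λ = +∞` or `ν(λ) → 0` as `λ → Λ`. -/
structure IsEEBranch (θ : ℝ) (Λ : EReal) (χ : ℝ → H1 × H1) : Prop where
  starts : ∃ lam₀ : ℝ, 0 < lam₀ ∧ (lam₀ : EReal) ≤ Λ ∧
    ∀ lam ∈ Set.Ioo 0 lam₀, ∀ q : Config, IsCritical θ lam q ↔ q = eeConfig (χ lam)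
  smooth : ContDiffOn ℝ (⊤ : ℕ∞) χ (lengthInterval Λ)
  solution : ∀ lam ∈ lengthInterval Λ, IsEECritical θ lam (χ lam)
  nu_pos : ∀ lam ∈ lengthInterval Λ, 0 < nu θ lam (χ lam)
  endpoint : Λ = ⊤ ∨ ∃ L : ℝ, Λ = (L : EReal) ∧
    Tendsto (fun lam => nu θ lam (χ lam)) (𝓝[<] L) (𝓝 0)

/-- `λ_c = inf {λ ∈ (0, Λ) : μ(λ) < 0}`. -/
def criticalLength (θ : ℝ) (Λ : EReal) (χ : ℝ → H1 × H1) : ℝ :=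
  sInf {lam : ℝ | lam ∈ lengthInterval Λ ∧ mu θ lam (χ lam) < 0}

/-- The conditions for a nondegenerate symmetry-breaking loss of stability at `λ_c`. -/
structure BifurcationConditions (θ : ℝ) (Λ : EReal) (χ : ℝ → H1 × H1) : Prop where
  exists_neg : ∃ lam ∈ lengthInterval Λ, mu θ lam (χ lam) < 0
  pos_before : ∀ lam ∈ Set.Ioo 0 (criticalLength θ Λ χ), 0 < mu θ lam (χ lam)
  deriv_neg : deriv (fun lam => mu θ lam (χ lam)) (criticalLength θ Λ χ) < 0

end FrustratedCell

end

/-!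
The Euler–Lagrange system on `(-1,1)` is semilinear. Parametrising `H¹₀(-1,1)` by the derivative,
that is, by the Hilbert space `X` of mean-zero functions in `L²(-1,1)`, and expressing the bulk term
by its Riesz representative, a pair `w` of derivatives describes an eigenvalue exchange solution if
and only if `residual (θ, λ) w = w + λ² • eeForce θ w = 0` (`isEECritical_iff`). This map is smooth
in `(θ, λ, w)` for `θ < 1`, makes sense at `λ = 0`, where its only zero is `0`, and its partial
derivative in `w` represents `λ² Φ`. Hence where `ν > 0` the Lax–Milgram and implicit function
theorems describe all nearby solutions, at all nearby `(θ, λ)` (`IsNondeg.exists_local`).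

*The branch.* A continuous family of solutions with `ν > 0` starting at `λ = 0` is unique, and can
be continued to a maximal one (`maxPath`). The Dirichlet form bounds solutions a priori and bounded
sequences of solutions are precompact, because the force only sees the values of the configuration,
which depend compactly on its derivatives; therefore `ν → 0` at a finite endpoint
(`tendsto_specSP_maxPath`). For small `λ` the same bounds show that there is exactly one critical
point. So the maximal family is a branch (`isEEBranch_maxPath`). Conversely every branch starts at
`0` and follows every such family as far as that one exists (`IsEEBranch.eq_eeState`).

*The eigenvalue.* One has `μ = (2 / λ²) specSB ((λ² / 2) V)`, where `specSB V` is the lowest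
eigenvalue of the Dirichlet realisation of `-d²/dx² + V` and the potential `V` depends smoothly on
`(θ, w)`. The ground state is simple, so its square depends continuously on `V`; being the
derivative of the concave function `specSB`, it makes `specSB` continuously differentiable
(`contDiff_specSB`).

*Persistence.* At `θ₀` the critical length is a zero of `μ` at which `μ` has negative derivative. On
a neighbourhood of that point, in `(θ, λ)`, the derivative of `μ` in `λ` stays negative; on the
remaining part of `[0, λ_c]` the scaled quantity `λ² μ / 2` is bounded below by a positive constant,
including at `λ = 0`. Both properties, and the family of solutions up to a point slightly past the
critical length, are stable under small changes of `θ` (`eventually_bifurcationConditions`).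
-/

noncomputable section

namespace FrustratedCell

/-! ### Primitives of `L²` functions and the space `H¹₀(-1,1)` -/

/-- The Banach algebra `C([-1,1])`. -/
abbrev CI : Type := C(Set.Icc (-1 : ℝ) 1, ℝ)

/-- The left endpoint of `[-1,1]`. -/
abbrev leftEnd : Set.Icc (-1 : ℝ) 1 := ⟨-1, by norm_num⟩

/-- The right endpoint of `[-1,1]`. -/
abbrev rightEnd : Set.Icc (-1 : ℝ) 1 := ⟨1, by norm_num⟩

theorem L2.integrableOn (v : L2) : IntegrableOn (fun t => v t) (Set.Ioc (-1 : ℝ) 1) volume :=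
  (Lp.memLp v).integrable (by norm_num)

theorem L2.intervalIntegrable' (v : L2) : IntervalIntegrable (fun t => v t) volume (-1) 1 :=
  L2.intervalIntegrable v rightEnd

/-- Cauchy–Schwarz on `[a,b]`: primitives of `L²` functions are Hölder continuous with
exponent `1/2`. -/
theorem L2.abs_integral_le (v : L2) {a b : ℝ} (ha : -1 ≤ a) (hab : a ≤ b) (hb : b ≤ 1) :
    |∫ t in a..b, v t| ≤ Real.sqrt (b - a) * ‖v‖ := by
  have hsub : Set.Ioc a b ⊆ Set.Ioc (-1) 1 := Set.Ioc_subset_Ioc ha hb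
  have hμ : (volume.restrict (Set.Ioc (-1 : ℝ) 1)) (Set.Ioc a b) = ENNReal.ofReal (b - a) := by
    rw [Measure.restrict_apply measurableSet_Ioc, Set.inter_eq_left.2 hsub, Real.volume_Ioc]
  have hne : (volume.restrict (Set.Ioc (-1 : ℝ) 1)) (Set.Ioc a b) ≠ ⊤ := by
    rw [hμ]; exact ENNReal.ofReal_ne_top
  have h1 := MeasureTheory.L2.inner_indicatorConstLp_one (𝕜 := ℝ)
    (measurableSet_Ioc (a := a) (b := b)) hne v
  have h2 : ∫ x in Set.Ioc a b, v x ∂(volume.restrict (Set.Ioc (-1 : ℝ) 1))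
      = ∫ t in a..b, v t := by
    rw [intervalIntegral.integral_of_le hab, Measure.restrict_restrict measurableSet_Ioc,
      Set.inter_eq_left.2 hsub]
  rw [← h2, ← h1]
  refine (abs_real_inner_le_norm _ _).trans ?_
  gcongr
  rw [norm_indicatorConstLp (by norm_num) (by norm_num)]
  simp only [Measure.real, hμ, ENNReal.toReal_ofReal (sub_nonneg.2 hab), norm_one, one_mul]
  rw [Real.sqrt_eq_rpow]; norm_num

/-- The primitive `x ↦ ∫_{-1}^x v` as a continuous function on `[-1,1]`. -/
def primitiveFun (v : L2) : CI where
  toFun x := ∫ t in (-1 : ℝ)..x, v t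
  continuous_toFun := by
    have h := intervalIntegral.continuousOn_primitive_interval
      (μ := volume) (f := fun t => v t) (a := -1) (b := 1)
      (by
        rw [Set.uIcc_of_le (by norm_num), integrableOn_Icc_iff_integrableOn_Ioc]
        exact v.integrableOn)
    rw [Set.uIcc_of_le (by norm_num)] at h
    exact h.domRestrict

theorem primitiveFun_sub (v : L2) (x y : Set.Icc (-1 : ℝ) 1) :
    primitiveFun v y - primitiveFun v x = ∫ t in (x : ℝ)..y, v t :=
  intervalIntegral.integral_interval_sub_left (L2.intervalIntegrable v y)
    (L2.intervalIntegrable v x)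

theorem abs_primitiveFun_sub_le (v : L2) (x y : Set.Icc (-1 : ℝ) 1) :
    |primitiveFun v y - primitiveFun v x| ≤ Real.sqrt |(y : ℝ) - x| * ‖v‖ := by
  wlog h : (x : ℝ) ≤ y generalizing x y
  · rw [abs_sub_comm, abs_sub_comm (y : ℝ)]; exact this y x (le_of_not_ge h)
  rw [primitiveFun_sub, abs_of_nonneg (sub_nonneg.2 h)]
  exact v.abs_integral_le x.2.1 h y.2.2

theorem primitiveFun_left (v : L2) : primitiveFun v leftEnd = 0 := by
  show ∫ t in (-1 : ℝ)..(-1 : ℝ), v t = 0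
  simp

theorem norm_primitiveFun_le (v : L2) : ‖primitiveFun v‖ ≤ Real.sqrt 2 * ‖v‖ := by
  refine (ContinuousMap.norm_le _ (by positivity)).2 fun x => ?_
  have h := abs_primitiveFun_sub_le v leftEnd x
  rw [primitiveFun_left, sub_zero] at h
  refine h.trans ?_
  gcongr
  rw [abs_le]
  constructor <;> linarith [x.2.1, x.2.2]

/-- The primitive vanishing at `-1`, as a bounded operator `L²(-1,1) → C([-1,1])`. -/
def primitive : L2 →L[ℝ] CI :=
  LinearMap.mkContinuous
    { toFun := primitiveFun
      map_add' := by
        intro v w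
        ext x
        show ∫ t in (-1 : ℝ)..x, (v + w : L2) t
          = (∫ t in (-1 : ℝ)..x, v t) + ∫ t in (-1 : ℝ)..x, w t
        rw [L2.integral_congr (Lp.coeFn_add v w) x]
        exact intervalIntegral.integral_add (L2.intervalIntegrable v x)
          (L2.intervalIntegrable w x)
      map_smul' := by
        intro c v
        ext x
        show ∫ t in (-1 : ℝ)..x, (c • v : L2) t = c * ∫ t in (-1 : ℝ)..x, v t
        rw [L2.integral_congr (Lp.coeFn_smul c v) x]
        simp }
    (Real.sqrt 2) norm_primitiveFun_le

theorem primitive_left (v : L2) : primitive v leftEnd = 0 := primitiveFun_left v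

theorem norm_primitive_le (v : L2) : ‖primitive v‖ ≤ Real.sqrt 2 * ‖v‖ := norm_primitiveFun_le v

theorem abs_primitive_sub_le (v : L2) (x y : Set.Icc (-1 : ℝ) 1) :
    |primitive v y - primitive v x| ≤ Real.sqrt |(y : ℝ) - x| * ‖v‖ :=
  abs_primitiveFun_sub_le v x y

/-- An `L²` function is determined by its primitive, by the Lebesgue differentiation theorem. -/
theorem primitive_injective : Function.Injective primitive := by
  refine (injective_iff_map_eq_zero primitive).2 fun v hv => ?_
  have hz : ∀ x ∈ Set.Icc (-1 : ℝ) 1, ∫ t in (-1 : ℝ)..x, v t = 0 := fun x hx =>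
    congrArg (fun g : CI => g ⟨x, hx⟩) hv
  rw [Lp.eq_zero_iff_ae_eq_zero]
  have hd := IntervalIntegrable.ae_hasDerivAt_integral v.intervalIntegrable'
  have hne : ∀ᵐ x : ℝ, x ≠ 1 := by simp [ae_iff, measure_singleton]
  refine (ae_restrict_iff' measurableSet_Ioc).2 ?_
  filter_upwards [hd, hne] with x hx hx1 hxm
  have hx' := hx (by rw [Set.uIcc_of_le (by norm_num)]; exact ⟨hxm.1.le, hxm.2⟩) (-1) (by simp)
  have hloc : (fun y => ∫ t in (-1 : ℝ)..y, v t) =ᶠ[𝓝 x] fun _ => 0 := by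
    filter_upwards [Ioo_mem_nhds hxm.1 (lt_of_le_of_ne hxm.2 hx1)] with y hy
    exact hz y ⟨hy.1.le, hy.2.le⟩
  exact hx'.unique ((hasDerivAt_const x (0 : ℝ)).congr_of_eventuallyEq hloc)

/-- `v ↦ ∫_{-1}^1 v`. -/
def totalIntegral : L2 →L[ℝ] ℝ := (ContinuousMap.evalCLM ℝ rightEnd).comp primitive

/-- The Hilbert space of mean-zero functions in `L²(-1,1)`. Taking the derivative identifies
`H¹₀(-1,1)`, with the norm `(∫ |u'|²)^{1/2}`, with this space. -/
def X : Type := totalIntegral.ker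

instance : NormedAddCommGroup X := inferInstanceAs (NormedAddCommGroup totalIntegral.ker)

instance : InnerProductSpace ℝ X := inferInstanceAs (InnerProductSpace ℝ totalIntegral.ker)

instance : CompleteSpace X := ContinuousLinearMap.completeSpace_ker totalIntegral

/-- The inclusion of the mean-zero functions into `L²(-1,1)`. -/
def toL2 : X →L[ℝ] L2 := totalIntegral.ker.subtypeL

theorem toL2_injective : Function.Injective toL2 := Subtype.val_injective

theorem norm_toL2 (w : X) : ‖toL2 w‖ = ‖w‖ := rfl

theorem inner_toL2 (v w : X) : inner ℝ (toL2 v) (toL2 w) = inner ℝ v w := rfl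

theorem totalIntegral_toL2 (w : X) : totalIntegral (toL2 w) = 0 := w.2

theorem exists_toL2_eq {v : L2} (hv : totalIntegral v = 0) : ∃ w : X, toL2 w = v := ⟨⟨v, hv⟩, rfl⟩

/-- The `H¹₀` function with derivative `w`. -/
def prim : X →L[ℝ] CI := primitive.comp toL2

theorem prim_apply (w : X) (x : Set.Icc (-1 : ℝ) 1) :
    prim w x = ∫ t in (-1 : ℝ)..x, toL2 w t := rfl

theorem prim_left (w : X) : prim w leftEnd = 0 := primitive_left _

theorem prim_right (w : X) : prim w rightEnd = 0 := totalIntegral_toL2 w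

theorem prim_injective : Function.Injective prim :=
  primitive_injective.comp toL2_injective

theorem norm_prim_le (w : X) : ‖prim w‖ ≤ Real.sqrt 2 * ‖w‖ := norm_primitive_le _

/-- The compact embedding of `H¹₀(-1,1)` into `C([-1,1])`. -/
theorem exists_subseq_tendsto_prim {w : ℕ → X} {R : ℝ} (hw : ∀ n, ‖w n‖ ≤ R) :
    ∃ (g : CI) (φ : ℕ → ℕ), StrictMono φ ∧ Tendsto (fun n => prim (w (φ n))) atTop (𝓝 g) := by
  have hR : 0 ≤ R := (norm_nonneg _).trans (hw 0)
  let e := ContinuousMap.isometryEquivBoundedOfCompact (Set.Icc (-1 : ℝ) 1) ℝ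
  let S : Set (BoundedContinuousFunction (Set.Icc (-1 : ℝ) 1) ℝ) :=
    Set.range fun n => e (prim (w n))
  have hc : IsCompact (closure S) := by
    refine BoundedContinuousFunction.arzela_ascoli (Metric.closedBall (0 : ℝ) (Real.sqrt 2 * R))
      (isCompact_closedBall _ _) S ?_ ?_
    · rintro f x ⟨n, rfl⟩
      rw [mem_closedBall_zero_iff]
      refine ((prim (w n)).norm_coe_le_norm x).trans ((norm_prim_le _).trans ?_)
      gcongr
      exact hw n
    · refine Metric.equicontinuous_of_continuity_modulus (fun d => Real.sqrt d * R) ?_ _ ?_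
      · have : ContinuousAt (fun d : ℝ => Real.sqrt d * R) 0 := by fun_prop
        simpa [ContinuousAt] using this
      · rintro x y ⟨f, n, rfl⟩
        rw [dist_comm, Real.dist_eq, Subtype.dist_eq, dist_comm, Real.dist_eq]
        refine (abs_primitive_sub_le (toL2 (w n)) x y).trans ?_
        gcongr
        exact hw n
  obtain ⟨a, -, φ, hφ, hlim⟩ := hc.tendsto_subseq
    (x := fun n => e (prim (w n))) fun n => subset_closure ⟨n, rfl⟩
  refine ⟨e.symm a, φ, hφ, ?_⟩
  have := (e.symm.continuous.tendsto a).comp hlim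
  simpa [Function.comp_def] using this

theorem continuous_comp_projIcc (g : CI) :
    Continuous fun x : ℝ => g (Set.projIcc (-1) 1 (by norm_num) x) :=
  g.continuous.comp continuous_projIcc

/-! ### Integration of continuous functions and the dual of the embedding -/

/-- `g ↦ ∫_{-1}^1 g`, on `C([-1,1])`. -/
def integ : CI →L[ℝ] ℝ :=
  LinearMap.mkContinuous
    { toFun := fun g => ∫ x in (-1 : ℝ)..1, g (Set.projIcc (-1) 1 (by norm_num) x)
      map_add' := by
        intro f g
        exact intervalIntegral.integral_add
          ((continuous_comp_projIcc f).intervalIntegrable _ _)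
          ((continuous_comp_projIcc g).intervalIntegrable _ _)
      map_smul' := by
        intro c f
        simp }
    2 (by
      intro f
      have := intervalIntegral.norm_integral_le_of_norm_le_const (a := -1) (b := 1) (C := ‖f‖)
        (f := fun x => f (Set.projIcc (-1) 1 (by norm_num) x))
        (fun x _ => f.norm_coe_le_norm _)
      simpa [mul_comm, show |(1 : ℝ) + 1| = 2 by norm_num] using this)

theorem integ_apply (g : CI) :
    integ g = ∫ x in (-1 : ℝ)..1, g (Set.projIcc (-1) 1 (by norm_num) x) := rfl

theorem intervalIntegrable_projIcc (g : CI) :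
    IntervalIntegrable (fun x => g (Set.projIcc (-1) 1 (by norm_num) x)) volume (-1) 1 :=
  (continuous_comp_projIcc g).intervalIntegrable _ _

theorem integ_mono {f g : CI} (h : f ≤ g) : integ f ≤ integ g :=
  intervalIntegral.integral_mono_on (by norm_num) (intervalIntegrable_projIcc f)
    (intervalIntegrable_projIcc g) fun _ _ => h _

theorem integ_nonneg {f : CI} (h : 0 ≤ f) : 0 ≤ integ f := by
  simpa using integ_mono h

theorem integ_const (c : ℝ) : integ (ContinuousMap.const _ c) = 2 * c := by
  simp [integ_apply]; norm_num

theorem abs_integ_le (f : CI) : |integ f| ≤ 2 * ‖f‖ := by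
  have h := integ.le_opNorm f
  rw [Real.norm_eq_abs] at h
  refine h.trans ?_
  gcongr
  exact LinearMap.mkContinuous_norm_le _ (by norm_num) _

theorem integ_sq_nonneg (f : CI) : 0 ≤ integ (f * f) :=
  integ_nonneg fun _ => mul_self_nonneg _

theorem integ_sq_pos {f : CI} (hf : f ≠ 0) : 0 < integ (f * f) := by
  refine lt_of_le_of_ne (integ_sq_nonneg f) fun h => hf ?_
  have hc : Continuous fun x => (f * f) (Set.projIcc (-1) 1 (by norm_num) x) :=
    (f * f).continuous.comp continuous_projIcc
  have hz := (intervalIntegral.integral_eq_zero_iff_of_le_of_nonneg_ae (by norm_num : (-1 : ℝ) ≤ 1)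
    (ae_of_all _ fun x => mul_self_nonneg _) (hc.intervalIntegrable _ _)).1
    ((integ_apply (f * f)).symm.trans h.symm)
  have hz' := Measure.eqOn_Ioc_of_ae_eq (μ := volume) hz hc.continuousOn continuousOn_const
  have h0 : Set.EqOn (fun x => (f * f) (Set.projIcc (-1) 1 (by norm_num) x)) (fun _ => 0)
      (Set.Icc (-1 : ℝ) 1) := by
    have := hz'.closure hc continuous_const
    rwa [closure_Ioc (by norm_num)] at this
  ext x
  have := h0 x.2
  simpa using this

/-- `|∫ f g²| ≤ ‖f‖ ∫ g²`. -/
theorem abs_integ_mul_sq_le (f g : CI) : |integ (f * (g * g))| ≤ ‖f‖ * integ (g * g) := by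
  have key : ∀ f : CI, integ (f * (g * g)) ≤ ‖f‖ * integ (g * g) := by
    intro f
    have : integ (f * (g * g)) ≤ integ (‖f‖ • (g * g)) := by
      refine integ_mono fun x => ?_
      exact mul_le_mul_of_nonneg_right ((le_abs_self _).trans (f.norm_coe_le_norm x))
        (mul_self_nonneg _)
    simpa using this
  refine abs_le.2 ⟨?_, key f⟩
  have := key (-f)
  rw [neg_mul, map_neg, norm_neg] at this
  linarith

/-- The operator `J` with `⟪J g, k⟫ = ∫ g · prim k`: if `u = prim (J g)`, then `-u'' = g` weakly,
with `u(±1) = 0`. -/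
def J : CI →L[ℝ] X :=
  LinearMap.mkContinuous
    { toFun := fun g => (InnerProductSpace.toDual ℝ X).symm
        ((integ.comp (ContinuousLinearMap.mul ℝ CI g)).comp prim)
      map_add' := by
        intro f g
        rw [← map_add]
        congr 1
        ext k
        simp
      map_smul' := by
        intro c f
        apply ext_inner_right ℝ
        intro k
        simp only [RingHom.id_apply, inner_smul_left, InnerProductSpace.toDual_symm_apply]
        simp }
    (‖integ‖ * ‖prim‖) (by
      intro g
      show ‖(InnerProductSpace.toDual ℝ X).symm _‖ ≤ _
      rw [LinearIsometryEquiv.norm_map]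
      refine (ContinuousLinearMap.opNorm_comp_le _ _).trans ?_
      rw [mul_right_comm]
      gcongr
      refine (ContinuousLinearMap.opNorm_comp_le _ _).trans ?_
      gcongr
      exact ContinuousLinearMap.opNorm_mul_apply_le ℝ CI g)

theorem inner_J (g : CI) (k : X) : inner ℝ (J g) k = integ (g * prim k) := by
  show inner ℝ ((InnerProductSpace.toDual ℝ X).symm _) k = _
  rw [InnerProductSpace.toDual_symm_apply]
  rfl

theorem integ_prim_sq_le (w : X) : integ (prim w * prim w) ≤ 4 * ‖w‖ ^ 2 := by
  have h := abs_integ_le (prim w * prim w)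
  have h1 : ‖prim w * prim w‖ ≤ (Real.sqrt 2 * ‖w‖) * (Real.sqrt 2 * ‖w‖) :=
    (norm_mul_le _ _).trans (mul_le_mul (norm_prim_le w) (norm_prim_le w) (norm_nonneg _)
      (by positivity))
  have h2 : Real.sqrt 2 * Real.sqrt 2 = 2 := Real.mul_self_sqrt (by norm_num)
  have h3 : (Real.sqrt 2 * ‖w‖) * (Real.sqrt 2 * ‖w‖) = 2 * ‖w‖ ^ 2 := by
    rw [mul_mul_mul_comm, h2]; ring
  linarith [le_abs_self (integ (prim w * prim w))]

/-! ### Integration by parts -/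

theorem L2.inner_eq (v w : L2) : inner ℝ v w = ∫ x in (-1 : ℝ)..1, v x * w x := by
  rw [MeasureTheory.L2.inner_def, intervalIntegral.integral_of_le (by norm_num)]
  refine integral_congr_ae (ae_of_all _ fun x => ?_)
  simp [mul_comm]

/-- A continuous function on `[-1,1]`, as an element of `L²(-1,1)`. -/
def ofCont (f : CI) : L2 :=
  MemLp.toLp (fun x => f (Set.projIcc (-1) 1 (by norm_num) x))
    (MemLp.of_bound (continuous_comp_projIcc f).aestronglyMeasurable ‖f‖
      (ae_of_all _ fun _ => f.norm_coe_le_norm _))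

theorem ofCont_ae (f : CI) : (ofCont f : ℝ → ℝ)
    =ᵐ[volume.restrict (Set.Ioc (-1 : ℝ) 1)] fun x => f (Set.projIcc (-1) 1 (by norm_num) x) :=
  MemLp.coeFn_toLp _

theorem integral_congr_L2 {f g : ℝ → ℝ}
    (h : f =ᵐ[volume.restrict (Set.Ioc (-1 : ℝ) 1)] g) :
    ∫ t in (-1 : ℝ)..1, f t = ∫ t in (-1 : ℝ)..1, g t :=
  L2.integral_congr h rightEnd

theorem inner_ofCont (f : CI) (v : L2) :
    inner ℝ (ofCont f) v = ∫ x in (-1 : ℝ)..1, f (Set.projIcc (-1) 1 (by norm_num) x) * v x := by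
  rw [L2.inner_eq]
  refine integral_congr_L2 ?_
  filter_upwards [ofCont_ae f] with x hx
  rw [hx]

theorem inner_ofCont_one (v : L2) : inner ℝ (ofCont 1) v = totalIntegral v := by
  rw [inner_ofCont]
  simp only [ContinuousMap.one_apply, one_mul]
  rfl

/-- The primitive `x ↦ ∫_{-1}^x g` of a continuous function, as an element of `C([-1,1])`. -/
def contPrimitive (g : CI) : CI where
  toFun x := ∫ t in (-1 : ℝ)..x, g (Set.projIcc (-1) 1 (by norm_num) t)
  continuous_toFun := by
    have := intervalIntegral.continuous_primitive
      (fun a b => (continuous_comp_projIcc g).intervalIntegrable (μ := volume) a b) (-1)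
    exact this.comp continuous_subtype_val

theorem integ_mul_prim (g : CI) (k : X) :
    integ (g * prim k) = -inner ℝ (ofCont (contPrimitive g)) (toL2 k) := by
  set gR : ℝ → ℝ := fun t => g (Set.projIcc (-1) 1 (by norm_num) t) with hgR
  have hg : IntervalIntegrable gR volume (-1) 1 := intervalIntegrable_projIcc g
  have hk := L2.intervalIntegrable' (toL2 k)
  have hgac := hg.absolutelyContinuousOnInterval_intervalIntegral (c := -1) (by simp)
  have hkac := hk.absolutelyContinuousOnInterval_intervalIntegral (c := -1) (by simp)
  have hparts := hgac.integral_mul_deriv_eq_deriv_mul hkac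
  have hk1 : ∫ t in (-1 : ℝ)..1, (toL2 k) t = 0 := prim_right k
  have e1 : ∫ x in (-1 : ℝ)..1, (∫ t in (-1 : ℝ)..x, gR t) *
      deriv (fun x => ∫ t in (-1 : ℝ)..x, (toL2 k) t) x
      = inner ℝ (ofCont (contPrimitive g)) (toL2 k) := by
    rw [inner_ofCont]
    refine intervalIntegral.integral_congr_ae ?_
    filter_upwards [hk.ae_hasDerivAt_integral] with x hx hxm
    rw [Set.uIoc_of_le (by norm_num)] at hxm
    have hxI : x ∈ Set.Icc (-1 : ℝ) 1 := ⟨hxm.1.le, hxm.2⟩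
    rw [(hx (by rwa [Set.uIcc_of_le (by norm_num)]) (-1) (by simp)).deriv,
      Set.projIcc_of_mem _ hxI]
    rfl
  have e2 : ∫ x in (-1 : ℝ)..1, deriv (fun x => ∫ t in (-1 : ℝ)..x, gR t) x *
      (∫ t in (-1 : ℝ)..x, (toL2 k) t) = integ (g * prim k) := by
    rw [integ_apply]
    refine intervalIntegral.integral_congr_ae ?_
    filter_upwards [hg.ae_hasDerivAt_integral] with x hx hxm
    rw [Set.uIoc_of_le (by norm_num)] at hxm
    have hxI : x ∈ Set.Icc (-1 : ℝ) 1 := ⟨hxm.1.le, hxm.2⟩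
    rw [(hx (by rwa [Set.uIcc_of_le (by norm_num)]) (-1) (by simp)).deriv]
    simp only [hgR, ContinuousMap.mul_apply, Set.projIcc_of_mem _ hxI, prim_apply]
  rw [e1, e2, hk1] at hparts
  simp at hparts
  linarith

/-- `(J g)(x) = c - ∫_{-1}^x g` for almost every `x`: the difference is orthogonal to all
mean-zero functions. -/
theorem exists_J_eq (g : CI) :
    ∃ c : ℝ, toL2 (J g) = c • ofCont 1 - ofCont (contPrimitive g) := by
  set p := ofCont (contPrimitive g)
  have h1 : totalIntegral (ofCont 1) = 2 := by
    rw [← inner_ofCont_one, inner_ofCont, integral_congr_L2 (g := fun _ => (1 : ℝ))]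
    · norm_num
    · filter_upwards [ofCont_ae 1] with x hx
      rw [hx]; simp
  set c := totalIntegral p / 2
  have hz : totalIntegral (toL2 (J g) + p - c • ofCont 1) = 0 := by
    rw [map_sub, map_add, map_smul, h1, totalIntegral_toL2, smul_eq_mul]
    simp only [c]; ring
  obtain ⟨z, hz⟩ := exists_toL2_eq hz
  have hperp : ∀ k : X, inner ℝ (toL2 z) (toL2 k) = 0 := by
    intro k
    rw [hz, inner_sub_left, inner_add_left, inner_smul_left, inner_ofCont_one, inner_toL2,
      inner_J, totalIntegral_toL2, integ_mul_prim]
    simp [p]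
  have h0 := hperp z
  rw [inner_self_eq_zero, hz, sub_eq_zero] at h0
  refine ⟨c, ?_⟩
  rw [← h0]; abel

/-! ### `H¹₀` functions and admissible configurations -/

theorem H1.eq_add_primitive (u : H1) (x : Set.Icc (-1 : ℝ) 1) :
    u.1.1 x = u.1.1 leftEnd + primitive u.1.2 x := u.2 x

/-- The inclusion of `H¹₀(-1,1)`, parametrised by the derivative, into `H¹(-1,1)`. -/
def emb : X →L[ℝ] H1 :=
  (prim.prod toL2).codRestrict h1Submodule fun w x => by
    show prim w x = prim w leftEnd + _
    rw [prim_left, zero_add]; rfl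

@[simp] theorem emb_fst (w : X) : (emb w).1.1 = prim w := rfl

theorem emb_injective : Function.Injective emb := fun v w h => by
  have : (emb v).1.2 = (emb w).1.2 := by rw [h]
  exact toL2_injective this

theorem H1.val_neg_one (u : H1) : u.val (-1) = u.1.1 leftEnd := by
  simp [H1.val, Set.projIcc_left]

theorem H1.val_one (u : H1) : u.val 1 = u.1.1 rightEnd := by
  simp [H1.val, Set.projIcc_right]

theorem H1.isH10_iff (u : H1) : u.IsH10 ↔ ∃ w : X, u = emb w := by
  rw [H1.IsH10, H1.val_neg_one, H1.val_one]
  constructor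
  · rintro ⟨h0, h1⟩
    have hk : totalIntegral u.1.2 = 0 := by
      have := u.eq_add_primitive rightEnd
      rw [h0, h1, zero_add] at this
      exact this.symm
    obtain ⟨w, hw⟩ := exists_toL2_eq hk
    refine ⟨w, Subtype.ext (Prod.ext ?_ hw.symm)⟩
    ext x
    rw [u.eq_add_primitive x, h0, zero_add, ← hw]
    rfl
  · rintro ⟨w, rfl⟩
    exact ⟨prim_left w, prim_right w⟩

theorem isH10_emb (w : X) : (emb w).IsH10 := (H1.isH10_iff _).2 ⟨w, rfl⟩

/-- The function `x ↦ x` in `C([-1,1])`. -/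
def idC : CI := ⟨fun x => (x : ℝ), continuous_subtype_val⟩

/-- The constant function `1` in `H¹(-1,1)`. -/
def oneH : H1 := ⟨(1, 0), fun x => by
  show (1 : ℝ) = 1 + primitive 0 x
  simp⟩

/-- The function `x ↦ x` in `H¹(-1,1)`. -/
def idH : H1 := ⟨(idC, ofCont 1), fun x => by
  show (x : ℝ) = -1 + ∫ t in (-1 : ℝ)..x, ofCont 1 t
  rw [L2.integral_congr (ofCont_ae 1) x]
  simp⟩

/-- The eigenvalue exchange configuration with boundary values of `ℋ` whose difference to the
affine interpolation of the boundary values has derivative `w`. -/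
def eeState (θ : ℝ) (w : X × X) : H1 × H1 :=
  (qPlus θ • oneH + emb w.1, (-3 * qPlus θ) • idH + emb w.2)

/-- The first coordinate of `eeState`, as a continuous function. -/
def coord₁ (θ : ℝ) (w : X) : CI := qPlus θ • 1 + prim w

/-- The second coordinate of `eeState`, as a continuous function. -/
def coord₂ (θ : ℝ) (w : X) : CI := (-3 * qPlus θ) • idC + prim w

/-- The configurations satisfying the boundary conditions, in the same parametrisation. -/
def state (θ : ℝ) (w : X × X × X) : Config :=
  (qPlus θ • oneH + emb w.1, (-3 * qPlus θ) • idH + emb w.2.1, emb w.2.2)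

theorem isAdmissible_iff (θ : ℝ) (q : Config) : IsAdmissible θ q ↔ ∃ w, q = state θ w := by
  have key : IsAdmissible θ q ↔ (q.1 - qPlus θ • oneH).IsH10 ∧
      (q.2.1 - (-3 * qPlus θ) • idH).IsH10 ∧ q.2.2.IsH10 := by
    simp only [IsAdmissible, H1.IsH10, H1.val_neg_one, H1.val_one]
    have a1 (x) : (q.1 - qPlus θ • oneH).1.1 x = q.1.1.1 x - qPlus θ * 1 := rfl
    have a2 (x) : (q.2.1 - (-3 * qPlus θ) • idH).1.1 x = q.2.1.1.1 x - (-3 * qPlus θ) * x := rfl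
    simp only [a1, a2]
    constructor
    · rintro ⟨⟨h1, h2⟩, ⟨h3, h4⟩, h5⟩
      exact ⟨⟨by linarith, by linarith⟩, ⟨by linarith, by linarith⟩, h5⟩
    · rintro ⟨⟨h1, h2⟩, ⟨h3, h4⟩, h5⟩
      exact ⟨⟨by linarith, by linarith⟩, ⟨by linarith, by linarith⟩, h5⟩
  rw [key, H1.isH10_iff, H1.isH10_iff, H1.isH10_iff]
  constructor
  · rintro ⟨⟨w1, h1⟩, ⟨w2, h2⟩, ⟨w3, h3⟩⟩
    refine ⟨(w1, w2, w3), ?_⟩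
    rw [sub_eq_iff_eq_add'] at h1 h2
    exact Prod.ext h1 (Prod.ext h2 h3)
  · rintro ⟨w, rfl⟩
    exact ⟨⟨w.1, by simp [state]⟩, ⟨w.2.1, by simp [state]⟩, ⟨w.2.2, rfl⟩⟩

theorem eeConfig_eeState (θ : ℝ) (w : X × X) :
    eeConfig (eeState θ w) = state θ (w.1, w.2, 0) := by
  simp [eeConfig, eeState, state]

theorem isAdmissible_eeConfig_iff (θ : ℝ) (χ : H1 × H1) :
    IsAdmissible θ (eeConfig χ) ↔ ∃ w, χ = eeState θ w := by
  rw [isAdmissible_iff]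
  constructor
  · rintro ⟨w, hw⟩
    simp only [eeConfig, state, Prod.mk.injEq] at hw
    exact ⟨(w.1, w.2.1), Prod.ext hw.1 hw.2.1⟩
  · rintro ⟨w, rfl⟩
    exact ⟨_, eeConfig_eeState θ w⟩

/-! ### The bulk energy density in coordinates -/

/-- `|Q|²/2` in coordinates. -/
def rho (a b c : CI) : CI := (3 : ℝ) • (a * a) + b * b + c * c

/-- The bulk energy density without its additive constant, in coordinates. -/
def bulkC (θ : ℝ) (a b c : CI) : CI :=
  θ • (a * a) + (θ / 3) • (b * b + c * c) + (4 : ℝ) • (a * a * a)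
    - (4 : ℝ) • (a * (b * b + c * c)) + (1 / 2 : ℝ) • (rho a b c * rho a b c)

/-- `∂f/∂q₁`. -/
def grad₁ (θ : ℝ) (a b c : CI) : CI :=
  (2 * θ) • a + (12 : ℝ) • (a * a) - (4 : ℝ) • (b * b + c * c) + (6 : ℝ) • (a * rho a b c)

/-- The common factor `W` in `∂f/∂q₂ = W q₂` and `∂f/∂q₃ = W q₃`; for `q₃ = 0` it is also
`∂²f/∂q₃²`. -/
def pot (θ : ℝ) (a b c : CI) : CI :=
  (2 * θ / 3) • 1 - (8 : ℝ) • a + (2 : ℝ) • rho a b c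

/-- `∂²f/∂q₁²`. -/
def hess₁₁ (θ : ℝ) (a b c : CI) : CI :=
  (2 * θ) • 1 + (24 : ℝ) • a + (6 : ℝ) • rho a b c + (36 : ℝ) • (a * a)

/-- `∂²f/∂q₁∂q₂`; by symmetry `∂²f/∂q₁∂q₃` is `hess₁₂ a c`. -/
def hess₁₂ (a b : CI) : CI := (12 : ℝ) • (a * b) - (8 : ℝ) • b

/-- `∂²f/∂q₂²`. -/
def hess₂₂ (θ : ℝ) (a b c : CI) : CI := pot θ a b c + (4 : ℝ) • (b * b)

theorem normSq_qTensor (a b c : ℝ) :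
    normSq (qTensor a b c) = 6 * a ^ 2 + 2 * b ^ 2 + 2 * c ^ 2 := by
  simp [normSq, qTensor, Matrix.trace, Fin.sum_univ_three, Matrix.mul_apply]
  ring

theorem bulk_qTensor (θ a b c : ℝ) : bulk θ (qTensor a b c) =
    θ * (a * a) + (θ / 3) * (b * b + c * c) + 4 * (a * a * a) - 4 * (a * (b * b + c * c))
      + 1 / 2 * ((3 * (a * a) + b * b + c * c) * (3 * (a * a) + b * b + c * c))
      - sInf (bulk₀ θ '' {P | P.IsSymm ∧ P.trace = 0}) := by
  rw [bulk, bulk₀, normSq_qTensor]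
  congr 1
  have : (qTensor a b c * qTensor a b c * qTensor a b c).trace
      = -6 * a ^ 3 + 6 * a * (b ^ 2 + c ^ 2) := by
    simp [qTensor, Matrix.trace, Fin.sum_univ_three]
    ring
  rw [this]
  ring

theorem L2.intervalIntegrable_sq (v : L2) :
    IntervalIntegrable (fun x => v x ^ 2) volume (-1) 1 := by
  rw [intervalIntegrable_iff_integrableOn_Ioc_of_le (by norm_num)]
  exact (Lp.memLp v).integrable_sq

theorem L2.integral_sq (v : L2) : ∫ x in (-1 : ℝ)..1, v x ^ 2 = ‖v‖ ^ 2 := by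
  rw [← real_inner_self_eq_norm_sq, L2.inner_eq]
  simp [sq]

theorem energy_eq (θ lam : ℝ) (q : Config) :
    energy θ lam q = 1 / (2 * lam ^ 2) *
      (6 * ‖q.1.1.2‖ ^ 2 + 2 * ‖q.2.1.1.2‖ ^ 2 + 2 * ‖q.2.2.1.2‖ ^ 2)
      + integ (bulkC θ q.1.1.1 q.2.1.1.1 q.2.2.1.1)
      - 2 * sInf (bulk₀ θ '' {P | P.IsSymm ∧ P.trace = 0}) := by
  set C := sInf (bulk₀ θ '' {P | P.IsSymm ∧ P.trace = 0}) with hC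
  set c1 := 1 / (2 * lam ^ 2)
  set p : ℝ → ℝ := fun x =>
    bulkC θ q.1.1.1 q.2.1.1.1 q.2.2.1.1 (Set.projIcc (-1) 1 (by norm_num) x)
  have hint : energy θ lam q = ∫ x in (-1 : ℝ)..1, (c1 * (6 * q.1.1.2 x ^ 2 + 2 * q.2.1.1.2 x ^ 2
      + 2 * q.2.2.1.2 x ^ 2) + (p x - C)) := by
    refine intervalIntegral.integral_congr fun x _ => ?_
    simp only [normSq_qTensor, bulk_qTensor, ← hC]
    rfl
  have i1 := (q.1.1.2.intervalIntegrable_sq).const_mul 6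
  have i2 := (q.2.1.1.2.intervalIntegrable_sq).const_mul 2
  have i3 := (q.2.2.1.2.intervalIntegrable_sq).const_mul 2
  have ip : IntervalIntegrable p volume (-1) 1 := intervalIntegrable_projIcc _
  have ic : IntervalIntegrable (fun _ : ℝ => C) volume (-1) 1 := intervalIntegrable_const
  rw [hint, intervalIntegral.integral_add (((i1.add i2).add i3).const_mul c1) (ip.sub ic),
    intervalIntegral.integral_const_mul, intervalIntegral.integral_add (i1.add i2) i3,
    intervalIntegral.integral_add i1 i2, intervalIntegral.integral_const_mul,
    intervalIntegral.integral_const_mul, intervalIntegral.integral_const_mul,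
    L2.integral_sq, L2.integral_sq, L2.integral_sq, intervalIntegral.integral_sub ip ic,
    intervalIntegral.integral_const, integ_apply]
  simp only [smul_eq_mul]
  ring

/-! ### First and second variation -/

/-- The first variation `DE_λ(q)[h]`. -/
def firstVar (θ lam : ℝ) (q h : Config) : ℝ :=
  1 / lam ^ 2 * (6 * inner ℝ q.1.1.2 h.1.1.2 + 2 * inner ℝ q.2.1.1.2 h.2.1.1.2
      + 2 * inner ℝ q.2.2.1.2 h.2.2.1.2)
    + integ (grad₁ θ q.1.1.1 q.2.1.1.1 q.2.2.1.1 * h.1.1.1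
      + pot θ q.1.1.1 q.2.1.1.1 q.2.2.1.1 * q.2.1.1.1 * h.2.1.1.1
      + pot θ q.1.1.1 q.2.1.1.1 q.2.2.1.1 * q.2.2.1.1 * h.2.2.1.1)

/-- The quadratic form `D²f(a,b,c)[(h,k,l)]` of the bulk energy density. -/
def hessC (θ : ℝ) (a b c h k l : CI) : CI :=
  hess₁₁ θ a b c * (h * h) + (2 : ℝ) • (hess₁₂ a b * (h * k)) + hess₂₂ θ a b c * (k * k)
    + hess₂₂ θ a c b * (l * l) + (2 : ℝ) • (hess₁₂ a c * (h * l)) + (8 : ℝ) • (b * c * (k * l))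

/-- The second variation `D²E_λ(q)[h]`. -/
def secondVar (θ lam : ℝ) (q h : Config) : ℝ :=
  1 / lam ^ 2 * (6 * ‖h.1.1.2‖ ^ 2 + 2 * ‖h.2.1.1.2‖ ^ 2 + 2 * ‖h.2.2.1.2‖ ^ 2)
    + integ (hessC θ q.1.1.1 q.2.1.1.1 q.2.2.1.1 h.1.1.1 h.2.1.1.1 h.2.2.1.1)

theorem bulkC_line (θ : ℝ) (a b c h k l : CI) : ∃ e₃ e₄ : CI, ∀ t : ℝ,
    bulkC θ (a + t • h) (b + t • k) (c + t • l) = bulkC θ a b c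
      + t • (grad₁ θ a b c * h + pot θ a b c * b * k + pot θ a b c * c * l)
      + (t ^ 2 / 2) • hessC θ a b c h k l + t ^ 3 • e₃ + t ^ 4 • e₄ := by
  refine ⟨(4 : ℝ) • (h * h * h) - (4 : ℝ) • (h * (k * k + l * l))
    + ((6 : ℝ) • (a * h) + (2 : ℝ) • (b * k) + (2 : ℝ) • (c * l)) * rho h k l,
    (1 / 2 : ℝ) • (rho h k l * rho h k l), fun t => ?_⟩
  ext x
  simp only [bulkC, rho, grad₁, pot, hessC, hess₁₁, hess₁₂, hess₂₂, ContinuousMap.add_apply,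
    ContinuousMap.sub_apply, ContinuousMap.smul_apply, ContinuousMap.mul_apply, smul_eq_mul,
    ContinuousMap.one_apply]
  ring

theorem norm_add_smul_sq (t : ℝ) (v w : L2) :
    ‖v + t • w‖ ^ 2 = ‖v‖ ^ 2 + 2 * t * inner ℝ v w + t ^ 2 * ‖w‖ ^ 2 := by
  rw [norm_add_sq_real, inner_smul_right, norm_smul, mul_pow, Real.norm_eq_abs, sq_abs]
  ring

/-- Along a line, the energy is a polynomial of degree four; its coefficients of degree one and two
are the first variation and half the second variation. -/
theorem energy_line (θ lam : ℝ) (q h : Config) : ∃ e₀ e₃ e₄ : ℝ, ∀ t : ℝ,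
    energy θ lam (q + t • h) = e₀ + t * firstVar θ lam q h + t ^ 2 * (secondVar θ lam q h / 2)
      + t ^ 3 * e₃ + t ^ 4 * e₄ := by
  obtain ⟨e₃, e₄, he⟩ := bulkC_line θ q.1.1.1 q.2.1.1.1 q.2.2.1.1 h.1.1.1 h.2.1.1.1 h.2.2.1.1
  refine ⟨energy θ lam q, integ e₃, integ e₄, fun t => ?_⟩
  have s1 : (q + t • h).1.1 = q.1.1 + t • h.1.1 := rfl
  have s2 : (q + t • h).2.1.1 = q.2.1.1 + t • h.2.1.1 := rfl
  have s3 : (q + t • h).2.2.1 = q.2.2.1 + t • h.2.2.1 := rfl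
  rw [energy_eq, energy_eq, s1, s2, s3]
  simp only [Prod.fst_add, Prod.snd_add, Prod.smul_fst, Prod.smul_snd, he, map_add, map_smul,
    norm_add_smul_sq, firstVar, secondVar, smul_eq_mul]
  ring

theorem hasDerivAt_quartic (e₀ e₁ e₂ e₃ e₄ : ℝ) (t : ℝ) :
    HasDerivAt (fun t : ℝ => e₀ + t * e₁ + t ^ 2 * e₂ + t ^ 3 * e₃ + t ^ 4 * e₄)
      (e₁ + 2 * t * e₂ + 3 * t ^ 2 * e₃ + 4 * t ^ 3 * e₄) t := by
  have h1 := (hasDerivAt_id t).mul_const e₁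
  have h2 := (hasDerivAt_pow 2 t).mul_const e₂
  have h3 := (hasDerivAt_pow 3 t).mul_const e₃
  have h4 := (hasDerivAt_pow 4 t).mul_const e₄
  refine (((h1.const_add e₀).add h2).add h3).add h4 |>.congr_deriv ?_
  norm_num

theorem hasDerivAt_energy_line (θ lam : ℝ) (q h : Config) :
    HasDerivAt (fun t : ℝ => energy θ lam (q + t • h)) (firstVar θ lam q h) 0 := by
  obtain ⟨e₀, e₃, e₄, he⟩ := energy_line θ lam q h
  rw [funext he]
  exact (hasDerivAt_quartic _ _ _ _ _ 0).congr_deriv (by ring)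

theorem iteratedDeriv_energy_line (θ lam : ℝ) (q h : Config) :
    iteratedDeriv 2 (fun t : ℝ => energy θ lam (q + t • h)) 0 = secondVar θ lam q h := by
  obtain ⟨e₀, e₃, e₄, he⟩ := energy_line θ lam q h
  have h1 : deriv (fun t : ℝ => energy θ lam (q + t • h)) = fun t => firstVar θ lam q h
      + 2 * t * (secondVar θ lam q h / 2) + 3 * t ^ 2 * e₃ + 4 * t ^ 3 * e₄ := by
    funext t
    rw [funext he]
    exact (hasDerivAt_quartic _ _ _ _ _ t).deriv
  rw [iteratedDeriv_succ, iteratedDeriv_one, h1]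
  have h2 := hasDerivAt_quartic (firstVar θ lam q h) (secondVar θ lam q h) (3 * e₃) (4 * e₄) 0 0
  refine HasDerivAt.deriv (h2.congr_deriv (by ring) |>.congr_of_eventuallyEq
    (Eventually.of_forall fun t => by ring))

/-! ### The Euler–Lagrange equation as a fixed point problem in `H¹₀` -/

/-- The bulk force: `q` is critical for `E_λ` if and only if `w = -λ² force w`, where `w` is the
derivative of the difference of `q` to the affine interpolation of its boundary values. -/
def force (θ : ℝ) (w : X × X × X) : X × X × X :=
  ((1 / 6 : ℝ) • J (grad₁ θ (coord₁ θ w.1) (coord₂ θ w.2.1) (prim w.2.2)),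
    (1 / 2 : ℝ) • J (pot θ (coord₁ θ w.1) (coord₂ θ w.2.1) (prim w.2.2) * coord₂ θ w.2.1),
    (1 / 2 : ℝ) • J (pot θ (coord₁ θ w.1) (coord₂ θ w.2.1) (prim w.2.2) * prim w.2.2))

/-- The bulk force on eigenvalue exchange configurations. -/
def eeForce (θ : ℝ) (w : X × X) : X × X :=
  ((1 / 6 : ℝ) • J (grad₁ θ (coord₁ θ w.1) (coord₂ θ w.2) 0),
    (1 / 2 : ℝ) • J (pot θ (coord₁ θ w.1) (coord₂ θ w.2) 0 * coord₂ θ w.2))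

theorem inner_smul_add_smul_J (c d : ℝ) (u k : X) (g : CI) :
    inner ℝ (c • u + d • J g) k = c * inner ℝ u k + d * integ (g * prim k) := by
  rw [inner_add_left, real_inner_smul_left, real_inner_smul_left, inner_J]

theorem firstVar_state (θ lam : ℝ) (w k : X × X × X) :
    firstVar θ lam (state θ w) (emb k.1, emb k.2.1, emb k.2.2)
      = 6 * inner ℝ ((1 / lam ^ 2) • w.1 + (force θ w).1) k.1
        + 2 * inner ℝ ((1 / lam ^ 2) • w.2.1 + (force θ w).2.1) k.2.1
        + 2 * inner ℝ ((1 / lam ^ 2) • w.2.2 + (force θ w).2.2) k.2.2 := by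
  have h1 : inner ℝ (state θ w).1.1.2 (emb k.1).1.2 = inner ℝ w.1 k.1 := by
    show inner ℝ (qPlus θ • (0 : L2) + toL2 w.1) (toL2 k.1) = _
    rw [smul_zero, zero_add]; rfl
  have h2 : inner ℝ (state θ w).2.1.1.2 (emb k.2.1).1.2 = inner ℝ w.2.1 k.2.1 := by
    show inner ℝ ((-3 * qPlus θ) • ofCont 1 + toL2 w.2.1) (toL2 k.2.1) = _
    rw [inner_add_left, inner_smul_left, inner_ofCont_one, totalIntegral_toL2, mul_zero, zero_add,
      inner_toL2]
  have h3 : inner ℝ (state θ w).2.2.1.2 (emb k.2.2).1.2 = inner ℝ w.2.2 k.2.2 := rfl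
  have g1 : (state θ w).1.1.1 = coord₁ θ w.1 := rfl
  have g2 : (state θ w).2.1.1.1 = coord₂ θ w.2.1 := rfl
  have g3 : (state θ w).2.2.1.1 = prim w.2.2 := rfl
  simp only [firstVar, h1, h2, h3, g1, g2, g3, emb_fst, force,
    inner_smul_add_smul_J, map_add]
  ring

/-- The Euler–Lagrange equation, in integrated form. -/
theorem isCritical_iff {θ lam : ℝ} (hl : lam ≠ 0) (q : Config) :
    IsCritical θ lam q ↔ ∃ w, q = state θ w ∧ w + lam ^ 2 • force θ w = 0 := by
  have hl2 : lam ^ 2 ≠ 0 := pow_ne_zero 2 hl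
  have comp (u f : X) : (1 / lam ^ 2) • u + f = 0 ↔ u + lam ^ 2 • f = 0 := by
    rw [← smul_eq_zero_iff_right hl2, smul_add, smul_smul, mul_one_div_cancel hl2, one_smul]
  rw [IsCritical, isAdmissible_iff]
  constructor
  · rintro ⟨⟨w, rfl⟩, h⟩
    refine ⟨w, rfl, ?_⟩
    have key (k : X × X × X) : firstVar θ lam (state θ w) (emb k.1, emb k.2.1, emb k.2.2) = 0 :=
      (hasDerivAt_energy_line _ _ _ _).unique (h _ (isH10_emb _) (isH10_emb _) (isH10_emb _))
    simp only [firstVar_state] at key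
    refine Prod.ext ((comp _ _).1 ?_) (Prod.ext ((comp _ _).1 ?_) ((comp _ _).1 ?_))
    · have := key ((1 / lam ^ 2) • w.1 + (force θ w).1, 0, 0)
      simpa [-smul_add, -one_div] using this
    · have := key (0, (1 / lam ^ 2) • w.2.1 + (force θ w).2.1, 0)
      simpa [-smul_add, -one_div] using this
    · have := key (0, 0, (1 / lam ^ 2) • w.2.2 + (force θ w).2.2)
      simpa [-smul_add, -one_div] using this
  · rintro ⟨w, rfl, hw⟩
    refine ⟨⟨w, rfl⟩, fun h h1 h2 h3 => ?_⟩
    obtain ⟨k1, hk1⟩ := (H1.isH10_iff _).1 h1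
    obtain ⟨k2, hk2⟩ := (H1.isH10_iff _).1 h2
    obtain ⟨k3, hk3⟩ := (H1.isH10_iff _).1 h3
    have hh : h = (emb k1, emb k2, emb k3) := Prod.ext hk1 (Prod.ext hk2 hk3)
    have hd := hasDerivAt_energy_line θ lam (state θ w) h
    rw [hh, firstVar_state θ lam w (k1, k2, k3),
      (comp _ _).2 (congrArg Prod.fst hw), (comp _ _).2 (congrArg (fun p => p.2.1) hw),
      (comp _ _).2 (congrArg (fun p => p.2.2) hw)] at hd
    rw [hh]
    simpa using hd

theorem force_ee (θ : ℝ) (w : X × X) :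
    force θ (w.1, w.2, 0) = ((eeForce θ w).1, (eeForce θ w).2, 0) := by
  simp [force, eeForce]

/-- The Euler–Lagrange equation within `ℋ^{ee}`. By the symmetry `q₃ ↦ -q₃`, its solutions are
also critical points of the full energy. -/
theorem isEECritical_iff {θ lam : ℝ} (hl : lam ≠ 0) (χ : H1 × H1) :
    IsEECritical θ lam χ ↔ ∃ w, χ = eeState θ w ∧ w + lam ^ 2 • eeForce θ w = 0 := by
  have hl2 : lam ^ 2 ≠ 0 := pow_ne_zero 2 hl
  have comp (u f : X) : (1 / lam ^ 2) • u + f = 0 ↔ u + lam ^ 2 • f = 0 := by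
    rw [← smul_eq_zero_iff_right hl2, smul_add, smul_smul, mul_one_div_cancel hl2, one_smul]
  have hline (h : H1 × H1) : (fun t : ℝ => eeEnergy θ lam (χ + t • h))
      = fun t : ℝ => energy θ lam (eeConfig χ + t • ((h.1, h.2, 0) : Config)) := by
    funext t
    simp [eeEnergy, eeConfig]
  rw [IsEECritical, isAdmissible_eeConfig_iff]
  constructor
  · rintro ⟨⟨w, rfl⟩, h⟩
    refine ⟨w, rfl, ?_⟩
    have key (k : X × X) :
        firstVar θ lam (state θ (w.1, w.2, 0)) (emb k.1, emb k.2, emb 0) = 0 := by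
      have h1 := h (emb k.1, emb k.2) (isH10_emb _) (isH10_emb _)
      rw [hline, eeConfig_eeState] at h1
      rw [map_zero]
      exact (hasDerivAt_energy_line _ _ _ _).unique h1
    have key' (k : X × X) := (firstVar_state θ lam (w.1, w.2, 0) (k.1, k.2, 0)).symm.trans (key k)
    simp only [force_ee] at key'
    refine Prod.ext ((comp _ _).1 ?_) ((comp _ _).1 ?_)
    · have := key' ((1 / lam ^ 2) • w.1 + (eeForce θ w).1, 0)
      simpa [-smul_add, -one_div] using this
    · have := key' (0, (1 / lam ^ 2) • w.2 + (eeForce θ w).2)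
      simpa [-smul_add, -one_div] using this
  · rintro ⟨w, rfl, hw⟩
    refine ⟨⟨w, rfl⟩, fun h h1 h2 => ?_⟩
    rw [hline, eeConfig_eeState]
    have hc : IsCritical θ lam (state θ (w.1, w.2, 0)) := by
      refine (isCritical_iff hl _).2 ⟨_, rfl, ?_⟩
      rw [force_ee]
      exact Prod.ext (congrArg (fun p => p.1) hw)
        (Prod.ext (congrArg (fun p => p.2) hw) (by simp))
    exact hc.2 _ h1 h2 ((H1.isH10_iff _).2 ⟨0, by simp⟩)

/-! ### The two lowest eigenvalues as functions of the potentials -/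

instance : Nontrivial X := by
  have h0 : totalIntegral (ofCont idC) = 0 := by
    rw [← inner_ofCont_one, inner_ofCont, integral_congr_L2 (g := fun x => x)]
    · norm_num
    · filter_upwards [ofCont_ae idC, ae_restrict_mem measurableSet_Ioc] with x hx hxm
      rw [hx, Set.projIcc_of_mem _ ⟨hxm.1.le, hxm.2⟩]
      simp [idC]
  obtain ⟨w, hw⟩ := exists_toL2_eq h0
  refine ⟨w, 0, fun h => ?_⟩
  have h1 : inner ℝ (ofCont idC) (ofCont idC) = (2 / 3 : ℝ) := by
    rw [inner_ofCont, integral_congr_L2 (g := fun x => x ^ 2)]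
    · rw [integral_pow]; norm_num
    · filter_upwards [ofCont_ae idC, ae_restrict_mem measurableSet_Ioc] with x hx hxm
      rw [hx, Set.projIcc_of_mem _ ⟨hxm.1.le, hxm.2⟩]
      simp [idC, sq]
  rw [← hw, h, map_zero, inner_zero_left] at h1
  norm_num at h1

theorem integ_prim_sq_pos {h : X} (hh : h ≠ 0) : 0 < integ (prim h * prim h) :=
  integ_sq_pos fun h0 => hh (prim_injective (by rw [h0, map_zero]))

/-- The quadratic form `∫ h'² + V h²` on `H¹₀(-1,1)`. -/
def quadSB (V : CI) (h : X) : ℝ := ‖h‖ ^ 2 + integ (V * (prim h * prim h))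

/-- The lowest Dirichlet eigenvalue of `-d²/dx² + V` on `(-1,1)`. -/
def specSB (V : CI) : ℝ :=
  ⨅ h : {h : X // h ≠ 0}, quadSB V h / integ (prim (h : X) * prim (h : X))

theorem quadSB_ge (V : CI) (h : X) : -‖V‖ * integ (prim h * prim h) ≤ quadSB V h := by
  have := abs_le.1 (abs_integ_mul_sq_le V (prim h))
  have h2 := sq_nonneg ‖h‖
  rw [quadSB]
  linarith [this.1]

theorem specSB_mul_le (V : CI) (h : X) : specSB V * integ (prim h * prim h) ≤ quadSB V h := by
  rcases eq_or_ne h 0 with rfl | hh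
  · simp [quadSB]
  rw [← le_div_iff₀ (integ_prim_sq_pos hh)]
  refine ciInf_le (f := fun h : {h : X // h ≠ 0} =>
    quadSB V h / integ (prim (h : X) * prim (h : X))) ⟨-‖V‖, ?_⟩ ⟨h, hh⟩
  rintro _ ⟨k, rfl⟩
  exact (le_div_iff₀ (integ_prim_sq_pos k.2)).2 (quadSB_ge V k)

theorem le_specSB {V : CI} {c : ℝ} (hc : ∀ h : X, c * integ (prim h * prim h) ≤ quadSB V h) :
    c ≤ specSB V := by
  obtain ⟨x, hx⟩ := exists_ne (0 : X)
  have : Nonempty {h : X // h ≠ 0} := ⟨⟨x, hx⟩⟩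
  exact le_ciInf fun h => (le_div_iff₀ (integ_prim_sq_pos h.2)).2 (hc h)

theorem quadSB_add (V k : CI) (h : X) :
    quadSB (V + k) h = quadSB V h + integ (k * (prim h * prim h)) := by
  simp only [quadSB, add_mul, map_add]; ring

theorem specSB_sub_le (V V' : CI) : specSB V - specSB V' ≤ ‖V - V'‖ := by
  have : specSB V - ‖V - V'‖ ≤ specSB V' := by
    refine le_specSB fun h => ?_
    have h1 := specSB_mul_le V h
    have h2 := quadSB_add V' (V - V') h
    have h3 := (abs_le.1 (abs_integ_mul_sq_le (V - V') (prim h))).2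
    rw [add_sub_cancel] at h2
    linarith
  linarith

theorem abs_specSB_sub_le (V V' : CI) : |specSB V - specSB V'| ≤ ‖V - V'‖ :=
  abs_le.2 ⟨by have := specSB_sub_le V' V; rw [norm_sub_rev] at this; linarith, specSB_sub_le V V'⟩

theorem continuous_specSB : Continuous specSB := by
  have : LipschitzWith 1 specSB := LipschitzWith.of_dist_le_mul fun V V' => by
    rw [Real.dist_eq, dist_eq_norm]; simpa using abs_specSB_sub_le V V'
  exact this.continuous

theorem specSB_zero_pos : 0 < specSB 0 := by
  refine lt_of_lt_of_le (by norm_num : (0 : ℝ) < 1 / 4) (le_specSB fun h => ?_)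
  have := integ_prim_sq_le h
  simp only [quadSB, zero_mul, map_zero]
  linarith

/-- The squared `L²` norm on `H¹₀(-1,1)²`. -/
def denSP (h : X × X) : ℝ := integ (prim h.1 * prim h.1) + integ (prim h.2 * prim h.2)

theorem denSP_pos {h : X × X} (hh : h ≠ 0) : 0 < denSP h := by
  by_cases h1 : h.1 = 0
  · have h2 : h.2 ≠ 0 := fun h2 => hh (Prod.ext h1 h2)
    exact add_pos_of_nonneg_of_pos (integ_sq_nonneg _) (integ_prim_sq_pos h2)
  · exact add_pos_of_pos_of_nonneg (integ_prim_sq_pos h1) (integ_sq_nonneg _)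

/-- The integral of the quadratic form with coefficient matrix `(a, b; b, c)`. -/
def potSP (p : CI × CI × CI) (h : X × X) : ℝ :=
  integ (p.1 * (prim h.1 * prim h.1) + (2 : ℝ) • (p.2.1 * (prim h.1 * prim h.2))
    + p.2.2 * (prim h.2 * prim h.2))

/-- The quadratic form `∫ 6 h₁'² + 2 h₂'² + a h₁² + 2 b h₁ h₂ + c h₂²` on `H¹₀(-1,1)²`. -/
def quadSP (p : CI × CI × CI) (h : X × X) : ℝ := 6 * ‖h.1‖ ^ 2 + 2 * ‖h.2‖ ^ 2 + potSP p h

/-- The lowest eigenvalue of the form `quadSP` with respect to the `L²` inner product. -/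
def specSP (p : CI × CI × CI) : ℝ := ⨅ h : {h : X × X // h ≠ 0}, quadSP p h / denSP h

theorem abs_potSP_le (p : CI × CI × CI) (h : X × X) : |potSP p h| ≤ 3 * ‖p‖ * denSP h := by
  have hp1 : ‖p.1‖ ≤ ‖p‖ := norm_fst_le p
  have hp2 : ‖p.2.1‖ ≤ ‖p‖ := (norm_fst_le p.2).trans (norm_snd_le p)
  have hp3 : ‖p.2.2‖ ≤ ‖p‖ := (norm_snd_le p.2).trans (norm_snd_le p)
  have key : ∀ q : CI × CI × CI, ‖q.1‖ ≤ ‖p‖ → ‖q.2.1‖ ≤ ‖p‖ → ‖q.2.2‖ ≤ ‖p‖ →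
      potSP q h ≤ 3 * ‖p‖ * denSP h := by
    intro q h1 h2 h3
    have : potSP q h ≤ integ ((3 * ‖p‖) • (prim h.1 * prim h.1 + prim h.2 * prim h.2)) := by
      refine integ_mono fun x => ?_
      show q.1 x * (prim h.1 x * prim h.1 x) + 2 * (q.2.1 x * (prim h.1 x * prim h.2 x))
        + q.2.2 x * (prim h.2 x * prim h.2 x)
        ≤ 3 * ‖p‖ * (prim h.1 x * prim h.1 x + prim h.2 x * prim h.2 x)
      have e1 := abs_le.1 ((q.1.norm_coe_le_norm x).trans h1)
      have e2 := abs_le.1 ((q.2.1.norm_coe_le_norm x).trans h2)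
      have e3 := abs_le.1 ((q.2.2.norm_coe_le_norm x).trans h3)
      generalize prim h.1 x = s at *
      generalize prim h.2 x = t at *
      have f1 : q.1 x * (s * s) ≤ ‖p‖ * (s * s) :=
        mul_le_mul_of_nonneg_right e1.2 (mul_self_nonneg s)
      have f3 : q.2.2 x * (t * t) ≤ ‖p‖ * (t * t) :=
        mul_le_mul_of_nonneg_right e3.2 (mul_self_nonneg t)
      have f2 : 2 * (q.2.1 x * (s * t)) ≤ ‖p‖ * (s * s + t * t) := by
        have g1 : 0 ≤ (‖p‖ - q.2.1 x) * (s + t) ^ 2 :=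
          mul_nonneg (sub_nonneg.2 e2.2) (sq_nonneg _)
        have g2 : 0 ≤ (‖p‖ + q.2.1 x) * (s - t) ^ 2 :=
          mul_nonneg (by linarith [e2.1]) (sq_nonneg _)
        linarith
      have n1 : 0 ≤ ‖p‖ * (s * s) := mul_nonneg (norm_nonneg _) (mul_self_nonneg s)
      have n2 : 0 ≤ ‖p‖ * (t * t) := mul_nonneg (norm_nonneg _) (mul_self_nonneg t)
      linarith
    simpa [denSP, mul_add] using this
  refine abs_le.2 ⟨?_, key p hp1 hp2 hp3⟩
  have := key (-p) (by simpa using hp1) (by simpa using hp2) (by simpa using hp3)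
  have hneg : potSP (-p) h = -potSP p h := by
    simp only [potSP, Prod.fst_neg, Prod.snd_neg, ← map_neg]
    congr 1
    simp only [neg_mul, smul_neg]
    abel
  rw [hneg] at this
  linarith

theorem specSP_mul_le (p : CI × CI × CI) (h : X × X) : specSP p * denSP h ≤ quadSP p h := by
  rcases eq_or_ne h 0 with rfl | hh
  · simp [quadSP, denSP, potSP]
  rw [← le_div_iff₀ (denSP_pos hh)]
  refine ciInf_le (f := fun h : {h : X × X // h ≠ 0} => quadSP p h / denSP h)
    ⟨-(3 * ‖p‖), ?_⟩ ⟨h, hh⟩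
  rintro _ ⟨k, rfl⟩
  refine (le_div_iff₀ (denSP_pos k.2)).2 ?_
  have h1 := (abs_le.1 (abs_potSP_le p k)).1
  have h2 := sq_nonneg ‖k.1.1‖
  have h3 := sq_nonneg ‖k.1.2‖
  rw [quadSP]
  linarith

theorem le_specSP {p : CI × CI × CI} {c : ℝ} (hc : ∀ h : X × X, c * denSP h ≤ quadSP p h) :
    c ≤ specSP p := by
  obtain ⟨x, hx⟩ := exists_ne (0 : X × X)
  have : Nonempty {h : X × X // h ≠ 0} := ⟨⟨x, hx⟩⟩
  exact le_ciInf fun h => (le_div_iff₀ (denSP_pos h.2)).2 (hc h)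

theorem specSP_sub_le (p p' : CI × CI × CI) : specSP p - specSP p' ≤ 3 * ‖p - p'‖ := by
  have : specSP p - 3 * ‖p - p'‖ ≤ specSP p' := by
    refine le_specSP fun h => ?_
    have h1 := specSP_mul_le p h
    have h3 := (abs_le.1 (abs_potSP_le (p - p') h)).2
    have h2 : potSP (p - p') h = potSP p h - potSP p' h := by
      simp only [potSP, ← map_sub, Prod.fst_sub, Prod.snd_sub]
      congr 1
      simp only [sub_mul, smul_sub]
      abel
    rw [quadSP] at h1 ⊢
    linarith
  linarith

theorem continuous_specSP : Continuous specSP := by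
  have : LipschitzWith 3 specSP := LipschitzWith.of_dist_le_mul fun p p' => by
    rw [Real.dist_eq, dist_eq_norm]
    refine abs_le.2 ⟨?_, specSP_sub_le p p'⟩
    have := specSP_sub_le p' p
    rw [norm_sub_rev] at this
    simpa using (by linarith : -(3 * ‖p - p'‖) ≤ specSP p - specSP p')
  exact this.continuous

theorem specSP_zero_pos : 0 < specSP 0 := by
  refine lt_of_lt_of_le (by norm_num : (0 : ℝ) < 1 / 4) (le_specSP fun h => ?_)
  have h1 := integ_prim_sq_le h.1
  have h2 := integ_prim_sq_le h.2
  have : potSP 0 h = 0 := by simp [potSP]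
  rw [quadSP, this, denSP]
  have := sq_nonneg ‖h.1‖
  have := sq_nonneg ‖h.2‖
  linarith

/-- A form with positive lowest eigenvalue is coercive in the `H¹₀` norm. -/
theorem exists_coercive_quadSP {p : CI × CI × CI} (hp : 0 < specSP p) :
    ∃ κ > 0, ∀ h : X × X, κ * (‖h.1‖ ^ 2 + ‖h.2‖ ^ 2) ≤ quadSP p h := by
  set K := 3 * ‖p‖
  have hK : 0 ≤ K := by positivity
  refine ⟨2 * specSP p / (specSP p + K), by positivity, fun h => ?_⟩
  have h1 := specSP_mul_le p h
  have h2 : 2 * (‖h.1‖ ^ 2 + ‖h.2‖ ^ 2) ≤ quadSP p h + K * denSP h := by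
    have h1 := (abs_le.1 (abs_potSP_le p h)).1
    have h2 := sq_nonneg ‖h.1‖
    rw [quadSP]; linarith
  rw [div_mul_eq_mul_div, div_le_iff₀ (by positivity)]
  have h3 := mul_le_mul_of_nonneg_left h2 hp.le
  have h4 := mul_le_mul_of_nonneg_left h1 hK
  linarith

/-! ### The eigenvalues `ν` and `μ` of an eigenvalue exchange configuration -/

/-- The potential of `Ψ` at the eigenvalue exchange configuration with parameter `w`. -/
def potSB (θ : ℝ) (w : X × X) : CI := pot θ (coord₁ θ w.1) (coord₂ θ w.2) 0

/-- The Hessian of the bulk energy density in the directions `q₁, q₂` at the eigenvalue exchange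
configuration with parameter `w`. -/
def hessSP (θ : ℝ) (w : X × X) : CI × CI × CI :=
  (hess₁₁ θ (coord₁ θ w.1) (coord₂ θ w.2) 0, hess₁₂ (coord₁ θ w.1) (coord₂ θ w.2),
    hess₂₂ θ (coord₁ θ w.1) (coord₂ θ w.2) 0)

theorem emb_eq_zero_iff (w : X) : emb w = 0 ↔ w = 0 :=
  map_eq_zero_iff emb emb_injective

theorem integral_val_emb_sq (h : X) :
    ∫ x in (-1 : ℝ)..1, (emb h).val x ^ 2 = integ (prim h * prim h) := by
  simp [integ_apply, H1.val, sq]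

theorem mu_eq {lam : ℝ} (hl : lam ≠ 0) (θ : ℝ) (w : X × X) :
    mu θ lam (eeState θ w) = 2 / lam ^ 2 * specSB ((lam ^ 2 / 2) • potSB θ w) := by
  have hl2 : lam ^ 2 ≠ 0 := pow_ne_zero 2 hl
  have hsv (h : X) : secondVarSB θ lam (eeState θ w) (emb h)
      = 2 / lam ^ 2 * quadSB ((lam ^ 2 / 2) • potSB θ w) h := by
    rw [secondVarSB, iteratedDeriv_energy_line, eeConfig_eeState]
    have h1 : secondVar θ lam (state θ (w.1, w.2, 0)) (0, 0, emb h)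
        = 1 / lam ^ 2 * (6 * ‖(0 : L2)‖ ^ 2 + 2 * ‖(0 : L2)‖ ^ 2 + 2 * ‖toL2 h‖ ^ 2)
          + integ (hessC θ (coord₁ θ w.1) (coord₂ θ w.2) (prim 0) 0 0 (prim h)) := rfl
    have h2 : hessC θ (coord₁ θ w.1) (coord₂ θ w.2) (prim 0) 0 0 (prim h)
        = potSB θ w * (prim h * prim h) := by
      rw [map_zero]
      ext x
      simp [hessC, potSB, hess₂₂, pot, rho]
    rw [h1, h2, quadSB, norm_toL2, smul_mul_assoc, map_smul, norm_zero, smul_eq_mul]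
    field_simp
    ring
  have hset : {r : ℝ | ∃ h : H1, h.IsH10 ∧ h ≠ 0 ∧
      r = secondVarSB θ lam (eeState θ w) h / ∫ x in (-1 : ℝ)..1, h.val x ^ 2}
      = Set.range fun h : {h : X // h ≠ 0} => 2 / lam ^ 2 *
        (quadSB ((lam ^ 2 / 2) • potSB θ w) h / integ (prim (h : X) * prim (h : X))) := by
    ext r
    constructor
    · rintro ⟨h, h10, h0, rfl⟩
      obtain ⟨k, rfl⟩ := (H1.isH10_iff h).1 h10
      refine ⟨⟨k, fun hk => h0 ((emb_eq_zero_iff k).2 hk)⟩, ?_⟩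
      simp only [hsv, integral_val_emb_sq, mul_div_assoc]
    · rintro ⟨k, rfl⟩
      refine ⟨emb k, isH10_emb _, fun hk => k.2 ((emb_eq_zero_iff _).1 hk), ?_⟩
      simp only [hsv, integral_val_emb_sq, mul_div_assoc]
  rw [mu, hset, specSB, Real.mul_iInf_of_nonneg (by positivity)]
  rfl

theorem nu_eq {lam : ℝ} (hl : lam ≠ 0) (θ : ℝ) (w : X × X) :
    nu θ lam (eeState θ w) = 1 / lam ^ 2 * specSP (lam ^ 2 • hessSP θ w) := by
  have hl2 : lam ^ 2 ≠ 0 := pow_ne_zero 2 hl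
  have hsv (h : X × X) : secondVarSP θ lam (eeState θ w) (emb h.1, emb h.2)
      = 1 / lam ^ 2 * quadSP (lam ^ 2 • hessSP θ w) h := by
    rw [secondVarSP, iteratedDeriv_energy_line, eeConfig_eeState]
    have h1 : secondVar θ lam (state θ (w.1, w.2, 0)) (emb h.1, emb h.2, 0)
        = 1 / lam ^ 2 * (6 * ‖toL2 h.1‖ ^ 2 + 2 * ‖toL2 h.2‖ ^ 2 + 2 * ‖(0 : L2)‖ ^ 2)
          + integ (hessC θ (coord₁ θ w.1) (coord₂ θ w.2) (prim 0) (prim h.1) (prim h.2) 0) := rfl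
    have h2 : potSP (lam ^ 2 • hessSP θ w) h = lam ^ 2 *
        integ (hessC θ (coord₁ θ w.1) (coord₂ θ w.2) (prim 0) (prim h.1) (prim h.2) 0) := by
      rw [potSP, ← smul_eq_mul (lam ^ 2), ← map_smul, map_zero prim]
      congr 1
      ext x
      simp [hessC, hessSP]
      ring
    rw [h1, quadSP, h2, norm_toL2, norm_toL2, norm_zero]
    field_simp
    ring
  have hden (h : X × X) : ∫ x in (-1 : ℝ)..1, ((emb h.1).val x ^ 2 + (emb h.2).val x ^ 2)
      = denSP h := by
    rw [denSP, ← map_add, integ_apply]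
    simp [H1.val, sq]
  have hne (k : X × X) : ((emb k.1, emb k.2) : H1 × H1) = 0 ↔ k = 0 := by
    rw [Prod.mk_eq_zero, emb_eq_zero_iff, emb_eq_zero_iff, Prod.ext_iff]; rfl
  have hset : {r : ℝ | ∃ h : H1 × H1, h.1.IsH10 ∧ h.2.IsH10 ∧ h ≠ 0 ∧
      r = secondVarSP θ lam (eeState θ w) h /
        ∫ x in (-1 : ℝ)..1, (h.1.val x ^ 2 + h.2.val x ^ 2)}
      = Set.range fun h : {h : X × X // h ≠ 0} => 1 / lam ^ 2 *
        (quadSP (lam ^ 2 • hessSP θ w) h / denSP h) := by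
    ext r
    constructor
    · rintro ⟨⟨h1, h2⟩, h10, h20, h0, rfl⟩
      obtain ⟨k1, rfl⟩ := (H1.isH10_iff h1).1 h10
      obtain ⟨k2, rfl⟩ := (H1.isH10_iff h2).1 h20
      refine ⟨⟨(k1, k2), fun hk => h0 ((hne _).2 hk)⟩, ?_⟩
      simp only [hsv (k1, k2), hden (k1, k2), mul_div_assoc]
    · rintro ⟨k, rfl⟩
      refine ⟨(emb k.1.1, emb k.1.2), isH10_emb _, isH10_emb _, fun hk => k.2 ((hne _).1 hk), ?_⟩
      simp only [hsv, hden, mul_div_assoc]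
  rw [nu, hset, specSP, Real.mul_iInf_of_nonneg (by positivity)]
  rfl

/-! ### Differentiability of the lowest Dirichlet eigenvalue -/

theorem contPrimitive_comb (a b : ℝ) (f g : CI) :
    contPrimitive (a • f + b • g) = a • contPrimitive f + b • contPrimitive g := by
  ext x
  have hf := ((continuous_comp_projIcc f).intervalIntegrable (μ := volume) (-1) x).const_mul a
  have hg := ((continuous_comp_projIcc g).intervalIntegrable (μ := volume) (-1) x).const_mul b
  have h := intervalIntegral.integral_add hf hg
  rw [intervalIntegral.integral_const_mul, intervalIntegral.integral_const_mul] at h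
  exact h

theorem ofCont_comb (a b : ℝ) (f g : CI) :
    ofCont (a • f + b • g) = a • ofCont f + b • ofCont g := by
  refine Lp.ext ?_
  filter_upwards [ofCont_ae (a • f + b • g), Lp.coeFn_add (a • ofCont f) (b • ofCont g),
    Lp.coeFn_smul a (ofCont f), Lp.coeFn_smul b (ofCont g), ofCont_ae f, ofCont_ae g]
    with x h1 h2 h3 h4 h5 h6
  rw [h1, h2, Pi.add_apply, h3, h4, Pi.smul_apply, Pi.smul_apply, h5, h6]
  rfl

/-- Uniqueness for the initial value problem `y'' = V y`, `y(-1) = y'(-1) = 0`, with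
`y = prim z`. -/
theorem eq_zero_of_toL2_eq (V : CI) (z : X)
    (hz : toL2 z = ofCont (contPrimitive (V * prim z))) : z = 0 := by
  set pr : ℝ → Set.Icc (-1 : ℝ) 1 := Set.projIcc (-1) 1 (by norm_num) with hpr
  set g := V * prim z with hg
  set p := contPrimitive g with hp
  let Y : ℝ → ℝ := fun t => ∫ s in (-1 : ℝ)..t, p (pr s)
  let P : ℝ → ℝ := fun t => ∫ s in (-1 : ℝ)..t, g (pr s)
  have hY : ∀ x : Set.Icc (-1 : ℝ) 1, prim z x = Y x := by
    intro x
    rw [prim_apply, hz]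
    exact L2.integral_congr (ofCont_ae p) x
  have hP : ∀ x : Set.Icc (-1 : ℝ) 1, p x = P x := fun x => rfl
  have hYd (t : ℝ) : HasDerivAt Y (p (pr t)) t :=
    intervalIntegral.integral_hasDerivAt_right ((continuous_comp_projIcc p).intervalIntegrable _ _)
      ((continuous_comp_projIcc p).stronglyMeasurableAtFilter _ _)
      (continuous_comp_projIcc p).continuousAt
  have hPd (t : ℝ) : HasDerivAt P (g (pr t)) t :=
    intervalIntegral.integral_hasDerivAt_right ((continuous_comp_projIcc g).intervalIntegrable _ _)
      ((continuous_comp_projIcc g).stronglyMeasurableAtFilter _ _)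
      (continuous_comp_projIcc g).continuousAt
  let v : ℝ → ℝ × ℝ → ℝ × ℝ := fun t q => (q.2, V (pr t) * q.1)
  have hv (t : ℝ) : LipschitzWith (1 + ‖V‖₊) (v t) := by
    refine LipschitzWith.of_dist_le_mul fun q r => ?_
    have h1 : |q.1 - r.1| ≤ dist q r := by
      rw [← Real.dist_eq]; exact le_max_left _ _
    have h2 : |q.2 - r.2| ≤ dist q r := by
      rw [← Real.dist_eq]; exact le_max_right _ _
    have h3 : |V (pr t)| ≤ ‖V‖ := V.norm_coe_le_norm _
    have h0 : 0 ≤ dist q r := dist_nonneg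
    have hV : 0 ≤ ‖V‖ := norm_nonneg _
    rw [Prod.dist_eq]
    simp only [v, Real.dist_eq, ← mul_sub, abs_mul, NNReal.coe_add, NNReal.coe_one, coe_nnnorm]
    refine max_le ?_ ?_
    · nlinarith
    · have := mul_le_mul h3 h1 (abs_nonneg _) hV
      nlinarith
  have hcont : Continuous fun t => (Y t, P t) :=
    (continuous_iff_continuousAt.2 fun t => (hYd t).continuousAt).prodMk
      (continuous_iff_continuousAt.2 fun t => (hPd t).continuousAt)
  have hmem {t : ℝ} (ht : t ∈ Set.Ico (-1 : ℝ) 1) : pr t = ⟨t, ht.1, ht.2.le⟩ :=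
    Set.projIcc_of_mem _ _
  have huniq := ODE_solution_unique (v := v) (f := fun t => (Y t, P t)) (g := fun _ => (0, 0))
    (a := -1) (b := 1) hv hcont.continuousOn
    (fun t ht => by
      refine ((hYd t).prodMk (hPd t)).hasDerivWithinAt.congr_deriv ?_
      simp only [v, hmem ht, hP, hg, ContinuousMap.mul_apply, hY])
    continuousOn_const
    (fun t _ => (hasDerivWithinAt_const t (Set.Ici t) ((0 : ℝ), (0 : ℝ))).congr_deriv
      (by simp only [v, mul_zero]; rfl))
    (by simp [Y, P])
  refine prim_injective ?_
  rw [map_zero]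
  ext x
  rw [hY x]
  exact congrArg Prod.fst (huniq x.2)

/-- The polarisation of `quadSB`. -/
theorem quadSB_add_smul (V : CI) (h k : X) (t : ℝ) :
    quadSB V (h + t • k) = quadSB V k * (t * t)
      + 2 * (inner ℝ h k + integ (V * prim h * prim k)) * t + quadSB V h := by
  have h1 : ‖h + t • k‖ ^ 2 = ‖h‖ ^ 2 + 2 * t * inner ℝ h k + t ^ 2 * ‖k‖ ^ 2 := by
    rw [norm_add_sq_real, real_inner_smul_right, norm_smul, mul_pow, Real.norm_eq_abs, sq_abs]
    ring
  have h2 : V * (prim (h + t • k) * prim (h + t • k)) = V * (prim h * prim h)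
      + (2 * t) • (V * prim h * prim k) + (t * t) • (V * (prim k * prim k)) := by
    ext x
    simp only [map_add, map_smul, ContinuousMap.add_apply, ContinuousMap.mul_apply,
      ContinuousMap.smul_apply, smul_eq_mul]
    ring
  rw [quadSB, h1, h2, quadSB, quadSB, map_add, map_add, map_smul, map_smul, smul_eq_mul,
    smul_eq_mul]
  ring

/-- `h` is an `L²`-normalised minimiser of the Rayleigh quotient. -/
def IsGround (V : CI) (h : X) : Prop :=
  integ (prim h * prim h) = 1 ∧ quadSB V h = specSB V

/-- The Euler–Lagrange equation `h'' = (V - specSB V) h` of a minimiser. -/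
theorem IsGround.eq_neg_J {V : CI} {h : X} (hh : IsGround V h) :
    h = -J ((V - specSB V • 1) * prim h) := by
  set V' := V - specSB V • (1 : CI) with hV'
  have hquad (k : X) : quadSB V' k = quadSB V k - specSB V * integ (prim k * prim k) := by
    rw [hV', sub_eq_add_neg, quadSB_add, neg_mul, smul_mul_assoc, one_mul, map_neg, map_smul,
      smul_eq_mul]
    ring
  have key (k : X) : inner ℝ h k + integ (V' * prim h * prim k) = 0 := by
    have hnn (t : ℝ) : 0 ≤ quadSB V' k * (t * t)
        + 2 * (inner ℝ h k + integ (V' * prim h * prim k)) * t + quadSB V' h := by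
      rw [← quadSB_add_smul, hquad]
      linarith [specSB_mul_le V (h + t • k)]
    have h0 : quadSB V' h = 0 := by rw [hquad, hh.1, hh.2]; ring
    have hd := discrim_le_zero hnn
    rw [discrim, h0, mul_zero, sub_zero] at hd
    have := pow_eq_zero_iff (two_ne_zero) |>.1 (le_antisymm hd (sq_nonneg _))
    linarith
  rw [eq_neg_iff_add_eq_zero]
  refine ext_inner_right ℝ fun k => ?_
  rw [inner_add_left, inner_J, key k, inner_zero_left]

/-- The lowest eigenvalue is simple. -/
theorem IsGround.sq_eq {V : CI} {h k : X} (hh : IsGround V h) (hk : IsGround V k) :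
    prim h * prim h = prim k * prim k := by
  set V' := V - specSB V • (1 : CI)
  have hrep {h : X} (hh : IsGround V h) :
      ∃ c : ℝ, toL2 h = c • ofCont 1 + ofCont (contPrimitive (V' * prim h)) := by
    obtain ⟨c, hc⟩ := exists_J_eq (V' * prim h)
    refine ⟨-c, ?_⟩
    conv_lhs => rw [hh.eq_neg_J, map_neg, hc]
    rw [neg_smul]; abel
  have hlin (a b : ℝ) : ofCont (contPrimitive (V' * prim (a • h + b • k)))
      = a • ofCont (contPrimitive (V' * prim h)) + b • ofCont (contPrimitive (V' * prim k)) := by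
    rw [← ofCont_comb, ← contPrimitive_comb]
    simp only [map_add, map_smul, mul_add, mul_smul_comm]
  obtain ⟨c, hc⟩ := hrep hh
  obtain ⟨d, hd⟩ := hrep hk
  have hz : d • h + (-c) • k = 0 := by
    refine eq_zero_of_toL2_eq V' _ ?_
    rw [hlin, map_add, map_smul, map_smul, hc, hd]
    module
  have hne {h : X} (hh : IsGround V h) : h ≠ 0 := by
    rintro rfl
    simpa using hh.1
  have hd0 : d ≠ 0 := by
    rintro rfl
    refine hne hk (eq_zero_of_toL2_eq V' _ ?_)
    rw [hd, zero_smul, zero_add]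
  have hr : h = (c / d) • k := by
    have : d • h = c • k := by
      rw [neg_smul, ← sub_eq_add_neg, sub_eq_zero] at hz; exact hz
    rw [div_eq_inv_mul, mul_smul, ← this, smul_smul, inv_mul_cancel₀ hd0, one_smul]
  have hsq : prim h * prim h = ((c / d) * (c / d)) • (prim k * prim k) := by
    rw [hr, map_smul, smul_mul_smul_comm]
  have h1 := hh.1
  rw [hsq, map_smul, hk.1, smul_eq_mul, mul_one] at h1
  rw [hsq, h1, one_smul]

/-- Compactness of minimising sequences, also for converging potentials. -/
theorem exists_subseq_tendsto_ground {V : CI} {W : ℕ → CI} (hW : Tendsto W atTop (𝓝 V))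
    {h : ℕ → X} (h1 : ∀ n, integ (prim (h n) * prim (h n)) = 1)
    (hq : Tendsto (fun n => quadSB (W n) (h n)) atTop (𝓝 (specSB V))) :
    ∃ (k : X) (φ : ℕ → ℕ), StrictMono φ ∧ Tendsto (fun n => h (φ n)) atTop (𝓝 k) ∧
      IsGround V k := by
  obtain ⟨A, hA⟩ := hq.bddAbove_range
  obtain ⟨B, hB⟩ := hW.norm.bddAbove_range
  have hbound (n : ℕ) : ‖h n‖ ≤ Real.sqrt (A + B) := by
    refine Real.le_sqrt_of_sq_le ?_
    have e1 : quadSB (W n) (h n) ≤ A := hA ⟨n, rfl⟩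
    have e2 : ‖W n‖ ≤ B := hB ⟨n, rfl⟩
    have e3 := (abs_le.1 (abs_integ_mul_sq_le (W n) (prim (h n)))).1
    rw [h1, mul_one] at e3
    rw [quadSB] at e1
    linarith
  obtain ⟨g, φ, hφ, hg⟩ := exists_subseq_tendsto_prim hbound
  have hWφ := hW.comp hφ.tendsto_atTop
  have hqφ := hq.comp hφ.tendsto_atTop
  have hint {U : ℕ → CI} (hU : Tendsto U atTop (𝓝 V)) :
      Tendsto (fun n => integ (U n * (prim (h (φ n)) * prim (h (φ n))))) atTop
        (𝓝 (integ (V * (g * g)))) :=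
    (integ.continuous.tendsto _).comp (hU.mul (hg.mul hg))
  have hgg : integ (g * g) = 1 := by
    have := (integ.continuous.tendsto _).comp (hg.mul hg)
    refine tendsto_nhds_unique this ?_
    simp [Function.comp_def, h1]
  set a := specSB V - integ (V * (g * g)) with ha
  have hnorm : Tendsto (fun n => ‖h (φ n)‖ ^ 2) atTop (𝓝 a) := by
    refine (hqφ.sub (hint hWφ)).congr fun n => ?_
    simp [quadSB]
  -- the parallelogram identity turns minimality into the Cauchy property
  have hcauchy : CauchySeq fun n => h (φ n) := by
    rw [cauchySeq_iff_tendsto_dist_atTop_0]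
    have hf : Tendsto (fun n : ℕ × ℕ => n.1) atTop atTop := by
      rw [← prod_atTop_atTop_eq]; exact tendsto_fst
    have hs : Tendsto (fun n : ℕ × ℕ => n.2) atTop atTop := by
      rw [← prod_atTop_atTop_eq]; exact tendsto_snd
    have hsum : Tendsto (fun n : ℕ × ℕ => prim (h (φ n.1)) + prim (h (φ n.2))) atTop
        (𝓝 (g + g)) := (hg.comp hf).add (hg.comp hs)
    have hlow : Tendsto (fun n : ℕ × ℕ =>
        specSB V * integ ((prim (h (φ n.1)) + prim (h (φ n.2)))
          * (prim (h (φ n.1)) + prim (h (φ n.2))))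
        - integ (V * ((prim (h (φ n.1)) + prim (h (φ n.2)))
          * (prim (h (φ n.1)) + prim (h (φ n.2)))))) atTop (𝓝 (4 * a)) := by
      have e1 := ((integ.continuous.tendsto _).comp (hsum.mul hsum)).const_mul (specSB V)
      have e2 := (integ.continuous.tendsto _).comp ((hsum.mul hsum).const_mul V)
      have e3 : (g + g) * (g + g) = (4 : ℝ) • (g * g) := by
        ext x; simp; ring
      have e4 : 4 * a = specSB V * integ ((g + g) * (g + g)) - integ (V * ((g + g) * (g + g))) := by
        rw [e3, mul_smul_comm, map_smul, map_smul, hgg, ha, smul_eq_mul, smul_eq_mul]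
        ring
      rw [e4]
      exact e1.sub e2
    have hup : Tendsto (fun n : ℕ × ℕ => 2 * ‖h (φ n.1)‖ ^ 2 + 2 * ‖h (φ n.2)‖ ^ 2) atTop
        (𝓝 (2 * a + 2 * a)) :=
      ((hnorm.comp hf).const_mul 2).add ((hnorm.comp hs).const_mul 2)
    have hdist : Tendsto (fun n : ℕ × ℕ => ‖h (φ n.1) - h (φ n.2)‖ ^ 2) atTop (𝓝 0) := by
      have h0 := hup.sub hlow
      rw [show 2 * a + 2 * a - 4 * a = 0 by ring] at h0
      refine squeeze_zero (fun _ => sq_nonneg _) (fun n => ?_) h0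
      have e1 := parallelogram_law_with_norm ℝ (h (φ n.1)) (h (φ n.2))
      have e2 := specSB_mul_le V (h (φ n.1) + h (φ n.2))
      rw [quadSB, map_add] at e2
      simp only [sq]
      nlinarith
    have := (Real.continuous_sqrt.tendsto 0).comp hdist
    rw [Real.sqrt_zero] at this
    refine this.congr fun n => ?_
    simp [Real.sqrt_sq, dist_eq_norm]
  obtain ⟨k, hk⟩ := cauchySeq_tendsto_of_complete hcauchy
  have hgk : prim k = g := tendsto_nhds_unique ((prim.continuous.tendsto k).comp hk) hg
  refine ⟨k, φ, hφ, hk, by rw [hgk, hgg], ?_⟩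
  have := tendsto_nhds_unique ((continuous_norm.tendsto k).comp hk |>.pow 2) hnorm
  rw [quadSB, hgk, this, ha]
  ring

theorem exists_isGround (V : CI) : ∃ h, IsGround V h := by
  have hex (n : ℕ) : ∃ h : X, integ (prim h * prim h) = 1 ∧
      quadSB V h ≤ specSB V + 1 / ((n : ℝ) + 1) := by
    obtain ⟨x, hx⟩ := exists_ne (0 : X)
    have : Nonempty {h : X // h ≠ 0} := ⟨⟨x, hx⟩⟩
    have hpos : (0 : ℝ) < 1 / ((n : ℝ) + 1) := Nat.one_div_pos_of_nat
    obtain ⟨⟨k, hk⟩, hlt⟩ := exists_lt_of_ciInf_lt (lt_add_of_pos_right (specSB V) hpos)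
    have hk' := integ_prim_sq_pos hk
    set r := (Real.sqrt (integ (prim k * prim k)))⁻¹ with hr
    have hrr : r * r = (integ (prim k * prim k))⁻¹ := by
      rw [hr, ← mul_inv, Real.mul_self_sqrt hk'.le]
    have hprim : prim (r • k) * prim (r • k) = (r * r) • (prim k * prim k) := by
      rw [map_smul, smul_mul_smul_comm]
    refine ⟨r • k, ?_, ?_⟩
    · rw [hprim, map_smul, hrr, smul_eq_mul, inv_mul_cancel₀ hk'.ne']
    · have : quadSB V (r • k) = r * r * quadSB V k := by
        rw [quadSB, hprim, mul_smul_comm, map_smul, norm_smul, mul_pow, Real.norm_eq_abs, sq_abs,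
          smul_eq_mul, quadSB]
        ring
      rw [this, hrr, ← div_eq_inv_mul]
      exact hlt.le
  choose h h1 h2 using hex
  have hq : Tendsto (fun n => quadSB V (h n)) atTop (𝓝 (specSB V)) := by
    have hup : Tendsto (fun n : ℕ => specSB V + 1 / ((n : ℝ) + 1)) atTop (𝓝 (specSB V)) := by
      simpa using tendsto_one_div_add_atTop_nhds_zero_nat.const_add (specSB V)
    refine tendsto_of_tendsto_of_tendsto_of_le_of_le tendsto_const_nhds hup (fun n => ?_) h2
    simpa [h1] using specSB_mul_le V (h n)
  obtain ⟨k, -, -, -, hk⟩ := exists_subseq_tendsto_ground tendsto_const_nhds h1 hq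
  exact ⟨k, hk⟩

/-- The square of the normalised ground state of `-d²/dx² + V`. -/
def groundSq (V : CI) : CI :=
  prim (exists_isGround V).choose * prim (exists_isGround V).choose

theorem IsGround.sq_eq_groundSq {V : CI} {h : X} (hh : IsGround V h) :
    prim h * prim h = groundSq V :=
  hh.sq_eq (exists_isGround V).choose_spec

theorem continuous_groundSq : Continuous groundSq := by
  refine continuous_iff_continuousAt.2 fun V => tendsto_of_subseq_tendsto fun W hW => ?_
  set h : ℕ → X := fun n => (exists_isGround (W n)).choose
  have hg (n : ℕ) : IsGround (W n) (h n) := (exists_isGround (W n)).choose_spec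
  obtain ⟨k, φ, -, hlim, hk⟩ := exists_subseq_tendsto_ground hW (fun n => (hg n).1)
    (((continuous_specSB.tendsto V).comp hW).congr fun n => (hg n).2.symm)
  refine ⟨φ, ?_⟩
  rw [← hk.sq_eq_groundSq]
  have := (prim.continuous.tendsto k).comp hlim
  exact this.mul this

/-- The derivative of `specSB` at `V`: integration against the squared ground state. -/
def specSBDeriv (V : CI) : CI →L[ℝ] ℝ := integ.comp (ContinuousLinearMap.mul ℝ CI (groundSq V))

theorem specSB_add_le (V k : CI) : specSB (V + k) ≤ specSB V + integ (groundSq V * k) := by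
  obtain ⟨h, hh⟩ := exists_isGround V
  have h1 := specSB_mul_le (V + k) h
  rwa [hh.1, mul_one, quadSB_add, hh.2, hh.sq_eq_groundSq, mul_comm k] at h1

theorem hasFDerivAt_specSB (V : CI) : HasFDerivAt specSB (specSBDeriv V) V := by
  rw [hasFDerivAt_iff_isLittleO_nhds_zero, Asymptotics.isLittleO_iff]
  intro c hc
  have hcont : ContinuousAt (fun k : CI => ‖groundSq (V + k) - groundSq V‖) 0 := by
    have := continuous_groundSq
    fun_prop
  have hev : ∀ᶠ k in 𝓝 (0 : CI), ‖groundSq (V + k) - groundSq V‖ < c / 2 :=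
    hcont.eventually_lt_const (by simpa using half_pos hc)
  filter_upwards [hev] with k hk
  have h1 := specSB_add_le V k
  have h2 := specSB_add_le (V + k) (-k)
  rw [add_neg_cancel_right, mul_neg, map_neg] at h2
  have h3 : integ ((groundSq (V + k) - groundSq V) * k)
      = integ (groundSq (V + k) * k) - integ (groundSq V * k) := by rw [sub_mul, map_sub]
  have h4 : |integ ((groundSq (V + k) - groundSq V) * k)| ≤ c * ‖k‖ := by
    refine (abs_integ_le _).trans ?_
    have := norm_mul_le (groundSq (V + k) - groundSq V) k
    have := mul_le_mul_of_nonneg_right hk.le (norm_nonneg k)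
    linarith
  have h5 := abs_le.1 h4
  have h6 : specSBDeriv V k = integ (groundSq V * k) := rfl
  have h7 : 0 ≤ c * ‖k‖ := by positivity
  rw [Real.norm_eq_abs, h6, abs_le]
  constructor <;> linarith

theorem contDiff_specSB : ContDiff ℝ 1 specSB := by
  refine contDiff_one_iff_fderiv.2 ⟨fun V => (hasFDerivAt_specSB V).differentiableAt, ?_⟩
  rw [funext fun V => (hasFDerivAt_specSB V).fderiv]
  exact continuous_const.clm_comp
    ((ContinuousLinearMap.mul ℝ CI).continuous.comp continuous_groundSq)

/-! ### The Euler–Lagrange map and the implicit function theorem -/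

/-- The Euler–Lagrange map of the eigenvalue exchange problem at `σ = (θ, λ)`. -/
def residual (σ : ℝ × ℝ) (w : X × X) : X × X := w + σ.2 ^ 2 • eeForce σ.1 w

/-- The coefficients of the form `λ² Φ` at `σ = (θ, λ)`. -/
def hessCoeff (σ : ℝ × ℝ) (w : X × X) : CI × CI × CI := σ.2 ^ 2 • hessSP σ.1 w

/-- `w` parametrises a solution at `σ = (θ, λ)` with `ν > 0`. -/
def IsNondeg (σ : ℝ × ℝ) (w : X × X) : Prop := residual σ w = 0 ∧ 0 < specSP (hessCoeff σ w)

theorem contDiffAt_qPlus {n : WithTop ℕ∞} {θ : ℝ} (hθ : θ < 1) : ContDiffAt ℝ n qPlus θ := by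
  have : ContDiffAt ℝ n (fun θ : ℝ => Real.sqrt (1 - θ)) θ :=
    (contDiffAt_const.sub contDiffAt_id).sqrt (sub_pos.2 hθ).ne'
  unfold qPlus
  fun_prop

theorem continuous_qPlus : Continuous qPlus := by
  unfold qPlus
  fun_prop

theorem contDiffAt_coord₁ {n : WithTop ℕ∞} {p : (ℝ × ℝ) × (X × X)} (hp : p.1.1 < 1) :
    ContDiffAt ℝ n (fun p : (ℝ × ℝ) × (X × X) => coord₁ p.1.1 p.2.1) p := by
  have h1 : ContDiffAt ℝ n (fun p : (ℝ × ℝ) × (X × X) => qPlus p.1.1) p :=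
    (contDiffAt_qPlus hp).comp p (f := fun p : (ℝ × ℝ) × (X × X) => p.1.1) (by fun_prop)
  unfold coord₁
  fun_prop

theorem contDiffAt_coord₂ {n : WithTop ℕ∞} {p : (ℝ × ℝ) × (X × X)} (hp : p.1.1 < 1) :
    ContDiffAt ℝ n (fun p : (ℝ × ℝ) × (X × X) => coord₂ p.1.1 p.2.2) p := by
  have h1 : ContDiffAt ℝ n (fun p : (ℝ × ℝ) × (X × X) => qPlus p.1.1) p :=
    (contDiffAt_qPlus hp).comp p (f := fun p : (ℝ × ℝ) × (X × X) => p.1.1) (by fun_prop)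
  unfold coord₂
  fun_prop

theorem contDiffAt_potSB {n : WithTop ℕ∞} {p : (ℝ × ℝ) × (X × X)} (hp : p.1.1 < 1) :
    ContDiffAt ℝ n (fun p : (ℝ × ℝ) × (X × X) => potSB p.1.1 p.2) p := by
  have h1 := contDiffAt_coord₁ (n := n) hp
  have h2 := contDiffAt_coord₂ (n := n) hp
  unfold potSB pot rho
  fun_prop

theorem contDiffAt_residual {n : WithTop ℕ∞} {p : (ℝ × ℝ) × (X × X)} (hp : p.1.1 < 1) :
    ContDiffAt ℝ n (fun p : (ℝ × ℝ) × (X × X) => residual p.1 p.2) p := by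
  have h1 := contDiffAt_coord₁ (n := n) hp
  have h2 := contDiffAt_coord₂ (n := n) hp
  have h3 := contDiffAt_potSB (n := n) hp
  unfold potSB at h3
  have h4 : ContDiffAt ℝ n (fun p : (ℝ × ℝ) × (X × X) =>
      grad₁ p.1.1 (coord₁ p.1.1 p.2.1) (coord₂ p.1.1 p.2.2) 0) p := by
    unfold grad₁ rho
    fun_prop
  unfold residual eeForce
  fun_prop

theorem continuous_coord₁ :
    Continuous (fun p : (ℝ × ℝ) × (X × X) => coord₁ p.1.1 p.2.1) := by
  have := continuous_qPlus
  unfold coord₁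
  fun_prop

theorem continuous_coord₂ :
    Continuous (fun p : (ℝ × ℝ) × (X × X) => coord₂ p.1.1 p.2.2) := by
  have := continuous_qPlus
  unfold coord₂
  fun_prop

theorem continuous_potSB : Continuous (fun p : (ℝ × ℝ) × (X × X) => potSB p.1.1 p.2) := by
  have h1 := continuous_coord₁
  have h2 := continuous_coord₂
  unfold potSB pot rho
  fun_prop

theorem continuous_hessCoeff : Continuous (fun p : (ℝ × ℝ) × (X × X) => hessCoeff p.1 p.2) := by
  have h1 := continuous_coord₁
  have h2 := continuous_coord₂
  unfold hessCoeff hessSP hess₁₁ hess₁₂ hess₂₂ pot rho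
  fun_prop

theorem continuous_residual : Continuous (fun p : (ℝ × ℝ) × (X × X) => residual p.1 p.2) := by
  have h1 := continuous_coord₁
  have h2 := continuous_coord₂
  unfold residual eeForce grad₁ pot rho
  fun_prop

theorem continuous_specSP_hessCoeff :
    Continuous (fun p : (ℝ × ℝ) × (X × X) => specSP (hessCoeff p.1 p.2)) :=
  continuous_specSP.comp continuous_hessCoeff

/-- The linearisation of the bulk force in direction `k`. -/
def eeForceLin (θ : ℝ) (w k : X × X) : X × X :=
  ((1 / 6 : ℝ) • J ((hessSP θ w).1 * prim k.1 + (hessSP θ w).2.1 * prim k.2),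
    (1 / 2 : ℝ) • J ((hessSP θ w).2.1 * prim k.1 + (hessSP θ w).2.2 * prim k.2))

theorem grad₁_line (θ : ℝ) (a b h k : CI) : ∃ e₂ e₃ : CI, ∀ t : ℝ,
    grad₁ θ (a + t • h) (b + t • k) 0 = grad₁ θ a b 0
      + t • (hess₁₁ θ a b 0 * h + hess₁₂ a b * k) + t ^ 2 • e₂ + t ^ 3 • e₃ := by
  refine ⟨(12 : ℝ) • (h * h) - (4 : ℝ) • (k * k) + (6 : ℝ) • (a * rho h k 0)
    + (6 : ℝ) • (h * ((6 : ℝ) • (a * h) + (2 : ℝ) • (b * k))), (6 : ℝ) • (h * rho h k 0),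
    fun t => ?_⟩
  ext x
  simp only [grad₁, rho, hess₁₁, hess₁₂, ContinuousMap.add_apply, ContinuousMap.sub_apply,
    ContinuousMap.smul_apply, ContinuousMap.mul_apply, smul_eq_mul, ContinuousMap.one_apply,
    ContinuousMap.zero_apply]
  ring

theorem pot_mul_line (θ : ℝ) (a b h k : CI) : ∃ e₂ e₃ : CI, ∀ t : ℝ,
    pot θ (a + t • h) (b + t • k) 0 * (b + t • k) = pot θ a b 0 * b
      + t • (hess₁₂ a b * h + hess₂₂ θ a b 0 * k) + t ^ 2 • e₂ + t ^ 3 • e₃ := by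
  refine ⟨(2 : ℝ) • (((6 : ℝ) • (a * h) + (2 : ℝ) • (b * k)) * k + rho h k 0 * b)
    - (8 : ℝ) • (h * k), (2 : ℝ) • (rho h k 0 * k), fun t => ?_⟩
  ext x
  simp only [pot, rho, hess₂₂, hess₁₂, ContinuousMap.add_apply, ContinuousMap.sub_apply,
    ContinuousMap.smul_apply, ContinuousMap.mul_apply, smul_eq_mul, ContinuousMap.one_apply,
    ContinuousMap.zero_apply]
  ring

theorem hasDerivAt_cubic {E : Type*} [NormedAddCommGroup E] [NormedSpace ℝ E] (e₀ e₁ e₂ e₃ : E) :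
    HasDerivAt (fun t : ℝ => e₀ + t • e₁ + t ^ 2 • e₂ + t ^ 3 • e₃) e₁ 0 := by
  have h1 := (hasDerivAt_id (0 : ℝ)).smul_const e₁
  have h2 := (hasDerivAt_pow 2 (0 : ℝ)).smul_const e₂
  have h3 := (hasDerivAt_pow 3 (0 : ℝ)).smul_const e₃
  refine (((h1.const_add e₀).add h2).add h3).congr_deriv ?_
  simp

theorem hasDerivAt_eeForce_line (θ : ℝ) (w k : X × X) :
    HasDerivAt (fun t : ℝ => eeForce θ (w + t • k)) (eeForceLin θ w k) 0 := by
  obtain ⟨e₂, e₃, he⟩ := grad₁_line θ (coord₁ θ w.1) (coord₂ θ w.2) (prim k.1) (prim k.2)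
  obtain ⟨f₂, f₃, hf⟩ := pot_mul_line θ (coord₁ θ w.1) (coord₂ θ w.2) (prim k.1) (prim k.2)
  have c1 (t : ℝ) : coord₁ θ (w + t • k).1 = coord₁ θ w.1 + t • prim k.1 := by
    simp [coord₁, add_assoc]
  have c2 (t : ℝ) : coord₂ θ (w + t • k).2 = coord₂ θ w.2 + t • prim k.2 := by
    simp [coord₂, add_assoc]
  simp only [eeForce, c1, c2, he, hf]
  have h1 := J.hasFDerivAt.comp_hasDerivAt (0 : ℝ) (hasDerivAt_cubic
    (grad₁ θ (coord₁ θ w.1) (coord₂ θ w.2) 0)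
    (hess₁₁ θ (coord₁ θ w.1) (coord₂ θ w.2) 0 * prim k.1
      + hess₁₂ (coord₁ θ w.1) (coord₂ θ w.2) * prim k.2) e₂ e₃)
  have h2 := J.hasFDerivAt.comp_hasDerivAt (0 : ℝ) (hasDerivAt_cubic
    (pot θ (coord₁ θ w.1) (coord₂ θ w.2) 0 * coord₂ θ w.2)
    (hess₁₂ (coord₁ θ w.1) (coord₂ θ w.2) * prim k.1
      + hess₂₂ θ (coord₁ θ w.1) (coord₂ θ w.2) 0 * prim k.2) f₂ f₃)
  exact (h1.const_smul (1 / 6 : ℝ)).prodMk (h2.const_smul (1 / 2 : ℝ))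

/-- The partial derivative of the Euler–Lagrange map in `w` represents the form `λ² Φ`. -/
theorem quadSP_eq_inner (σ : ℝ × ℝ) (w k : X × X) :
    6 * inner ℝ (k + σ.2 ^ 2 • eeForceLin σ.1 w k).1 k.1
      + 2 * inner ℝ (k + σ.2 ^ 2 • eeForceLin σ.1 w k).2 k.2 = quadSP (hessCoeff σ w) k := by
  have e1 : (k + σ.2 ^ 2 • eeForceLin σ.1 w k).1 = (1 : ℝ) • k.1 + (σ.2 ^ 2 / 6) •
      J ((hessSP σ.1 w).1 * prim k.1 + (hessSP σ.1 w).2.1 * prim k.2) := by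
    simp only [eeForceLin, Prod.fst_add, Prod.smul_fst, smul_smul, one_smul]
    ring_nf
  have e2 : (k + σ.2 ^ 2 • eeForceLin σ.1 w k).2 = (1 : ℝ) • k.2 + (σ.2 ^ 2 / 2) •
      J ((hessSP σ.1 w).2.1 * prim k.1 + (hessSP σ.1 w).2.2 * prim k.2) := by
    simp only [eeForceLin, Prod.snd_add, Prod.smul_snd, smul_smul, one_smul]
    ring_nf
  have e3 : potSP (hessCoeff σ w) k = σ.2 ^ 2 *
      (integ (((hessSP σ.1 w).1 * prim k.1 + (hessSP σ.1 w).2.1 * prim k.2) * prim k.1)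
      + integ (((hessSP σ.1 w).2.1 * prim k.1 + (hessSP σ.1 w).2.2 * prim k.2) * prim k.2)) := by
    rw [potSP, ← map_add, ← smul_eq_mul (σ.2 ^ 2), ← map_smul]
    congr 1
    ext x
    simp [hessCoeff]
    ring
  rw [e1, e2, inner_smul_add_smul_J, inner_smul_add_smul_J, quadSP, e3,
    real_inner_self_eq_norm_sq, real_inner_self_eq_norm_sq]
  ring

/-- The Lax–Milgram theorem on `H¹₀ × H¹₀` with a weighted inner product. -/
theorem isInvertible_of_coercive (D : X × X →L[ℝ] X × X) {κ : ℝ} (hκ : 0 < κ)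
    (h : ∀ k : X × X, κ * (‖k.1‖ ^ 2 + ‖k.2‖ ^ 2)
      ≤ 6 * inner ℝ (D k).1 k.1 + 2 * inner ℝ (D k).2 k.2) : D.IsInvertible := by
  let e := WithLp.prodContinuousLinearEquiv 2 ℝ X X
  let S : (X × X) ≃L[ℝ] (X × X) :=
    (ContinuousLinearEquiv.smulLeft (Units.mk0 (6 : ℝ) (by norm_num))).prodCongr
      (ContinuousLinearEquiv.smulLeft (Units.mk0 (2 : ℝ) (by norm_num)))
  let T : WithLp 2 (X × X) →L[ℝ] WithLp 2 (X × X) :=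
    (e.symm : (X × X) →L[ℝ] WithLp 2 (X × X)) ∘L ((S : (X × X) →L[ℝ] (X × X)) ∘L D) ∘L
      (e : WithLp 2 (X × X) →L[ℝ] X × X)
  have hT : IsUnit T := by
    refine ContinuousLinearMap.isUnit_of_forall_le_norm_inner_map (𝕜 := ℝ) T
      (c := κ.toNNReal) (Real.toNNReal_pos.2 hκ) fun x => ?_
    have e1 : inner ℝ (T x) x = 6 * inner ℝ (D (e x)).1 (e x).1
        + 2 * inner ℝ (D (e x)).2 (e x).2 := by
      rw [WithLp.prod_inner_apply]
      show inner ℝ ((6 : ℝ) • (D (e x)).1) (e x).1 + inner ℝ ((2 : ℝ) • (D (e x)).2) (e x).2 = _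
      rw [real_inner_smul_left, real_inner_smul_left]
    have e2 : ‖x‖ ^ 2 = ‖(e x).1‖ ^ 2 + ‖(e x).2‖ ^ 2 := WithLp.prod_norm_sq_eq_of_L2 x
    rw [e1, e2, Real.coe_toNNReal _ hκ.le, mul_comm]
    exact (h (e x)).trans (le_abs_self _)
  obtain ⟨U, hU⟩ := hT
  have hT' : T.IsInvertible := ⟨ContinuousLinearEquiv.unitsEquiv ℝ _ U, by rw [← hU]; rfl⟩
  simpa [T] using hT'

/-- Near a solution with `ν > 0`, the solutions form the graph of a smooth function of `(θ, λ)`. -/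
theorem IsNondeg.exists_local {σ₀ : ℝ × ℝ} {w₀ : X × X} (hσ : σ₀.1 < 1) (h : IsNondeg σ₀ w₀) :
    ∃ u : ℝ × ℝ → X × X, u σ₀ = w₀ ∧ ContDiffAt ℝ (⊤ : ℕ∞) u σ₀ ∧
      ∀ᶠ p in 𝓝 (σ₀, w₀), residual p.1 p.2 = 0 ↔ u p.1 = p.2 := by
  set F : (ℝ × ℝ) × (X × X) → X × X := fun p => residual p.1 p.2 with hF
  have hc : ContDiffAt ℝ (⊤ : ℕ∞) F (σ₀, w₀) := contDiffAt_residual hσ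
  have hn : ((⊤ : ℕ∞) : WithTop ℕ∞) ≠ 0 := by simp
  set D := fderiv ℝ F (σ₀, w₀) ∘L .inr ℝ (ℝ × ℝ) (X × X) with hD
  have hDk (k : X × X) : D k = k + σ₀.2 ^ 2 • eeForceLin σ₀.1 w₀ k := by
    have hline : HasDerivAt (fun t : ℝ => (σ₀, w₀ + t • k)) ((0 : ℝ × ℝ), k) 0 := by
      refine (hasDerivAt_const (0 : ℝ) σ₀).prodMk ?_
      simpa using ((hasDerivAt_id (0 : ℝ)).smul_const k).const_add w₀
    have h1 : HasFDerivAt F (fderiv ℝ F (σ₀, w₀)) (σ₀, w₀ + (0 : ℝ) • k) := by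
      rw [zero_smul, add_zero]
      exact (hc.differentiableAt hn).hasFDerivAt
    have h2 := h1.comp_hasDerivAt (0 : ℝ) hline
    have h3 : HasDerivAt (fun t : ℝ => F (σ₀, w₀ + t • k))
        (k + σ₀.2 ^ 2 • eeForceLin σ₀.1 w₀ k) 0 := by
      have e1 : HasDerivAt (fun t : ℝ => w₀ + t • k) k 0 := by
        simpa using ((hasDerivAt_id (0 : ℝ)).smul_const k).const_add w₀
      exact e1.add ((hasDerivAt_eeForce_line σ₀.1 w₀ k).const_smul (σ₀.2 ^ 2))
    exact h2.unique h3
  have hinv : D.IsInvertible := by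
    obtain ⟨κ, hκ, hco⟩ := exists_coercive_quadSP h.2
    refine isInvertible_of_coercive D hκ fun k => ?_
    rw [hDk, quadSP_eq_inner]
    exact hco k
  refine ⟨hc.implicitFunction hn hinv, hc.implicitFunction_apply_self hn hinv,
    hc.contDiffAt_implicitFunction hn hinv, ?_⟩
  have := hc.eventually_apply_eq_iff_implicitFunction hn hinv
  rwa [show F (σ₀, w₀) = 0 from h.1] at this

/-- The local branch through a solution with `ν > 0` is continuous and consists of solutions with
`ν > 0`. -/
theorem IsNondeg.exists_local' {σ₀ : ℝ × ℝ} {w₀ : X × X} (hσ : σ₀.1 < 1) (h : IsNondeg σ₀ w₀) :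
    ∃ u : ℝ × ℝ → X × X, u σ₀ = w₀ ∧ ContDiffAt ℝ (⊤ : ℕ∞) u σ₀ ∧
      (∀ᶠ p in 𝓝 (σ₀, w₀), residual p.1 p.2 = 0 → p.2 = u p.1) ∧
      ∀ᶠ σ in 𝓝 σ₀, IsNondeg σ (u σ) ∧ ContinuousAt u σ := by
  obtain ⟨u, hu0, hu, hev⟩ := h.exists_local hσ
  refine ⟨u, hu0, hu, hev.mono fun p hp hres => (hp.1 hres).symm, ?_⟩
  have hgraph : Tendsto (fun σ => (σ, u σ)) (𝓝 σ₀) (𝓝 (σ₀, w₀)) := by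
    rw [← hu0]
    exact (continuousAt_id.prodMk hu.continuousAt).tendsto
  have hpos : ∀ᶠ p in 𝓝 (σ₀, w₀), 0 < specSP (hessCoeff p.1 p.2) :=
    continuous_specSP_hessCoeff.continuousAt.eventually_const_lt h.2
  have hcont : ∀ᶠ σ in 𝓝 σ₀, ContDiffAt ℝ 1 u σ :=
    (hu.of_le (by exact_mod_cast le_top)).eventually (by simp)
  filter_upwards [hgraph.eventually hev, hgraph.eventually hpos, hcont] with σ h1 h2 h3
  exact ⟨⟨h1.2 rfl, h2⟩, h3.continuousAt⟩

/-! ### Continuous families of solutions starting at `λ = 0` -/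

/-- `γ` is a continuous family of solutions with `ν > 0` at temperature `θ`, parametrised by
`λ ∈ [0,S]`. At `λ = 0` the only solution is `0`. -/
structure IsPath (θ S : ℝ) (γ : ℝ → X × X) : Prop where
  cont : ContinuousOn γ (Set.Icc 0 S)
  nondeg : ∀ t ∈ Set.Icc 0 S, IsNondeg (θ, t) (γ t)

theorem residual_zero (θ : ℝ) (w : X × X) : residual (θ, 0) w = w := by
  simp [residual]

theorem isNondeg_zero (θ : ℝ) : IsNondeg (θ, 0) 0 := by
  refine ⟨residual_zero θ 0, ?_⟩
  have : hessCoeff (θ, 0) 0 = 0 := by simp [hessCoeff]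
  rw [this]
  exact specSP_zero_pos

theorem IsPath.mono {θ S T : ℝ} {γ : ℝ → X × X} (h : IsPath θ S γ) (hT : T ≤ S) :
    IsPath θ T γ :=
  ⟨h.cont.mono (Set.Icc_subset_Icc_right hT), fun t ht => h.nondeg t ⟨ht.1, ht.2.trans hT⟩⟩

theorem isPath_zero (θ : ℝ) : IsPath θ 0 fun _ => 0 :=
  ⟨continuousOn_const, fun t ht => by
    obtain rfl : t = 0 := le_antisymm ht.2 ht.1
    exact isNondeg_zero θ⟩

theorem IsPath.apply_zero {θ S : ℝ} {γ : ℝ → X × X} (h : IsPath θ S γ) (hS : 0 ≤ S) : γ 0 = 0 := by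
  rw [← residual_zero θ (γ 0)]
  exact (h.nondeg 0 ⟨le_rfl, hS⟩).1

/-- Families of solutions with `ν > 0` are determined by their starting point. -/
theorem IsPath.eqOn {θ S : ℝ} (hθ : θ < 1) {γ γ' : ℝ → X × X} (h : IsPath θ S γ)
    (h' : IsPath θ S γ') : Set.EqOn γ γ' (Set.Icc 0 S) := by
  rcases lt_or_ge S 0 with hS | hS
  · simp [Set.Icc_eq_empty_of_lt hS]
  have hclosed : IsClosed ({t | γ t = γ' t} ∩ Set.Icc 0 S) := by
    have := (h.cont.sub h'.cont).preimage_isClosed_of_isClosed isClosed_Icc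
      (isClosed_singleton (x := (0 : X × X)))
    convert this using 1
    ext t
    simp [sub_eq_zero, and_comm]
  refine hclosed.Icc_subset_of_forall_mem_nhdsWithin
    ((h.apply_zero hS).trans (h'.apply_zero hS).symm) ?_
  rintro t ⟨hEq, ht⟩
  have htI : t ∈ Set.Icc 0 S := ⟨ht.1, ht.2.le⟩
  obtain ⟨u, -, -, hu, -⟩ := (h.nondeg t htI).exists_local' hθ
  have hle : 𝓝[>] t ≤ 𝓝[Set.Icc 0 S] t :=
    nhdsWithin_le_of_mem (Icc_mem_nhdsGT_of_mem ht)
  have hpair {γ : ℝ → X × X} (hγ : ContinuousOn γ (Set.Icc 0 S)) :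
      Tendsto (fun s => ((θ, s), γ s)) (𝓝[>] t) (𝓝 ((θ, t), γ t)) := by
    refine Tendsto.prodMk_nhds (tendsto_const_nhds.prodMk_nhds ?_) ((hγ t htI).mono_left hle)
    exact tendsto_nhdsWithin_of_tendsto_nhds tendsto_id
  have h2 := hpair h'.cont
  rw [← show γ t = γ' t from hEq] at h2
  filter_upwards [(hpair h.cont).eventually hu, h2.eventually hu,
    hle self_mem_nhdsWithin] with s h1 h2 hs
  exact (h1 (h.nondeg s hs).1).trans (h2 (h'.nondeg s hs).1).symm

/-- An open condition that holds along a compact curve holds in a uniform neighbourhood of it, for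
all nearby temperatures. -/
theorem exists_uniform_nhds {E : Type*} [NormedAddCommGroup E] {K : Set ℝ} (hK : IsCompact K)
    {Γ : ℝ → E} (hΓ : Continuous Γ) {θ₀ : ℝ} {Q : ℝ × ℝ → E → Prop}
    (hQ : ∀ t ∈ K, ∀ᶠ p in 𝓝 ((θ₀, t), Γ t), Q p.1 p.2) :
    ∃ η > 0, ∀ᶠ θ in 𝓝 θ₀, ∀ t ∈ K, ∀ v, ‖v - Γ t‖ < η → Q (θ, t) v := by
  have key : ∀ᶠ x : ℝ × ℝ in 𝓝 (0, θ₀), ∀ t ∈ K, ∀ v, ‖v - Γ t‖ < x.1 → Q (x.2, t) v := by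
    refine hK.eventually_forall_of_forall_eventually fun t ht => ?_
    obtain ⟨U, hU, V, hV, hUV⟩ := mem_nhds_prod_iff.1 (hQ t ht)
    obtain ⟨r, hr, hrV⟩ := Metric.mem_nhds_iff.1 hV
    have h1 : ∀ᶠ z : (ℝ × ℝ) × ℝ in 𝓝 ((0, θ₀), t), z.1.1 < r / 2 := by
      have : ContinuousAt (fun z : (ℝ × ℝ) × ℝ => z.1.1) ((0, θ₀), t) := by fun_prop
      exact this.eventually_lt_const (half_pos hr)
    have h2 : ∀ᶠ z : (ℝ × ℝ) × ℝ in 𝓝 ((0, θ₀), t), (z.1.2, z.2) ∈ U := by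
      have : ContinuousAt (fun z : (ℝ × ℝ) × ℝ => (z.1.2, z.2)) ((0, θ₀), t) := by fun_prop
      exact this.eventually_mem hU
    have h3 : ∀ᶠ z : (ℝ × ℝ) × ℝ in 𝓝 ((0, θ₀), t), ‖Γ z.2 - Γ t‖ < r / 2 := by
      have : ContinuousAt (fun z : (ℝ × ℝ) × ℝ => ‖Γ z.2 - Γ t‖) ((0, θ₀), t) := by fun_prop
      exact this.eventually_lt_const (by simpa using half_pos hr)
    filter_upwards [h1, h2, h3] with z h1 h2 h3 v hv
    refine hUV (Set.mk_mem_prod h2 (hrV ?_))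
    rw [mem_ball_iff_norm, ← sub_add_sub_cancel v (Γ z.2) (Γ t)]
    refine (norm_add_le _ _).trans_lt ?_
    linarith
  rw [nhds_prod_eq] at key
  obtain ⟨η, h1, h2⟩ := ((key.curry.filter_mono nhdsWithin_le_nhds).and
    (self_mem_nhdsWithin : Set.Ioi (0 : ℝ) ∈ 𝓝[>] 0)).exists
  exact ⟨η, h2, h1⟩

/-- A path, continued by constants outside `[0,S]`. -/
theorem IsPath.continuous_comp_projIcc {θ S : ℝ} (hS : 0 ≤ S) {γ : ℝ → X × X} (h : IsPath θ S γ) :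
    Continuous fun t : ℝ => γ (Set.projIcc 0 S hS t) :=
  (continuousOn_iff_continuous_domRestrict.1 h.cont).comp continuous_projIcc

/-- A family of solutions with `ν > 0` persists, with small changes, at nearby temperatures. -/
theorem IsPath.eventually_exists {θ₀ S : ℝ} (hθ₀ : θ₀ < 1) (hS : 0 ≤ S) {γ₀ : ℝ → X × X}
    (h : IsPath θ₀ S γ₀) {η : ℝ} (hη : 0 < η) :
    ∀ᶠ θ in 𝓝 θ₀, ∃ γ, IsPath θ S γ ∧ ∀ t ∈ Set.Icc 0 S, ‖γ t - γ₀ t‖ < η := by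
  -- it may be assumed that `γ₀` is continuous on the whole line
  wlog hc : Continuous γ₀ generalizing γ₀
  · have hEq : ∀ t ∈ Set.Icc 0 S, γ₀ (Set.projIcc 0 S hS t) = γ₀ t := fun t ht => by
      rw [Set.projIcc_of_mem hS ht]
    have hcc := h.continuous_comp_projIcc hS
    have := this (γ₀ := fun t => γ₀ (Set.projIcc 0 S hS t))
      ⟨hcc.continuousOn, fun t ht => by rw [hEq t ht]; exact h.nondeg t ht⟩ hcc
    refine this.mono fun θ ⟨γ, h1, h2⟩ => ⟨γ, h1, fun t ht => ?_⟩
    rw [← hEq t ht]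
    exact h2 t ht
  have hcpt : IsCompact (Set.Icc 0 S) := isCompact_Icc
  -- solutions near the curve are unique
  obtain ⟨r₁, hr₁, huniq⟩ := exists_uniform_nhds hcpt (Γ := fun t => (γ₀ t, γ₀ t)) (by fun_prop)
    (θ₀ := θ₀) (Q := fun σ v => residual σ v.1 = 0 → residual σ v.2 = 0 → v.1 = v.2) (by
      intro t ht
      obtain ⟨u, -, -, hu, -⟩ := (h.nondeg t ht).exists_local' hθ₀
      have c1 : Tendsto (fun p : (ℝ × ℝ) × ((X × X) × (X × X)) => (p.1, p.2.1))
          (𝓝 ((θ₀, t), (γ₀ t, γ₀ t))) (𝓝 ((θ₀, t), γ₀ t)) :=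
        ContinuousAt.tendsto (by fun_prop)
      have c2 : Tendsto (fun p : (ℝ × ℝ) × ((X × X) × (X × X)) => (p.1, p.2.2))
          (𝓝 ((θ₀, t), (γ₀ t, γ₀ t))) (𝓝 ((θ₀, t), γ₀ t)) :=
        ContinuousAt.tendsto (by fun_prop)
      filter_upwards [c1.eventually hu, c2.eventually hu] with p h1 h2 h3 h4
      exact (h1 h3).trans (h2 h4).symm)
  set r := min r₁ η with hr
  have hrpos : 0 < r := lt_min hr₁ hη
  -- solutions near the curve exist
  have hex : ∀ᶠ θ in 𝓝 θ₀, ∀ t ∈ Set.Icc 0 S, ∃ v, ‖v - γ₀ t‖ < r ∧ IsNondeg (θ, t) v := by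
    refine hcpt.eventually_forall_of_forall_eventually fun t ht => ?_
    obtain ⟨u, hu0, huc, -, hu⟩ := (h.nondeg t ht).exists_local' hθ₀
    have h1 : ∀ᶠ σ : ℝ × ℝ in 𝓝 (θ₀, t), ‖u σ - γ₀ σ.2‖ < r := by
      have hcu := huc.continuousAt
      have : ContinuousAt (fun σ : ℝ × ℝ => ‖u σ - γ₀ σ.2‖) (θ₀, t) := by fun_prop
      exact this.eventually_lt_const (by simpa [hu0] using hrpos)
    filter_upwards [hu, h1] with σ h1 h2
    exact ⟨u σ, h2, h1.1⟩
  filter_upwards [huniq, hex, eventually_lt_nhds hθ₀] with θ hu he hθ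
  choose! γ hγr hγn using he
  refine ⟨γ, ⟨fun t ht => ?_, hγn⟩, fun t ht => (hγr t ht).trans_le (min_le_right _ _)⟩
  obtain ⟨u, hu0, huc, -, hun⟩ := (hγn t ht).exists_local' hθ
  have hpair : ContinuousAt (fun s : ℝ => (θ, s)) t := by fun_prop
  have hcu : ContinuousAt (fun s : ℝ => u (θ, s)) t :=
    ContinuousAt.comp (f := fun s : ℝ => (θ, s)) huc.continuousAt hpair
  have h1 : ∀ᶠ s in 𝓝 t, ‖u (θ, s) - γ₀ s‖ < r := by
    have : ContinuousAt (fun s : ℝ => ‖u (θ, s) - γ₀ s‖) t := by fun_prop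
    exact this.eventually_lt_const (by simpa [hu0] using hγr t ht)
  refine hcu.continuousWithinAt.congr_of_eventuallyEq ?_ hu0.symm
  filter_upwards [nhdsWithin_le_nhds h1, nhdsWithin_le_nhds (hpair.tendsto.eventually hun),
    self_mem_nhdsWithin] with s h1 h2 hs
  refine hu s hs (γ s, u (θ, s)) ?_ (hγn s hs).1 h2.1.1
  rw [Prod.mk_sub_mk, Prod.norm_def]
  exact max_lt ((hγr s hs).trans_le (min_le_left _ _)) (h1.trans_le (min_le_left _ _))

/-- Continuation of a path by a curve of solutions. -/
theorem IsPath.extend {θ S T : ℝ} {γ u : ℝ → X × X} (hS : 0 ≤ S) (hT : S ≤ T) (h : IsPath θ S γ)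
    (huc : ContinuousOn u (Set.Icc S T)) (hun : ∀ t ∈ Set.Icc S T, IsNondeg (θ, t) (u t))
    (hEq : γ S = u S) : ∃ γ', IsPath θ T γ' := by
  classical
  refine ⟨fun t => if t ≤ S then γ t else u t, ?_, fun t ht => ?_⟩
  · rw [← Set.Icc_union_Icc_eq_Icc hS hT]
    refine ContinuousOn.union_of_isClosed (h.cont.congr fun t ht => if_pos ht.2)
      (huc.congr fun t ht => ?_) isClosed_Icc isClosed_Icc
    rcases ht.1.eq_or_lt with rfl | hlt
    · simp [hEq]
    · exact if_neg hlt.not_ge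
  · rcases le_or_gt t S with hle | hlt
    · simp only [if_pos hle]
      exact h.nondeg t ⟨ht.1, hle⟩
    · simp only [if_neg hlt.not_ge]
      exact hun t ⟨hlt.le, ht.2⟩

/-- The lengths `S` such that solutions with `ν > 0` can be continued from `0` up to `S`. -/
def pathDomain (θ : ℝ) : Set ℝ := {S | 0 ≤ S ∧ ∃ γ, IsPath θ S γ}

theorem zero_mem_pathDomain (θ : ℝ) : 0 ∈ pathDomain θ := ⟨le_rfl, _, isPath_zero θ⟩

theorem mem_pathDomain_of_le {θ S T : ℝ} (hS : S ∈ pathDomain θ) (h0 : 0 ≤ T) (hT : T ≤ S) :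
    T ∈ pathDomain θ :=
  ⟨h0, hS.2.imp fun _ h => h.mono hT⟩

open Classical in
/-- The maximal continuous family of solutions with `ν > 0` starting at `λ = 0`. -/
def maxPath (θ S : ℝ) : X × X :=
  if h : S ∈ pathDomain θ then h.2.choose S else 0

theorem IsPath.eqOn_maxPath {θ S : ℝ} (hθ : θ < 1) {γ : ℝ → X × X} (h : IsPath θ S γ) :
    Set.EqOn (maxPath θ) γ (Set.Icc 0 S) := by
  intro t ht
  have hmem : t ∈ pathDomain θ := ⟨ht.1, γ, h.mono ht.2⟩
  rw [maxPath, dif_pos hmem]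
  exact hmem.2.choose_spec.eqOn hθ (h.mono ht.2) ⟨ht.1, le_rfl⟩

theorem isPath_maxPath {θ S : ℝ} (hθ : θ < 1) (hS : S ∈ pathDomain θ) :
    IsPath θ S (maxPath θ) := by
  obtain ⟨γ, hγ⟩ := hS.2
  have hEq := hγ.eqOn_maxPath hθ
  exact ⟨hγ.cont.congr hEq, fun t ht => by rw [hEq ht]; exact hγ.nondeg t ht⟩

/-- If a path arrives at a point close enough to a solution with `ν > 0`, it can be continued past
that solution. -/
theorem exists_mem_pathDomain_gt {θ L : ℝ} (hθ : θ < 1) {w : X × X} (hw : IsNondeg (θ, L) w)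
    {s : ℕ → ℝ} (hs : ∀ n, s n ∈ pathDomain θ) (hsL : ∀ n, s n ≤ L) (hlim : Tendsto s atTop (𝓝 L))
    (hwlim : Tendsto (fun n => maxPath θ (s n)) atTop (𝓝 w)) : ∃ T > L, T ∈ pathDomain θ := by
  obtain ⟨u, hu0, -, hun, huv⟩ := hw.exists_local' hθ
  have hpair (t : ℝ) : ContinuousAt (fun s : ℝ => (θ, s)) t := by fun_prop
  obtain ⟨δ, hδ, hδv⟩ := Metric.eventually_nhds_iff.1 ((hpair L).tendsto.eventually huv)
  have h1 : ∀ᶠ n in atTop, maxPath θ (s n) = u (θ, s n) := by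
    have : Tendsto (fun n => ((θ, s n), maxPath θ (s n))) atTop (𝓝 ((θ, L), w)) :=
      ((hpair L).tendsto.comp hlim).prodMk_nhds hwlim
    filter_upwards [this.eventually hun] with n hn
    exact hn ((isPath_maxPath hθ (hs n)).nondeg _ ⟨(hs n).1, le_rfl⟩).1
  obtain ⟨n, h1, h2⟩ := (h1.and (hlim.eventually (Metric.ball_mem_nhds L hδ))).exists
  have hball (t : ℝ) (ht : t ∈ Set.Icc (s n) (L + δ / 2)) : dist t L < δ := by
    rw [Real.dist_eq, abs_lt] at h2
    rw [Real.dist_eq, abs_lt]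
    constructor <;> linarith [ht.1, ht.2, h2.1]
  refine ⟨L + δ / 2, by linarith, by linarith [(hs n).1, hsL n], ?_⟩
  refine (isPath_maxPath hθ (hs n)).extend (u := fun t => u (θ, t)) (hs n).1
    (by linarith [hsL n]) (fun t ht => ?_) (fun t ht => (hδv (hball t ht)).1) h1
  exact (ContinuousAt.comp (f := fun s : ℝ => (θ, s)) (hδv (hball t ht)).2
    (hpair t)).continuousWithinAt

theorem exists_gt_mem_pathDomain {θ S : ℝ} (hθ : θ < 1) (hS : S ∈ pathDomain θ) :
    ∃ T > S, T ∈ pathDomain θ :=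
  exists_mem_pathDomain_gt hθ ((isPath_maxPath hθ hS).nondeg S ⟨hS.1, le_rfl⟩)
    (s := fun _ => S) (fun _ => hS) (fun _ => le_rfl) tendsto_const_nhds tendsto_const_nhds

/-- The maximal family is locally given by the implicit function theorem. -/
theorem maxPath_eventuallyEq {θ S : ℝ} (hθ : θ < 1) (hS : S ∈ pathDomain θ) (h0 : 0 < S) :
    ∃ u : ℝ × ℝ → X × X, ContDiffAt ℝ (⊤ : ℕ∞) u (θ, S) ∧
      maxPath θ =ᶠ[𝓝 S] fun t => u (θ, t) := by
  obtain ⟨T, hT, hTmem⟩ := exists_gt_mem_pathDomain hθ hS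
  have hp := isPath_maxPath hθ hTmem
  obtain ⟨u, -, hu, huv, -⟩ := (hp.nondeg S ⟨h0.le, hT.le⟩).exists_local' hθ
  refine ⟨u, hu, ?_⟩
  have hnhds : Set.Icc 0 T ∈ 𝓝 S := Icc_mem_nhds h0 hT
  have hc : ContinuousAt (maxPath θ) S := hp.cont.continuousAt hnhds
  have hpair : Tendsto (fun t => ((θ, t), maxPath θ t)) (𝓝 S) (𝓝 ((θ, S), maxPath θ S)) :=
    (tendsto_const_nhds.prodMk_nhds tendsto_id).prodMk_nhds hc
  filter_upwards [hpair.eventually huv, hnhds] with t h1 ht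
  exact h1 (hp.nondeg t ht).1

/-! ### A priori bounds and uniqueness for small `λ` -/

/-- Coercivity of the bulk energy density: `∇f(q)·(q - b)` is bounded below, uniformly for `b` in a
bounded set. The quartic part contributes `2ρ²`, which dominates all other terms. -/
theorem exists_le_grad_mul (θ β : ℝ) : ∃ C : ℝ, 0 ≤ C ∧ ∀ a b c p s : ℝ, |p| ≤ β → |s| ≤ β →
    -C ≤ (2 * θ * a + 12 * (a * a) - 4 * (b * b + c * c)
        + 6 * (a * (3 * (a * a) + b * b + c * c))) * (a - p)
      + (2 * θ / 3 - 8 * a + 2 * (3 * (a * a) + b * b + c * c)) * b * (b - s)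
      + (2 * θ / 3 - 8 * a + 2 * (3 * (a * a) + b * b + c * c)) * c * c := by
  set A := 24 + 8 * |β| with hA
  set B := 2 * |θ| + 24 * |β| with hB
  set D := 4 * |β| * |θ| with hD
  set R := A + B + D + 1 with hR
  have hβ := abs_nonneg β
  have hθ := abs_nonneg θ
  have hA0 : 0 ≤ A := by positivity
  have hB0 : 0 ≤ B := by positivity
  have hD0 : 0 ≤ D := by positivity
  -- the one-variable polynomial bounding the expression from below
  have hpoly (n : ℝ) (hn : 0 ≤ n) :
      -(A * R ^ 3 + B * R ^ 2 + D * R) ≤ 2 * n ^ 4 - A * n ^ 3 - B * n ^ 2 - D * n := by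
    rcases le_total n R with h | h
    · have h1 : A * n ^ 3 ≤ A * R ^ 3 := by gcongr
      have h2 : B * n ^ 2 ≤ B * R ^ 2 := by gcongr
      have h3 : D * n ≤ D * R := by gcongr
      have h4 : 0 ≤ n ^ 4 := by positivity
      linarith
    · have hn1 : 1 ≤ n := by linarith
      have h1 : n ^ 2 ≤ n ^ 3 := pow_le_pow_right₀ hn1 (by norm_num)
      have h2 : n ≤ n ^ 3 := le_self_pow₀ hn1 (by norm_num)
      have h3 : B * n ^ 2 ≤ B * n ^ 3 := by gcongr
      have h4 : D * n ≤ D * n ^ 3 := by gcongr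
      have h5 : (A + B + D) * n ^ 3 ≤ n * n ^ 3 := by gcongr; linarith
      have h6 : 0 ≤ n ^ 4 := by positivity
      have h7 : 0 ≤ A * R ^ 3 + B * R ^ 2 + D * R := by positivity
      nlinarith
  refine ⟨A * R ^ 3 + B * R ^ 2 + D * R, by positivity, fun a b c p s hp hs => ?_⟩
  set ρ := 3 * (a * a) + b * b + c * c with hρ
  have ha2 := mul_self_nonneg a
  have hb2 := mul_self_nonneg b
  have hc2 := mul_self_nonneg c
  have hρ0 : 0 ≤ ρ := by positivity
  set n := Real.sqrt ρ with hn
  have hn0 : 0 ≤ n := Real.sqrt_nonneg _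
  have hnn : n ^ 2 = ρ := Real.sq_sqrt hρ0
  have ha : |a| ≤ n := Real.abs_le_sqrt (by rw [hρ]; nlinarith)
  have hb : |b| ≤ n := Real.abs_le_sqrt (by rw [hρ]; nlinarith)
  have hp' : |p| ≤ |β| := hp.trans (le_abs_self β)
  have hs' : |s| ≤ |β| := hs.trans (le_abs_self β)
  set g := 2 * θ * a + 12 * (a * a) - 4 * (b * b + c * c) + 6 * (a * ρ) with hg
  set W := 2 * θ / 3 - 8 * a + 2 * ρ with hW
  have hgabs : |g| ≤ 2 * |θ| * n + 16 * n ^ 2 + 6 * n ^ 3 := by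
    have h1 : |2 * θ * a| ≤ 2 * |θ| * n := by
      rw [abs_mul, abs_mul, abs_two]; gcongr
    have h2 : |6 * (a * ρ)| ≤ 6 * n ^ 3 := by
      rw [abs_mul, abs_mul, abs_of_nonneg hρ0, abs_of_pos (by norm_num : (0 : ℝ) < 6), ← hnn]
      have : |a| * n ^ 2 ≤ n * n ^ 2 := by gcongr
      linarith
    rw [abs_le] at h1 h2 ⊢
    constructor <;> linarith [h1.1, h1.2, h2.1, h2.2]
  have hWabs : |W| ≤ |θ| + 8 * n + 2 * n ^ 2 := by
    rw [abs_le] at ha ⊢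
    have := neg_abs_le θ
    have := le_abs_self θ
    constructor <;> linarith [ha.1, ha.2]
  have hWb : |W * b| ≤ (|θ| + 8 * n + 2 * n ^ 2) * n := by
    rw [abs_mul]; gcongr
  have hgp : g * p ≤ (2 * |θ| * n + 16 * n ^ 2 + 6 * n ^ 3) * |β| := by
    refine (le_abs_self _).trans ?_
    rw [abs_mul]; gcongr
  have hWs : W * b * s ≤ (|θ| + 8 * n + 2 * n ^ 2) * n * |β| := by
    refine (le_abs_self _).trans ?_
    rw [abs_mul]; gcongr
  -- Euler's identity for the homogeneous parts
  have heuler : g * a + W * b * b + W * c * c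
      = 2 * θ * (a * a) + 2 * θ / 3 * (b * b + c * c) + 12 * (a * (a * a - (b * b + c * c)))
        + 2 * n ^ 4 := by
    rw [hg, hW, show n ^ 4 = ρ * ρ by rw [← hnn]; ring, hρ]; ring
  have hquad : -(2 * |θ| * n ^ 2) ≤ 2 * θ * (a * a) + 2 * θ / 3 * (b * b + c * c) := by
    have h1 : -|θ| * (2 * (a * a) + 2 / 3 * (b * b + c * c))
        ≤ θ * (2 * (a * a) + 2 / 3 * (b * b + c * c)) :=
      mul_le_mul_of_nonneg_right (neg_abs_le θ) (by positivity)
    have h2 : |θ| * (2 * (a * a) + 2 / 3 * (b * b + c * c)) ≤ |θ| * (2 * n ^ 2) :=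
      mul_le_mul_of_nonneg_left (by rw [hnn]; linarith) hθ
    linarith
  have hcub : -(24 * n ^ 3) ≤ 12 * (a * (a * a - (b * b + c * c))) := by
    have h1 : |a * (a * a - (b * b + c * c))| ≤ n * n ^ 2 := by
      rw [abs_mul]
      gcongr
      rw [hnn, abs_le]
      constructor <;> linarith
    have := (abs_le.1 h1).1
    have : 0 ≤ n ^ 3 := by positivity
    linarith
  have := hpoly n hn0
  have e1 : g * (a - p) + W * b * (b - s) + W * c * c
      = (g * a + W * b * b + W * c * c) - g * p - W * b * s := by ring
  rw [e1, heuler]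
  have e2 : (2 * |θ| * n + 16 * n ^ 2 + 6 * n ^ 3) * |β| + (|θ| + 8 * n + 2 * n ^ 2) * n * |β|
      = 8 * |β| * n ^ 3 + 24 * |β| * n ^ 2 + 3 * |β| * |θ| * n := by ring
  have e3 : 0 ≤ |β| * |θ| * n := by positivity
  simp only [hA, hB, hD] at this ⊢
  linarith

/-- Critical points are close to the affine interpolation of the boundary values when `λ` is
small, and bounded when `λ` is. -/
theorem exists_norm_le (θ : ℝ) : ∃ C : ℝ, 0 ≤ C ∧ ∀ (lam : ℝ) (w : X × X × X),
    w + lam ^ 2 • force θ w = 0 → ‖w‖ ≤ C * |lam| := by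
  obtain ⟨C, hC, hbound⟩ := exists_le_grad_mul θ (3 * |qPlus θ|)
  refine ⟨Real.sqrt C, Real.sqrt_nonneg _, fun lam w hw => ?_⟩
  set a := coord₁ θ w.1
  set b := coord₂ θ w.2.1
  set c := prim w.2.2
  have i1 := congrArg (fun u : X × X × X => inner ℝ u.1 w.1) hw
  have i2 := congrArg (fun u : X × X × X => inner ℝ u.2.1 w.2.1) hw
  have i3 := congrArg (fun u : X × X × X => inner ℝ u.2.2 w.2.2) hw
  simp only [force, Prod.fst_add, Prod.snd_add, Prod.smul_fst, Prod.smul_snd, Prod.fst_zero,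
    Prod.snd_zero, inner_add_left, real_inner_smul_left, inner_J, inner_zero_left,
    real_inner_self_eq_norm_sq] at i1 i2 i3
  have hint : -(2 * C) ≤ integ (grad₁ θ a b c * prim w.1) + integ (pot θ a b c * b * prim w.2.1)
      + integ (pot θ a b c * c * prim w.2.2) := by
    rw [← map_add, ← map_add, ← mul_neg, ← integ_const]
    refine integ_mono fun x => ?_
    have h1 : |qPlus θ| ≤ 3 * |qPlus θ| := by linarith [abs_nonneg (qPlus θ)]
    have h2 : |-3 * qPlus θ * x| ≤ 3 * |qPlus θ| := by
      rw [abs_mul, abs_mul]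
      have : |(x : ℝ)| ≤ 1 := abs_le.2 ⟨x.2.1, x.2.2⟩
      have h3 : |(-3 : ℝ)| = 3 := by norm_num
      rw [h3]
      exact mul_le_of_le_one_right (by positivity) this
    have h3 := hbound (a x) (b x) (c x) (qPlus θ) (-3 * qPlus θ * x) h1 h2
    have ha : a x - qPlus θ = prim w.1 x := by
      show qPlus θ * 1 + prim w.1 x - qPlus θ = _
      ring
    have hb : b x - -3 * qPlus θ * x = prim w.2.1 x := by
      show -3 * qPlus θ * x + prim w.2.1 x - -3 * qPlus θ * x = _
      ring
    rw [ha, hb] at h3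
    have hx : (grad₁ θ a b c * prim w.1 + pot θ a b c * b * prim w.2.1
        + pot θ a b c * c * prim w.2.2) x = _ := rfl
    refine (h3.trans_eq ?_).trans_eq hx.symm
    simp only [grad₁, pot, rho, ContinuousMap.add_apply, ContinuousMap.sub_apply,
      ContinuousMap.smul_apply, ContinuousMap.mul_apply, smul_eq_mul, ContinuousMap.one_apply,
      mul_one, c]
  have hsum : 6 * ‖w.1‖ ^ 2 + 2 * ‖w.2.1‖ ^ 2 + 2 * ‖w.2.2‖ ^ 2 ≤ lam ^ 2 * (2 * C) := by
    have := mul_le_mul_of_nonneg_left hint (sq_nonneg lam)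
    linarith
  have n1 := sq_nonneg ‖w.1‖
  have n2 := sq_nonneg ‖w.2.1‖
  have n3 := sq_nonneg ‖w.2.2‖
  have key {y : ℝ} (hy : y ^ 2 ≤ lam ^ 2 * C) : y ≤ Real.sqrt C * |lam| := by
    refine (Real.le_sqrt_of_sq_le hy).trans_eq ?_
    rw [Real.sqrt_mul (sq_nonneg _), Real.sqrt_sq_eq_abs, mul_comm]
  rw [Prod.norm_def, Prod.norm_def]
  exact max_le (key (by linarith)) (max_le (key (by linarith)) (key (by linarith)))

theorem exists_norm_le_ee (θ : ℝ) : ∃ C : ℝ, 0 ≤ C ∧ ∀ (lam : ℝ) (w : X × X),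
    residual (θ, lam) w = 0 → ‖w‖ ≤ C * |lam| := by
  obtain ⟨C, hC, h⟩ := exists_norm_le θ
  refine ⟨C, hC, fun lam w hw => ?_⟩
  have hw' : (w.1, w.2, (0 : X)) + lam ^ 2 • force θ (w.1, w.2, 0) = 0 := by
    rw [force_ee]
    exact Prod.ext (congrArg (fun p => p.1) hw) (Prod.ext (congrArg (fun p => p.2) hw) (by simp))
  have := h lam _ hw'
  rw [Prod.norm_def, Prod.norm_def] at this
  rw [Prod.norm_def]
  exact max_le ((le_max_left _ _).trans this)
    ((le_max_left _ _).trans ((le_max_right _ _).trans this))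

theorem contDiff_force (θ : ℝ) : ContDiff ℝ 1 (force θ) := by
  unfold force grad₁ pot rho coord₁ coord₂
  fun_prop

/-- For small `λ` there is at most one critical point in `ℋ`: all of them are close to the affine
interpolation, where the force is Lipschitz continuous. -/
theorem exists_unique_small (θ : ℝ) : ∃ δ : ℝ, 0 < δ ∧ ∀ lam ∈ Set.Ioo 0 δ, ∀ w w' : X × X × X,
    w + lam ^ 2 • force θ w = 0 → w' + lam ^ 2 • force θ w' = 0 → w = w' := by
  obtain ⟨C, hC, hb⟩ := exists_norm_le θ
  obtain ⟨K, t, ht, hK⟩ := (contDiff_force θ).contDiffAt.exists_lipschitzOnWith (x := 0)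
  obtain ⟨r, hr, hrt⟩ := Metric.mem_nhds_iff.1 ht
  refine ⟨min 1 (min (r / (C + 1)) (1 / (K + 1))), by positivity, ?_⟩
  rintro lam ⟨h0, hlt⟩ w w' hw hw'
  have h1 : lam < 1 := hlt.trans_le (min_le_left _ _)
  have h2 : lam < r / (C + 1) := hlt.trans_le ((min_le_right _ _).trans (min_le_left _ _))
  have h3 : lam < 1 / (K + 1) := hlt.trans_le ((min_le_right _ _).trans (min_le_right _ _))
  have hmem {w : X × X × X} (hw : w + lam ^ 2 • force θ w = 0) : w ∈ t := by
    refine hrt (mem_ball_zero_iff.2 ((hb lam w hw).trans_lt ?_))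
    rw [abs_of_pos h0]
    rw [lt_div_iff₀ (by positivity)] at h2
    linarith
  have hL := hK.dist_le_mul w (hmem hw) w' (hmem hw')
  rw [dist_eq_norm, dist_eq_norm] at hL
  have e1 : w - w' = -(lam ^ 2 • (force θ w - force θ w')) := by
    have f1 := eq_neg_of_add_eq_zero_left hw
    have f2 := eq_neg_of_add_eq_zero_left hw'
    generalize force θ w = g at *
    generalize force θ w' = g' at *
    rw [f1, f2, smul_sub]
    abel
  have e2 : ‖w - w'‖ ≤ lam ^ 2 * (K * ‖w - w'‖) := by
    conv_lhs => rw [e1, norm_neg, norm_smul, Real.norm_eq_abs, abs_of_nonneg (sq_nonneg lam)]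
    gcongr
  rw [lt_div_iff₀ (by positivity)] at h3
  have h4 : lam ^ 2 * K < 1 := by
    have hK0 : (0 : ℝ) ≤ K := K.2
    nlinarith
  have h5 : ‖w - w'‖ = 0 := by
    have := norm_nonneg (w - w')
    nlinarith
  exact sub_eq_zero.1 (norm_eq_zero.1 h5)

/-! ### Existence of the branch -/

theorem tendsto_residual {ι : Type*} {l : Filter ι} {σ : ι → ℝ × ℝ} {w : ι → X × X} {σ₀ : ℝ × ℝ}
    {w₀ : X × X} (hσ : Tendsto σ l (𝓝 σ₀)) (hw : Tendsto w l (𝓝 w₀)) :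
    Tendsto (fun i => residual (σ i) (w i)) l (𝓝 (residual σ₀ w₀)) := by
  have h := (continuous_residual.tendsto (σ₀, w₀)).comp (hσ.prodMk_nhds hw)
  simpa only [Function.comp_def] using h

theorem tendsto_specSP_hessCoeff {ι : Type*} {l : Filter ι} {σ : ι → ℝ × ℝ} {w : ι → X × X}
    {σ₀ : ℝ × ℝ} {w₀ : X × X} (hσ : Tendsto σ l (𝓝 σ₀)) (hw : Tendsto w l (𝓝 w₀)) :
    Tendsto (fun i => specSP (hessCoeff (σ i) (w i))) l (𝓝 (specSP (hessCoeff σ₀ w₀))) := by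
  have h := (continuous_specSP_hessCoeff.tendsto (σ₀, w₀)).comp (hσ.prodMk_nhds hw)
  simpa only [Function.comp_def] using h

/-- At a finite endpoint of the maximal family, `ν` tends to zero: otherwise compactness produces a
limiting solution with `ν > 0`, past which the family can be continued. -/
theorem tendsto_specSP_maxPath {θ : ℝ} (hθ : θ < 1) {L : ℝ} (hL : 0 < L)
    (hdom : ∀ t, t ∈ pathDomain θ ↔ 0 ≤ t ∧ t < L) :
    Tendsto (fun t => specSP (hessCoeff (θ, t) (maxPath θ t))) (𝓝[<] L) (𝓝 0) := by
  by_contra hcon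
  rw [Metric.tendsto_nhds] at hcon
  push Not at hcon
  obtain ⟨ε, hε, hfreq⟩ := hcon
  have hev : ∀ᶠ t in 𝓝[<] L, t ∈ Set.Ioo 0 L := Ioo_mem_nhdsLT hL
  obtain ⟨s, hs, hsp⟩ := exists_seq_forall_of_frequently (hfreq.and_eventually hev)
  have hsL : Tendsto s atTop (𝓝 L) := hs.mono_right nhdsWithin_le_nhds
  have hmem (n : ℕ) : s n ∈ pathDomain θ := (hdom _).2 ⟨(hsp n).2.1.le, (hsp n).2.2⟩
  set w : ℕ → X × X := fun n => maxPath θ (s n) with hw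
  have hsol (n : ℕ) : IsNondeg (θ, s n) (w n) :=
    (isPath_maxPath hθ (hmem n)).nondeg _ ⟨(hmem n).1, le_rfl⟩
  have hge (n : ℕ) : ε ≤ specSP (hessCoeff (θ, s n) (w n)) := by
    have := (hsp n).1
    rwa [Real.dist_eq, sub_zero, abs_of_pos (hsol n).2] at this
  obtain ⟨C, hC, hbound⟩ := exists_norm_le_ee θ
  have hwb (n : ℕ) : ‖w n‖ ≤ C * L := by
    refine (hbound _ _ (hsol n).1).trans ?_
    rw [abs_of_pos (hsp n).2.1]
    exact mul_le_mul_of_nonneg_left (hsp n).2.2.le hC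
  obtain ⟨g₁, φ, hφ, hg₁⟩ := exists_subseq_tendsto_prim (w := fun n => (w n).1)
    fun n => (norm_fst_le _).trans (hwb n)
  obtain ⟨g₂, ψ, hψ, hg₂⟩ := exists_subseq_tendsto_prim (w := fun n => (w (φ n)).2)
    fun n => (norm_snd_le _).trans (hwb (φ n))
  set κ : ℕ → ℕ := fun n => φ (ψ n)
  have hκ : Tendsto κ atTop atTop := hφ.tendsto_atTop.comp hψ.tendsto_atTop
  have hg₁' : Tendsto (fun n => prim (w (κ n)).1) atTop (𝓝 g₁) := hg₁.comp hψ.tendsto_atTop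
  have hg₂' : Tendsto (fun n => prim (w (κ n)).2) atTop (𝓝 g₂) := hg₂
  -- the force depends on a solution only through its values
  let E : CI × CI → X × X := fun g =>
    ((1 / 6 : ℝ) • J (grad₁ θ (qPlus θ • 1 + g.1) ((-3 * qPlus θ) • idC + g.2) 0),
      (1 / 2 : ℝ) • J (pot θ (qPlus θ • 1 + g.1) ((-3 * qPlus θ) • idC + g.2) 0
        * ((-3 * qPlus θ) • idC + g.2)))
  have hE : Continuous E := by
    unfold E grad₁ pot rho
    fun_prop
  have hsκ := hsL.comp hκ
  have hlim : Tendsto (fun n => w (κ n)) atTop (𝓝 (-(L ^ 2 • E (g₁, g₂)))) := by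
    refine ((hsκ.pow 2).smul ((hE.tendsto _).comp (hg₁'.prodMk_nhds hg₂'))).neg.congr fun n => ?_
    exact (eq_neg_of_add_eq_zero_left (hsol (κ n)).1).symm
  have hσ : Tendsto (fun n => (θ, s (κ n))) atTop (𝓝 (θ, L)) :=
    tendsto_const_nhds.prodMk_nhds hsκ
  have hnd : IsNondeg (θ, L) (-(L ^ 2 • E (g₁, g₂))) := by
    constructor
    · refine tendsto_nhds_unique (tendsto_residual hσ hlim) ?_
      refine tendsto_const_nhds.congr fun n => ?_
      exact (hsol (κ n)).1.symm
    · refine hε.trans_le (ge_of_tendsto (tendsto_specSP_hessCoeff hσ hlim) ?_)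
      exact Eventually.of_forall fun n => hge (κ n)
  obtain ⟨T, hT, hTmem⟩ := exists_mem_pathDomain_gt hθ hnd (s := fun n => s (κ n))
    (fun n => hmem _) (fun n => (hsp _).2.2.le) hsκ hlim
  exact (((hdom T).1 hTmem).2.trans hT).false

open Classical in
/-- The endpoint of the maximal family. -/
def branchEnd (θ : ℝ) : EReal :=
  if BddAbove (pathDomain θ) then ((sSup (pathDomain θ) : ℝ) : EReal) else ⊤

theorem mem_pathDomain_iff_lt_sSup {θ : ℝ} (hθ : θ < 1) (hb : BddAbove (pathDomain θ)) (t : ℝ) :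
    t ∈ pathDomain θ ↔ 0 ≤ t ∧ t < sSup (pathDomain θ) := by
  constructor
  · intro ht
    obtain ⟨T, hT, hTm⟩ := exists_gt_mem_pathDomain hθ ht
    exact ⟨ht.1, hT.trans_le (le_csSup hb hTm)⟩
  · rintro ⟨h0, hlt⟩
    obtain ⟨T, hTm, hT⟩ := exists_lt_of_lt_csSup ⟨0, zero_mem_pathDomain θ⟩ hlt
    exact mem_pathDomain_of_le hTm h0 hT.le

theorem mem_lengthInterval_branchEnd {θ : ℝ} (hθ : θ < 1) (t : ℝ) :
    t ∈ lengthInterval (branchEnd θ) ↔ 0 < t ∧ t ∈ pathDomain θ := by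
  by_cases hb : BddAbove (pathDomain θ)
  · rw [branchEnd, if_pos hb, mem_pathDomain_iff_lt_sSup hθ hb]
    simp only [lengthInterval, Set.mem_ofPred_eq, EReal.coe_lt_coe_iff]
    exact ⟨fun h => ⟨h.1, h.1.le, h.2⟩, fun h => ⟨h.1, h.2.2⟩⟩
  · rw [branchEnd, if_neg hb]
    simp only [lengthInterval, Set.mem_ofPred_eq, EReal.coe_lt_top, and_true]
    refine ⟨fun h => ⟨h, ?_⟩, fun h => h.1⟩
    obtain ⟨T, hTm, hT⟩ := not_bddAbove_iff.1 hb t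
    exact mem_pathDomain_of_le hTm h.le hT.le

theorem contDiff_eeState (θ : ℝ) {n : WithTop ℕ∞} : ContDiff ℝ n (eeState θ) := by
  unfold eeState
  fun_prop

theorem isCritical_eeConfig_of_residual {θ lam : ℝ} (hl : lam ≠ 0) {w : X × X}
    (hw : residual (θ, lam) w = 0) : IsCritical θ lam (eeConfig (eeState θ w)) := by
  rw [eeConfig_eeState]
  refine (isCritical_iff hl _).2 ⟨_, rfl, ?_⟩
  rw [force_ee]
  exact Prod.ext (congrArg (fun p => p.1) hw) (Prod.ext (congrArg (fun p => p.2) hw) (by simp))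

theorem nu_eq_specSP {lam : ℝ} (hl : lam ≠ 0) (θ : ℝ) (w : X × X) :
    nu θ lam (eeState θ w) = 1 / lam ^ 2 * specSP (hessCoeff (θ, lam) w) := nu_eq hl θ w

/-- The maximal family is the branch of eigenvalue exchange solutions. -/
theorem isEEBranch_maxPath {θ : ℝ} (hθ : θ < 1) :
    IsEEBranch θ (branchEnd θ) fun lam => eeState θ (maxPath θ lam) := by
  have hmem := mem_lengthInterval_branchEnd hθ
  have hnd {t : ℝ} (ht : t ∈ pathDomain θ) : IsNondeg (θ, t) (maxPath θ t) :=
    (isPath_maxPath hθ ht).nondeg t ⟨ht.1, le_rfl⟩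
  refine ⟨?_, fun lam hlam => ?_, fun lam hlam => ?_, fun lam hlam => ?_, ?_⟩
  · obtain ⟨T, hT0, hT⟩ := exists_gt_mem_pathDomain hθ (zero_mem_pathDomain θ)
    obtain ⟨δ, hδ, huniq⟩ := exists_unique_small θ
    refine ⟨min T δ, lt_min hT0 hδ, ?_, ?_⟩
    · have h1 := ((hmem T).2 ⟨hT0, hT⟩).2
      exact (EReal.coe_le_coe_iff.2 (min_le_left T δ)).trans h1.le
    · rintro lam ⟨h0, hlt⟩ q
      have hlm : lam ∈ pathDomain θ :=
        mem_pathDomain_of_le hT h0.le (hlt.le.trans (min_le_left _ _))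
      have hcrit := isCritical_eeConfig_of_residual h0.ne' (hnd hlm).1
      constructor
      · intro hq
        obtain ⟨w, rfl, hw⟩ := (isCritical_iff h0.ne' q).1 hq
        obtain ⟨w', hw', hr⟩ := (isCritical_iff h0.ne' _).1 hcrit
        rw [hw', huniq lam ⟨h0, hlt.trans_le (min_le_right _ _)⟩ w w' hw hr]
      · rintro rfl
        exact hcrit
  · obtain ⟨h0, hm⟩ := (hmem lam).1 hlam
    obtain ⟨u, hu, hEq⟩ := maxPath_eventuallyEq hθ hm h0
    have h1 : ContDiffAt ℝ (⊤ : ℕ∞) (fun t : ℝ => u (θ, t)) lam :=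
      ContDiffAt.comp (f := fun t : ℝ => (θ, t)) lam hu (by fun_prop)
    exact ((contDiff_eeState θ).contDiffAt.comp lam
      (h1.congr_of_eventuallyEq hEq)).contDiffWithinAt
  · obtain ⟨h0, hm⟩ := (hmem lam).1 hlam
    exact (isEECritical_iff h0.ne' _).2 ⟨_, rfl, (hnd hm).1⟩
  · obtain ⟨h0, hm⟩ := (hmem lam).1 hlam
    rw [nu_eq_specSP h0.ne']
    have := (hnd hm).2
    positivity
  · by_cases hb : BddAbove (pathDomain θ)
    · right
      have hdom := mem_pathDomain_iff_lt_sSup hθ hb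
      refine ⟨sSup (pathDomain θ), by rw [branchEnd, if_pos hb], ?_⟩
      have hL : 0 < sSup (pathDomain θ) := ((hdom 0).1 (zero_mem_pathDomain θ)).2
      have h1 := tendsto_specSP_maxPath hθ hL hdom
      have h2 : Tendsto (fun t : ℝ => 1 / t ^ 2) (𝓝[<] sSup (pathDomain θ))
          (𝓝 (1 / sSup (pathDomain θ) ^ 2)) := by
        have : ContinuousAt (fun t : ℝ => 1 / t ^ 2) (sSup (pathDomain θ)) :=
          continuousAt_const.div (by fun_prop) (pow_ne_zero 2 hL.ne')
        exact this.tendsto.mono_left nhdsWithin_le_nhds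
      have h3 := h2.mul h1
      rw [mul_zero] at h3
      refine h3.congr' ?_
      filter_upwards [Ioo_mem_nhdsLT hL] with t ht
      rw [nu_eq_specSP ht.1.ne']
    · left
      rw [branchEnd, if_neg hb]

/-! ### Uniqueness of the branch -/

theorem norm_sub_le_eeState (θ : ℝ) (w w' : X × X) :
    ‖w - w'‖ ≤ ‖eeState θ w - eeState θ w'‖ := by
  have hemb (v : X) : ‖v‖ ≤ ‖emb v‖ := norm_snd_le (emb v : CI × L2)
  have h : eeState θ w - eeState θ w' = (emb (w.1 - w'.1), emb (w.2 - w'.2)) := by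
    simp [eeState]
  rw [h, Prod.norm_def, Prod.norm_def]
  exact max_le_max (hemb _) (hemb _)

/-- Every branch in the sense of `IsEEBranch` is a continuous family of solutions starting at
`λ = 0`; continuity at `0` follows from the a priori bound. -/
theorem IsEEBranch.exists_isPath {θ : ℝ} {Λ : EReal} {χ : ℝ → H1 × H1} (h : IsEEBranch θ Λ χ) :
    ∃ γ : ℝ → X × X, (∀ lam ∈ lengthInterval Λ, χ lam = eeState θ (γ lam)) ∧
      ∀ S ∈ lengthInterval Λ, IsPath θ S γ := by
  classical
  have hex : ∀ lam ∈ lengthInterval Λ, ∃ w, χ lam = eeState θ w ∧ residual (θ, lam) w = 0 :=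
    fun lam hlam => (isEECritical_iff hlam.1.ne' _).1 (h.solution lam hlam)
  choose! v hv hres using hex
  set γ : ℝ → X × X := fun t => if t ∈ lengthInterval Λ then v t else 0 with hγ
  have hγv {t : ℝ} (ht : t ∈ lengthInterval Λ) : γ t = v t := if_pos ht
  have hγ0 : γ 0 = 0 := if_neg fun h0 => lt_irrefl _ h0.1
  obtain ⟨C, hC, hbound⟩ := exists_norm_le_ee θ
  refine ⟨γ, fun lam hlam => by rw [hγv hlam, hv lam hlam], fun S hS => ?_⟩
  have hsub {t : ℝ} (h0 : 0 < t) (ht : t ≤ S) : t ∈ lengthInterval Λ :=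
    ⟨h0, (EReal.coe_le_coe_iff.2 ht).trans_lt hS.2⟩
  refine ⟨fun t ht => ?_, fun t ht => ?_⟩
  · rcases ht.1.eq_or_lt with rfl | h0
    · rw [ContinuousWithinAt, hγ0, tendsto_zero_iff_norm_tendsto_zero]
      have hlim : Tendsto (fun t : ℝ => C * |t|) (𝓝[Set.Icc 0 S] 0) (𝓝 0) := by
        have : ContinuousAt (fun t : ℝ => C * |t|) 0 := by fun_prop
        simpa using this.tendsto.mono_left nhdsWithin_le_nhds
      refine squeeze_zero' (Eventually.of_forall fun _ => norm_nonneg _) ?_ hlim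
      filter_upwards [self_mem_nhdsWithin] with s hs
      rcases hs.1.eq_or_lt with rfl | h0
      · simp [hγ0]
      · rw [hγv (hsub h0 hs.2)]
        exact hbound s _ (hres s (hsub h0 hs.2))
    · have hχ : ContinuousWithinAt χ (lengthInterval Λ) t :=
        h.smooth.continuousOn t (hsub h0 ht.2)
      have hnhds : lengthInterval Λ ∈ 𝓝[Set.Icc 0 S] t := by
        filter_upwards [self_mem_nhdsWithin, nhdsWithin_le_nhds (Ioi_mem_nhds h0)] with s hs h0
        exact hsub h0 hs.2
      have hχ' : Tendsto χ (𝓝[Set.Icc 0 S] t) (𝓝 (χ t)) :=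
        hχ.mono_left (nhdsWithin_le_of_mem hnhds)
      rw [ContinuousWithinAt, tendsto_iff_norm_sub_tendsto_zero]
      refine squeeze_zero' (Eventually.of_forall fun _ => norm_nonneg _) ?_
        (tendsto_iff_norm_sub_tendsto_zero.1 hχ')
      filter_upwards [hnhds] with s hs
      rw [hγv hs, hγv (hsub h0 ht.2), hv s hs, hv t (hsub h0 ht.2)]
      exact norm_sub_le_eeState θ _ _
  · rcases ht.1.eq_or_lt with rfl | h0
    · rw [hγ0]; exact isNondeg_zero θ
    · have hm := hsub h0 ht.2
      rw [hγv hm]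
      refine ⟨hres t hm, ?_⟩
      have := h.nu_pos t hm
      rw [hv t hm, nu_eq_specSP h0.ne'] at this
      exact pos_of_mul_pos_right this (by positivity)

/-- A branch contains every continuous family of solutions with `ν > 0` starting at `λ = 0`. -/
theorem IsEEBranch.eq_eeState {θ : ℝ} (hθ : θ < 1) {Λ : EReal} {χ : ℝ → H1 × H1}
    (h : IsEEBranch θ Λ χ) {S : ℝ} {γ : ℝ → X × X} (hγ : IsPath θ S γ) :
    (S : EReal) < Λ ∧ ∀ lam ∈ Set.Ioc 0 S, χ lam = eeState θ (γ lam) := by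
  obtain ⟨γ', hχ, hγ'⟩ := h.exists_isPath
  have hagree {t : ℝ} (ht : t ∈ lengthInterval Λ) (htS : t ≤ S) : χ t = eeState θ (γ t) := by
    rw [hχ t ht, (hγ' t ht).eqOn hθ (hγ.mono htS) ⟨ht.1.le, le_rfl⟩]
  have hlt : (S : EReal) < Λ := by
    rcases h.endpoint with rfl | ⟨L, rfl, hlim⟩
    · exact EReal.coe_lt_top S
    by_contra hcon
    have hLS : L ≤ S := EReal.coe_le_coe_iff.1 (not_lt.1 hcon)
    obtain ⟨lam₀, h0, hle, -⟩ := h.starts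
    have hL : 0 < L := h0.trans_le (EReal.coe_le_coe_iff.1 hle)
    have hnd := hγ.nondeg L ⟨hL.le, hLS⟩
    -- along the branch, `λ² ν(λ)` converges to the positive value attained by `γ`
    have h1 : Tendsto (fun t : ℝ => t ^ 2 * nu θ t (χ t)) (𝓝[<] L) (𝓝 (L ^ 2 * 0)) := by
      have : Tendsto (fun t : ℝ => t ^ 2) (𝓝[<] L) (𝓝 (L ^ 2)) :=
        (continuousAt_id.pow 2).tendsto.mono_left nhdsWithin_le_nhds
      exact this.mul hlim
    have hIoo : Set.Ioo 0 L ∈ 𝓝[<] L := Ioo_mem_nhdsLT hL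
    have h2 : Tendsto (fun t : ℝ => specSP (hessCoeff (θ, t) (γ t))) (𝓝[<] L)
        (𝓝 (specSP (hessCoeff (θ, L) (γ L)))) := by
      have hc : Tendsto γ (𝓝[<] L) (𝓝 (γ L)) := by
        refine (hγ.cont L ⟨hL.le, hLS⟩).mono_left (nhdsWithin_le_of_mem ?_)
        filter_upwards [hIoo] with t ht
        exact ⟨ht.1.le, ht.2.le.trans hLS⟩
      have hσ : Tendsto (fun t => (θ, t)) (𝓝[<] L) (𝓝 (θ, L)) :=
        tendsto_const_nhds.prodMk_nhds (tendsto_nhdsWithin_of_tendsto_nhds tendsto_id)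
      exact tendsto_specSP_hessCoeff hσ hc
    have h3 : (fun t : ℝ => t ^ 2 * nu θ t (χ t)) =ᶠ[𝓝[<] L]
        fun t : ℝ => specSP (hessCoeff (θ, t) (γ t)) := by
      filter_upwards [hIoo] with t ht
      rw [hagree ⟨ht.1, EReal.coe_lt_coe_iff.2 ht.2⟩ (ht.2.le.trans hLS), nu_eq_specSP ht.1.ne']
      rw [← mul_assoc, mul_one_div_cancel (pow_ne_zero 2 ht.1.ne'), one_mul]
    have := tendsto_nhds_unique (h1.congr' h3) h2
    rw [mul_zero] at this
    exact hnd.2.ne this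
  exact ⟨hlt, fun lam hlam =>
    hagree ⟨hlam.1, (EReal.coe_le_coe_iff.2 hlam.2).trans_lt hlt⟩ hlam.2⟩

/-! ### The symmetry-breaking eigenvalue along the branch -/

/-- `λ² μ / 2` at the configuration with derivatives `w`, for `σ = (θ, λ)`. Unlike `μ`, it is
continuous up to `λ = 0`. -/
def scaledMu (σ : ℝ × ℝ) (w : X × X) : ℝ := specSB ((σ.2 ^ 2 / 2) • potSB σ.1 w)

theorem mu_eq_scaledMu {lam : ℝ} (hl : lam ≠ 0) (θ : ℝ) (w : X × X) :
    mu θ lam (eeState θ w) = 2 / lam ^ 2 * scaledMu (θ, lam) w := mu_eq hl θ w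

theorem scaledMu_zero_pos (θ : ℝ) (w : X × X) : 0 < scaledMu (θ, 0) w := by
  simpa [scaledMu] using specSB_zero_pos

theorem mu_neg_iff {lam : ℝ} (hl : lam ≠ 0) (θ : ℝ) (w : X × X) :
    mu θ lam (eeState θ w) < 0 ↔ scaledMu (θ, lam) w < 0 := by
  rw [mu_eq_scaledMu hl]
  have : 0 < 2 / lam ^ 2 := by positivity
  constructor <;> intro h <;> nlinarith

theorem mu_pos_iff {lam : ℝ} (hl : lam ≠ 0) (θ : ℝ) (w : X × X) :
    0 < mu θ lam (eeState θ w) ↔ 0 < scaledMu (θ, lam) w := by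
  rw [mu_eq_scaledMu hl]
  exact mul_pos_iff_of_pos_left (by positivity)

theorem contDiffAt_scaledMu {p : (ℝ × ℝ) × (X × X)} (hp : p.1.1 < 1) :
    ContDiffAt ℝ 1 (fun p : (ℝ × ℝ) × (X × X) => scaledMu p.1 p.2) p := by
  have h1 : ContDiffAt ℝ 1 (fun p : (ℝ × ℝ) × (X × X) =>
      (p.1.2 ^ 2 / 2) • potSB p.1.1 p.2) p := by
    have h2 := contDiffAt_potSB (n := 1) hp
    have h3 : ContDiffAt ℝ 1 (fun p : (ℝ × ℝ) × (X × X) => p.1.2 ^ 2 / 2) p := by fun_prop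
    exact h3.smul h2
  exact contDiff_specSB.contDiffAt.comp p h1

theorem continuous_scaledMu : Continuous (fun p : (ℝ × ℝ) × (X × X) => scaledMu p.1 p.2) := by
  have h1 : Continuous (fun p : (ℝ × ℝ) × (X × X) => (p.1.2 ^ 2 / 2) • potSB p.1.1 p.2) := by
    have h2 : Continuous (fun p : (ℝ × ℝ) × (X × X) => p.1.2 ^ 2 / 2) := by fun_prop
    exact h2.smul continuous_potSB
  exact continuous_specSB.comp h1

theorem IsPath.continuousOn_scaledMu {θ S : ℝ} {γ : ℝ → X × X} (h : IsPath θ S γ) :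
    ContinuousOn (fun t => scaledMu (θ, t) (γ t)) (Set.Icc 0 S) := by
  have h1 : ContinuousOn (fun t => ((θ, t), γ t)) (Set.Icc 0 S) :=
    ContinuousOn.prodMk (by fun_prop) h.cont
  have h2 := continuous_scaledMu.comp_continuousOn h1
  simpa only [Function.comp_def] using h2

/-- A negative partial derivative of a `C¹` function stays negative nearby. -/
theorem eventually_deriv_neg {G : ℝ × ℝ → ℝ} {σ₀ : ℝ × ℝ} (hG : ContDiffAt ℝ 1 G σ₀)
    (hneg : deriv (fun t => G (σ₀.1, t)) σ₀.2 < 0) :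
    ∀ᶠ σ in 𝓝 σ₀, DifferentiableAt ℝ (fun t => G (σ.1, t)) σ.2 ∧
      deriv (fun t => G (σ.1, t)) σ.2 < 0 := by
  have key {σ : ℝ × ℝ} (h : DifferentiableAt ℝ G σ) :
      HasDerivAt (fun t => G (σ.1, t)) (fderiv ℝ G σ (0, 1)) σ.2 :=
    h.hasFDerivAt.comp_hasDerivAt (f := fun t : ℝ => (σ.1, t)) σ.2
      ((hasDerivAt_const _ _).prodMk (hasDerivAt_id _))
  rw [(key (hG.differentiableAt one_ne_zero)).deriv] at hneg
  have hc : ContinuousAt (fun σ => fderiv ℝ G σ (0, 1)) σ₀ :=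
    (hG.continuousAt_fderiv one_ne_zero).clm_apply continuousAt_const
  filter_upwards [hc.eventually_lt_const hneg, hG.eventually (by simp)] with σ h1 h2
  have h := key (h2.differentiableAt one_ne_zero)
  exact ⟨h.differentiableAt, by rwa [h.deriv]⟩

/-! ### The first loss of stability -/

/-- Along the branch, the critical length is a zero of `μ`: at `λ = 0` the scaled eigenvalue is
positive, and the branch continues past the critical length. -/
theorem exists_transversal_zero {θ : ℝ} (hθ : θ < 1)
    (h : BifurcationConditions θ (branchEnd θ) fun lam => eeState θ (maxPath θ lam)) :
    ∃ lc S, 0 < lc ∧ lc < S ∧ S ∈ pathDomain θ ∧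
      (∀ t ∈ Set.Ico 0 lc, 0 < scaledMu (θ, t) (maxPath θ t)) ∧
      scaledMu (θ, lc) (maxPath θ lc) = 0 ∧
      deriv (fun lam => mu θ lam (eeState θ (maxPath θ lam))) lc < 0 := by
  set Bad : Set ℝ := {lam | lam ∈ lengthInterval (branchEnd θ) ∧
    mu θ lam (eeState θ (maxPath θ lam)) < 0} with hBad
  set lc := sInf Bad with hlc
  have hbdd : BddBelow Bad := ⟨0, fun t ht => ht.1.1.le⟩
  obtain ⟨T, hT, hTneg⟩ := h.exists_neg
  have hlcT : lc ≤ T := csInf_le hbdd ⟨hT, hTneg⟩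
  have hlc0 : 0 ≤ lc := Real.sInf_nonneg fun t ht => ht.1.1.le
  obtain ⟨S, hTS, hS⟩ := exists_gt_mem_pathDomain hθ ((mem_lengthInterval_branchEnd hθ T).1 hT).2
  have hcont := (isPath_maxPath hθ hS).continuousOn_scaledMu
  set b : ℝ → ℝ := fun t => scaledMu (θ, t) (maxPath θ t) with hb
  have hlcS : lc < S := hlcT.trans_lt hTS
  have hle : b lc ≤ 0 := by
    by_contra hcon
    have hev : ∀ᶠ t in 𝓝[Set.Icc 0 S] lc, 0 < b t :=
      (hcont lc ⟨hlc0, hlcS.le⟩).eventually_const_lt (not_le.1 hcon)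
    have hev' : ∀ᶠ t in 𝓝[≥] lc, 0 < b t :=
      hev.filter_mono (nhdsWithin_le_of_mem (mem_of_superset (Icc_mem_nhdsGE hlcS)
        (Set.Icc_subset_Icc_left hlc0)))
    obtain ⟨ε, hε, hεb⟩ := mem_nhdsGE_iff_exists_Ico_subset.1 hev'
    obtain ⟨x, hx, hxε⟩ := exists_lt_of_csInf_lt (s := Bad) ⟨T, hT, hTneg⟩
      (show sInf Bad < ε from hε)
    exact lt_asymm (hεb ⟨csInf_le hbdd hx, hxε⟩) ((mu_neg_iff hx.1.1.ne' _ _).1 hx.2)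
  have hlcpos : 0 < lc := by
    rcases hlc0.eq_or_lt with h0 | h0
    · have hpos := scaledMu_zero_pos θ (maxPath θ 0)
      rw [← h0] at hle
      exact absurd hle (not_le.2 hpos)
    · exact h0
  have hpos : ∀ t ∈ Set.Ico 0 lc, 0 < b t := fun t ht => by
    rcases ht.1.eq_or_lt with rfl | h0
    · exact scaledMu_zero_pos θ _
    · exact (mu_pos_iff h0.ne' _ _).1 (h.pos_before t ⟨h0, ht.2⟩)
  refine ⟨lc, S, hlcpos, hlcS, hS, hpos, le_antisymm hle ?_, h.deriv_neg⟩
  have hlim : Tendsto b (𝓝[<] lc) (𝓝 (b lc)) :=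
    (hcont.continuousAt (Icc_mem_nhds hlcpos hlcS)).tendsto.mono_left nhdsWithin_le_nhds
  refine ge_of_tendsto hlim ?_
  filter_upwards [Ioo_mem_nhdsLT hlcpos] with t ht
  exact (hpos t ⟨ht.1.le, ht.2⟩).le

/-- If `μ` is positive up to `a`, and strictly decreasing from there to a negative value, then every
branch at this temperature loses stability in the sense of `BifurcationConditions`. -/
theorem IsPath.bifurcationConditions {θ a S : ℝ} (hθ : θ < 1) (ha : 0 < a) (haS : a < S)
    {γ : ℝ → X × X} (hγ : IsPath θ S γ) (hpos : ∀ t ∈ Set.Icc 0 a, 0 < scaledMu (θ, t) (γ t))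
    (hneg : scaledMu (θ, S) (γ S) < 0) {g : ℝ → ℝ}
    (hg : ∀ t ∈ Set.Icc a S, mu θ t (eeState θ (γ t)) = g t)
    (hg' : ∀ t ∈ Set.Icc a S, DifferentiableAt ℝ g t ∧ deriv g t < 0)
    {Λ : EReal} {χ : ℝ → H1 × H1} (h : IsEEBranch θ Λ χ) : BifurcationConditions θ Λ χ := by
  obtain ⟨hSΛ, hχ⟩ := h.eq_eeState hθ hγ
  have hS : 0 < S := ha.trans haS
  have hgc : ContinuousOn g (Set.Icc a S) := fun t ht =>
    (hg' t ht).1.continuousAt.continuousWithinAt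
  have hanti : StrictAntiOn g (Set.Icc a S) :=
    strictAntiOn_of_deriv_neg (convex_Icc a S) hgc fun t ht => (hg' t (interior_subset ht)).2
  have hga : 0 < g a := by
    rw [← hg a ⟨le_rfl, haS.le⟩]
    exact (mu_pos_iff ha.ne' _ _).2 (hpos a ⟨ha.le, le_rfl⟩)
  have hgS : g S < 0 := by
    rw [← hg S ⟨haS.le, le_rfl⟩]
    exact (mu_neg_iff hS.ne' _ _).2 hneg
  obtain ⟨z, ⟨haz, hzS⟩, hz⟩ := intermediate_value_Ioo' haS.le hgc ⟨hgS, hga⟩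
  have hzI : z ∈ Set.Icc a S := ⟨haz.le, hzS.le⟩
  have hmug {t : ℝ} (ht : t ∈ Set.Icc a S) : mu θ t (χ t) = g t := by
    rw [hχ t ⟨ha.trans_le ht.1, ht.2⟩, hg t ht]
  have hbefore {t : ℝ} (h0 : 0 < t) (ht : t < z) : 0 < mu θ t (χ t) := by
    rcases le_total t a with hta | hat
    · rw [hχ t ⟨h0, hta.trans haS.le⟩, mu_pos_iff h0.ne']
      exact hpos t ⟨h0.le, hta⟩
    · have htI : t ∈ Set.Icc a S := ⟨hat, (ht.trans hzS).le⟩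
      rw [hmug htI, ← hz]
      exact hanti htI hzI ht
  have hafter {t : ℝ} (hzt : z < t) (htS : t ≤ S) :
      t ∈ lengthInterval Λ ∧ mu θ t (χ t) < 0 := by
    have htI : t ∈ Set.Icc a S := ⟨(haz.trans hzt).le, htS⟩
    refine ⟨⟨ha.trans (haz.trans hzt), (EReal.coe_le_coe_iff.2 htS).trans_lt hSΛ⟩, ?_⟩
    rw [hmug htI, ← hz]
    exact hanti hzI htI hzt
  have hcrit : criticalLength θ Λ χ = z := by
    refine csInf_eq_of_forall_ge_of_forall_gt_exists_lt ⟨S, hafter hzS le_rfl⟩ (fun t ht => ?_)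
      fun y hy => ?_
    · exact not_lt.1 fun htz => lt_asymm ht.2 (hbefore ht.1.1 htz)
    · obtain ⟨t, hzt, ht⟩ := exists_between (lt_min hy hzS)
      exact ⟨t, hafter hzt (ht.le.trans (min_le_right _ _)), ht.trans_le (min_le_left _ _)⟩
  refine ⟨⟨S, hafter hzS le_rfl⟩, fun t ht => ?_, ?_⟩
  · rw [hcrit] at ht
    exact hbefore ht.1 ht.2
  · rw [hcrit]
    have hEq : (fun t => mu θ t (χ t)) =ᶠ[𝓝 z] g := by
      filter_upwards [Icc_mem_nhds haz hzS] with t ht using hmug ht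
    rw [hEq.deriv_eq]
    exact (hg' z hzI).2

/-- A transversal zero of `μ` along the branch persists at nearby temperatures. -/
theorem eventually_bifurcationConditions {θ₀ : ℝ} (hθ₀ : θ₀ < 1)
    (h : BifurcationConditions θ₀ (branchEnd θ₀) fun lam => eeState θ₀ (maxPath θ₀ lam)) :
    ∀ᶠ θ in 𝓝 θ₀, ∀ (Λ : EReal) (χ : ℝ → H1 × H1), IsEEBranch θ Λ χ →
      BifurcationConditions θ Λ χ := by
  obtain ⟨lc, S₀, hlc, hlcS, hS₀, hpos, hzero, hderiv⟩ := exists_transversal_zero hθ₀ h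
  have hpath := isPath_maxPath hθ₀ hS₀
  set γ₀ := maxPath θ₀ with hγ₀
  have hc₀ : ContinuousAt γ₀ lc := hpath.cont.continuousAt (Icc_mem_nhds hlc hlcS)
  obtain ⟨u, hu0, hu, huniq, -⟩ := (hpath.nondeg lc ⟨hlc.le, hlcS.le⟩).exists_local' hθ₀
  -- `μ` along the local solutions, as a `C¹` function of `(θ, λ)`
  set G : ℝ × ℝ → ℝ := fun σ => 2 / σ.2 ^ 2 * scaledMu σ (u σ) with hG
  have hGc : ContDiffAt ℝ 1 G (θ₀, lc) := by
    have h1 : ContDiffAt ℝ 1 (fun σ : ℝ × ℝ => 2 / σ.2 ^ 2) (θ₀, lc) :=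
      contDiffAt_const.div (by fun_prop) (pow_ne_zero 2 hlc.ne')
    have h2 : ContDiffAt ℝ 1 (fun σ : ℝ × ℝ => (σ, u σ)) (θ₀, lc) :=
      contDiffAt_id.prodMk (hu.of_le (by exact_mod_cast le_top))
    exact h1.mul (ContDiffAt.comp (f := fun σ : ℝ × ℝ => (σ, u σ)) (θ₀, lc)
      (contDiffAt_scaledMu hθ₀) h2)
  have hmuG {θ t : ℝ} (ht : 0 < t) {w : X × X} (hw : w = u (θ, t)) :
      mu θ t (eeState θ w) = G (θ, t) := by
    rw [mu_eq_scaledMu ht.ne', hw]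
  have hpair : Tendsto (fun t => ((θ₀, t), γ₀ t)) (𝓝 lc) (𝓝 ((θ₀, lc), γ₀ lc)) :=
    (tendsto_const_nhds.prodMk_nhds tendsto_id).prodMk_nhds hc₀
  have hGneg : deriv (fun t => G (θ₀, t)) lc < 0 := by
    have hEq : (fun t => mu θ₀ t (eeState θ₀ (γ₀ t))) =ᶠ[𝓝 lc] fun t => G (θ₀, t) := by
      filter_upwards [hpair.eventually huniq, Icc_mem_nhds hlc hlcS, Ioi_mem_nhds hlc]
        with t h1 h2 h3
      exact hmuG h3 (h1 (hpath.nondeg t h2).1)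
    rwa [← hEq.deriv_eq]
  obtain ⟨r₁, hr₁, hball₁⟩ := Metric.eventually_nhds_iff.1 (eventually_deriv_neg hGc hGneg)
  obtain ⟨r₂, hr₂, hball₂⟩ := Metric.eventually_nhds_iff.1 huniq
  set r := min r₁ r₂ with hr
  have hr0 : 0 < r := lt_min hr₁ hr₂
  obtain ⟨δ₁, hδ₁, hδγ⟩ := Metric.continuousAt_iff.1 hc₀ (r / 2) (half_pos hr0)
  obtain ⟨δ, hδ0, hδ⟩ := exists_between
    (show 0 < min (min r δ₁) (min lc (S₀ - lc)) from
      lt_min (lt_min hr0 hδ₁) (lt_min hlc (sub_pos.2 hlcS)))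
  obtain ⟨⟨hδr, hδδ₁⟩, hδlc, hδS⟩ : (δ < r ∧ δ < δ₁) ∧ δ < lc ∧ δ < S₀ - lc := by
    simpa only [lt_min_iff] using hδ
  set a := lc - δ with ha
  set S := lc + δ with hS
  have hSS₀ : S ≤ S₀ := by linarith
  have hdist {t : ℝ} (ht : t ∈ Set.Icc a S) : dist t lc ≤ δ := by
    rw [Real.dist_eq, abs_le]
    constructor <;> linarith [ht.1, ht.2]
  have hGd {θ t : ℝ} (hθ : dist θ θ₀ < r) (ht : t ∈ Set.Icc a S) :
      DifferentiableAt ℝ (fun s => G (θ, s)) t ∧ deriv (fun s => G (θ, s)) t < 0 :=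
    hball₁ (y := (θ, t)) ((max_lt hθ ((hdist ht).trans_lt hδr)).trans_le (min_le_left _ _))
  have hloc {θ t : ℝ} (hθ : dist θ θ₀ < r) (ht : t ∈ Set.Icc a S) {v : X × X}
      (hv : ‖v - γ₀ t‖ < r / 2) (hres : residual (θ, t) v = 0) : v = u (θ, t) := by
    refine hball₂ (y := ((θ, t), v)) ?_ hres
    refine (max_lt (max_lt hθ ((hdist ht).trans_lt hδr)) ?_).trans_le (min_le_right _ _)
    have h1 := dist_triangle v (γ₀ t) (γ₀ lc)
    have h2 := hδγ ((hdist ht).trans_lt hδδ₁)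
    rw [← dist_eq_norm] at hv
    show dist v (γ₀ lc) < r
    linarith
  have ha0 : 0 < a := sub_pos.2 hδlc
  have haS : a < S := by linarith
  have hlcI : lc ∈ Set.Icc a S := ⟨by linarith, by linarith⟩
  have hp := hpath.mono hSS₀
  have hG₀ {t : ℝ} (ht : t ∈ Set.Icc a S) : mu θ₀ t (eeState θ₀ (γ₀ t)) = G (θ₀, t) :=
    hmuG (ha0.trans_le ht.1) (hloc (by simpa using hr0) ht (by simpa using half_pos hr0)
      (hp.nondeg t ⟨ha0.le.trans ht.1, ht.2⟩).1)
  have hneg : scaledMu (θ₀, S) (γ₀ S) < 0 := by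
    have hSI : S ∈ Set.Icc a S := ⟨haS.le, le_rfl⟩
    rw [← mu_neg_iff (ha0.trans haS).ne', hG₀ hSI]
    have hanti : StrictAntiOn (fun t => G (θ₀, t)) (Set.Icc a S) :=
      strictAntiOn_of_deriv_neg (convex_Icc a S)
        (fun t ht => (hGd (by simpa using hr0) ht).1.continuousAt.continuousWithinAt)
        fun t ht => (hGd (by simpa using hr0) (interior_subset ht)).2
    have h1 := hanti hlcI hSI (by linarith)
    have h2 : G (θ₀, lc) = 0 := by rw [← hG₀ hlcI, mu_eq_scaledMu hlc.ne', hzero, mul_zero]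
    simpa only [h2] using h1
  -- the signs of `μ` on `[0, a]` and at `S` are stable
  have hS0 : 0 ≤ S := (ha0.trans haS).le
  have hΓ := hp.continuous_comp_projIcc hS0
  have hΓeq {t : ℝ} (ht : t ∈ Set.Icc 0 S) : γ₀ (Set.projIcc 0 S hS0 t) = γ₀ t := by
    rw [Set.projIcc_of_mem hS0 ht]
  have haI {t : ℝ} (ht : t ∈ Set.Icc 0 a) : t ∈ Set.Icc 0 S := ⟨ht.1, ht.2.trans haS.le⟩
  obtain ⟨η₁, hη₁, hev₁⟩ := exists_uniform_nhds (isCompact_Icc (a := 0) (b := a)) hΓ (θ₀ := θ₀)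
    (Q := fun σ v => 0 < scaledMu σ v) fun t ht => by
      rw [hΓeq (haI ht)]
      exact continuous_scaledMu.continuousAt.eventually_const_lt
        (hpos t ⟨ht.1, ht.2.trans_lt (by linarith)⟩)
  obtain ⟨η₂, hη₂, hev₂⟩ := exists_uniform_nhds (isCompact_singleton (x := S)) hΓ (θ₀ := θ₀)
    (Q := fun σ v => scaledMu σ v < 0) fun t ht => by
      obtain rfl : t = S := ht
      rw [hΓeq ⟨hS0, le_rfl⟩]
      exact continuous_scaledMu.continuousAt.eventually_lt_const hneg
  have hη : 0 < min (min η₁ η₂) (r / 2) := lt_min (lt_min hη₁ hη₂) (half_pos hr0)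
  filter_upwards [hev₁, hev₂, hp.eventually_exists hθ₀ hS0 hη, eventually_lt_nhds hθ₀,
    Metric.ball_mem_nhds θ₀ hr0] with θ h1 h2 h3 hθ hθr Λ χ hχ
  obtain ⟨γ, hγ, hclose⟩ := h3
  have hcl {t : ℝ} (ht : t ∈ Set.Icc 0 S) :
      (‖γ t - γ₀ t‖ < η₁ ∧ ‖γ t - γ₀ t‖ < η₂) ∧ ‖γ t - γ₀ t‖ < r / 2 := by
    simpa only [lt_min_iff] using hclose t ht
  refine hγ.bifurcationConditions hθ ha0 haS (fun t ht => ?_) ?_ (g := fun t => G (θ, t))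
    (fun t ht => ?_) (fun t ht => hGd hθr ht) hχ
  · refine h1 t ht _ ?_
    rw [hΓeq (haI ht)]
    exact (hcl (haI ht)).1.1
  · refine h2 S rfl _ ?_
    rw [hΓeq ⟨hS0, le_rfl⟩]
    exact (hcl ⟨hS0, le_rfl⟩).1.2
  · have htI : t ∈ Set.Icc 0 S := ⟨ha0.le.trans ht.1, ht.2⟩
    exact hmuG (ha0.trans_le ht.1) (hloc hθr ht (hcl htI).2 (hγ.nondeg t htI).1)

end FrustratedCell

end

theorem mainTheorem5 (θ₀ : ℝ) (hθ₀ : θ₀ < 1)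
    (h : ∀ (Λ : EReal) (χ : ℝ → FrustratedCell.H1 × FrustratedCell.H1),
      FrustratedCell.IsEEBranch θ₀ Λ χ → FrustratedCell.BifurcationConditions θ₀ Λ χ) :
    ∃ ε > 0, ∀ θ : ℝ, θ < 1 → |θ - θ₀| < ε →
      (∃ (Λ : EReal) (χ : ℝ → FrustratedCell.H1 × FrustratedCell.H1),
        FrustratedCell.IsEEBranch θ Λ χ) ∧
      ∀ (Λ : EReal) (χ : ℝ → FrustratedCell.H1 × FrustratedCell.H1),
        FrustratedCell.IsEEBranch θ Λ χ → FrustratedCell.BifurcationConditions θ Λ χ := by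
  have hev := FrustratedCell.eventually_bifurcationConditions hθ₀
    (h _ _ (FrustratedCell.isEEBranch_maxPath hθ₀))
  obtain ⟨ε, hε, hball⟩ := Metric.eventually_nhds_iff.1 hev
  exact ⟨ε, hε, fun θ hθ hd =>
    ⟨⟨_, _, FrustratedCell.isEEBranch_maxPath hθ⟩, hball (by rwa [Real.dist_eq])⟩⟩
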